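/- **Setting.** Continuous logic in a countable, possibly many-sorted language $\mathcal L$ with at least one sort. Structures are nonempty, metrically complete and of bounded diameter in every sort; symbols have prescribed moduli of uniform continuity and predicates prescribed compact ranges. Formulas have finitely many free variables, and all continuous $F:\mathbb R^k\to\mathbb R$ and $F:\mathbb R^\omega\to\mathbb R$ are connectives. A theory $T$ is a set of conditions $\sigma\le 0$ with $\sigma$ a sentence. Relations between $\mathfrak M,\mathfrak N$, density, tuples, separability and quantifiers are understood sort by sort; corresponding entries of two tuples have the same sorts. **Distortion systems.** A set $\Delta$ of formulas is a *distortion system for $T$* if it is logically complete (the values of the formulas of $\Delta$ at a finite tuple of a model of $T$ determine its type) and closed under renaming variables (including identifying variables and adding dummy ones), quantification, connectives $\mathbb R^k\to\mathbb R$ that are $1$-Lipschitz for the max metric, logical equivalence modulo $T$, and uniformly convergent limits. For a relation $R$ between $\mathfrak M$ and $\mathfrak N$, $$\mathrm{dis}_\Delta(R)=\sup\{|\varphi^{\mathfrak M}(\bar m)-\varphi^{\mathfrak N}(\bar n)|:\varphi\in\Delta,\ (\bar m,\bar n)\in R\}\in[0,\infty].$$ A *correlation* is a total surjective relation; an *almost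 correlation* is a correlation between dense sub-pre-structures. Put $\rho_\Delta(\mathfrak M,\mathfrak N)=\inf\{\mathrm{dis}_\Delta(R): R \text{ a correlation between } \mathfrak M \text{ and } \mathfrak N\}$. $\Delta$ is *u.u.c.* if for every $\varepsilon>0$ there is $\delta>0$ such that for all models $\mathfrak M,\mathfrak N$ of $T$ and all almost correlations $R$ between them, $\mathrm{dis}_\Delta(R^{<\delta})\le\mathrm{dis}_\Delta(R)+\varepsilon$, where $R^{<\delta}=\{(a,b):\exists (c,e)\in R,\ d(a,c)<\delta,\ d(b,e)<\delta\}$. $\Delta$ is *functional* if there is $\varepsilon>0$ such that for all models $\mathfrak M,\mathfrak N$ of $T$ every closed almost correlation $R$ between them with $\mathrm{dis}_\Delta(R)<\varepsilon$ is, in each sort, the graph of a uniformly continuous bijection with uniformly continuous inverse. **Weak moduli.** A *weak modulus* is a function $\Omega:[0,\infty)^{\mathbb N}\to[0,\infty]$ that is non-decreasing, subadditive, lower semicontinuous for the product topology, continuous in each argument, and satisfies $\Omega(0)=0$. It is *shift increasing* if $\Omega(\delta)\le\Omega(\delta')$ whenever $j_0<j_1<\cdots$, $\delta'_{j_i}=\delta_i$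 for all $i$, and $\delta'_k=0$ for all other $k$. A formula $\varphi(x_n,\dots,x_{n+k-1})$ *respects* $\Omega$ in $\mathfrak M$ if $|\varphi^{\mathfrak M}(\bar a)-\varphi^{\mathfrak M}(\bar b)|\le\Omega(0,\dots,0,d(a_0,b_0),\dots,d(a_{k-1},b_{k-1}),0,0,\dots)$, with $n$ leading zeros, for all $\bar a,\bar b$; if $n$ is not mentioned, $n=0$. Call $\Omega$ *suitable* for $\Delta$ if it is shift increasing and at least one of the following holds: * $\Delta$ is u.u.c., and every $\varphi\in\Delta$ that takes values in $[0,1]$ in all models of $T$ respects $\Omega$ in all models of $T$; * $\Delta$ is functional, and $\Delta$ has a subset $D$, countable and dense for the uniform norm over models of $T$ (among the formulas with the same free variables), such that for each $\varphi\in D$ there is an $n$ for which $\varphi(x_n,x_{n+1},\dots)$ respects $\Omega$ in all models of $T$. **Back-and-forth.** For tuples of length $n$, let $r_0(\mathfrak M,\bar m;\mathfrak N,\bar n)=\sup|\psi^{\mathfrak M}(\bar m)-\psi^{\mathfrak N}(\bar n)|$ over the $\psi\in\Delta$ that respect $\Omega$ in every $\mathcal L$-structure; $$r_{\alpha+1}(\mathfrak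 M,\bar m;\mathfrak N,\bar n)=\max\Bigl(\sup_{a\in\mathfrak M}\inf_{b\in\mathfrak N}r_\alpha(\mathfrak M,\bar ma;\mathfrak N,\bar nb),\ \sup_{b\in\mathfrak N}\inf_{a\in\mathfrak M}r_\alpha(\mathfrak M,\bar ma;\mathfrak N,\bar nb)\Bigr),$$ where $a,b$ have the same sort; and $r_\lambda=\sup_{\alpha<\lambda}r_\alpha$ for limit $\lambda$. The *$(\Delta,\Omega)$-Scott rank* $\alpha_{\mathfrak M}$ is the least $\alpha$ with $r_\alpha(\mathfrak M,\bar m;\mathfrak M,\bar n)=r_{\alpha+1}(\mathfrak M,\bar m;\mathfrak M,\bar n)$ for all finite tuples $\bar m,\bar n$ of $\mathfrak M$. **Infinitary formulas.** The $\mathcal L^{\Delta,\Omega}_{\omega_1\omega}$-formulas $\varphi$ in variables $x_0,\dots,x_{n-1}$ and their syntactic ranges $I(\varphi)$ are generated as follows. Formulas of $\Delta$ respecting $\Omega$ in every $\mathcal L$-structure belong, with $I(\varphi)$ the closed convex hull of the set of all values. If $\varphi_i$ ($i$ in a countable set) belong and $I$ is a nonempty compact interval with $I=\overline{\bigcup_iI(\varphi_i)}$,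 then $\sup_i\varphi_i$ and $\inf_i\varphi_i$ belong, with range $I$. If $\varphi(x_0,\dots,x_n)$ belongs, so do $\sup_{x_n}\varphi$ and $\inf_{x_n}\varphi$, with range $I(\varphi)$. If $\varphi_1,\dots,\varphi_k$ belong and $F:\mathbb R^k\to\mathbb R$ is $1$-Lipschitz for the max metric, then $F(\varphi_1,\dots,\varphi_k)$ belongs, with range $F(I(\varphi_1)\times\dots\times I(\varphi_k))$. **Scott sentence.** Let $\mathfrak M\models T$ be separable with sequences $(a^s_i)_{i<\omega}$ dense in each sort $s$. For each list of sorts of variables $x_0,\dots,x_{n-1}$, let $(\psi_i)_{i<\omega}$ be a sequence of formulas of $\Delta$ in these variables that respect $\Omega$ in every $\mathcal L$-structure, dense among all such formulas for the uniform norm over models of $T$. Put $$\varphi_{0,\mathfrak M,\bar m}=\sup_i\min\bigl(|\psi_i^{\mathfrak M}(\bar m)-\psi_i(\bar x)|,1\bigr),\qquad \varphi_{\lambda,\mathfrak M,\bar m}=\sup_{\alpha<\lambda}\varphi_{\alpha,\mathfrak M,\bar m}\ \ (\lambda\text{ limit}),$$ $$\varphi_{\alpha+1,\mathfrak M,\bar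 m}=\max\Bigl(\sup_{s,i}\inf_{x_n:s}\varphi_{\alpha,\mathfrak M,\bar ma^s_i},\ \sup_s\sup_{x_n:s}\inf_i\varphi_{\alpha,\mathfrak M,\bar ma^s_i}\Bigr),$$ and, with $\alpha=\alpha_{\mathfrak M}$, $$\sigma_{\mathfrak M}=\max\Bigl(\varphi_{\alpha,\mathfrak M,\varnothing},\ \sup_{\bar a}\ \sup_{x_0,\dots,x_{n-1}}\tfrac12|\varphi_{\alpha,\mathfrak M,\bar a}-\varphi_{\alpha+1,\mathfrak M,\bar a}|\Bigr),$$ where $\bar a$ ranges over all finite tuples (of any length $n$) of elements $a^s_i$. **Theorem.** Let $\Delta$ be a distortion system for $T$ that is u.u.c. or functional. Then there is a weak modulus suitable for $\Delta$. For every suitable $\Omega$, sequences $(\psi_i)$ as above exist, and for every choice of them, every separable $\mathfrak M\models T$ and every choice of the dense sequences $(a_i^s)$, $\sigma_{\mathfrak M}$ is an $\mathcal L^{\Delta,\Omega}_{\omega_1\omega}$-sentence, and for every separable $\mathfrak N\models T$, $$\mathfrak N\models\sigma_{\mathfrak M}\le0\iff\rho_\Delta(\mathfrak M,\mathfrak N)=0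 .$$ -/

import Mathlib

open scoped NNReal ENNReal

namespace MetricLogic

/-! ## Languages, structures, formulas -/

/-- A (many-sorted) signature of continuous logic. Every sort comes with a bound on the diameter of
its metric, every function and relation symbol with a modulus of uniform continuity, and every
relation symbol with a compact interval in which it takes its values. -/
structure Language where
  Sorts : Type
  Func : Type
  Rel : Type
  diam : Sorts → ℝ
  funArity : Func → ℕ
  funDom : (f : Func) → Fin (funArity f) → Sorts
  funCod : Func → Sorts
  funMod : Func → ℝ → ℝ
  funMod_pos : ∀ f, ∀ ε > 0, 0 < funMod f ε
  relArity : Rel → ℕ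
  relDom : (P : Rel) → Fin (relArity P) → Sorts
  relMod : Rel → ℝ → ℝ
  relMod_pos : ∀ P, ∀ ε > 0, 0 < relMod P ε
  relLo : Rel → ℝ
  relHi : Rel → ℝ

/-- An `L`-structure: every sort is a nonempty complete metric space of bounded diameter, and the
symbols are interpreted by functions obeying the prescribed bounds and moduli. -/
structure Structure (L : Language) where
  carrier : L.Sorts → Type
  [metric : ∀ s, MetricSpace (carrier s)]
  [complete : ∀ s, CompleteSpace (carrier s)]
  [nonempty : ∀ s, Nonempty (carrier s)]
  dist_le : ∀ s (x y : carrier s), dist x y ≤ L.diam s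
  funMap : (f : L.Func) → ((i : Fin (L.funArity f)) → carrier (L.funDom f i)) → carrier (L.funCod f)
  fun_unif : ∀ f, ∀ ε > 0, ∀ x y, (∀ i, dist (x i) (y i) < L.funMod f ε) →
    dist (funMap f x) (funMap f y) ≤ ε
  relMap : (P : L.Rel) → ((i : Fin (L.relArity P)) → carrier (L.relDom P i)) → ℝ
  rel_mem : ∀ P x, relMap P x ∈ Set.Icc (L.relLo P) (L.relHi P)
  rel_unif : ∀ P, ∀ ε > 0, ∀ x y, (∀ i, dist (x i) (y i) < L.relMod P ε) →
    |relMap P x - relMap P y| ≤ ε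

attribute [instance] Structure.metric Structure.complete Structure.nonempty

/-- Variables of sort `s` in a context. A context `[sₙ₋₁, …, s₀]` lists the sorts of the variables
`xₙ₋₁, …, x₀`, the most recent variable first; so the head variable of `s :: Γ` is `xₙ` with
`n = Γ.length`. For a one-sorted language, contexts are just arities. -/
inductive Var {S : Type} : List S → S → Type
  | head {Γ : List S} {s : S} : Var (s :: Γ) s
  | tail {Γ : List S} {s t : S} (x : Var Γ s) : Var (t :: Γ) s

/-- Tuples of elements of `M` whose sorts are given by a context. -/
def Structure.Env {L : Language} (M : Structure L) : List L.Sorts → Type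
  | [] => Unit
  | s :: Γ => M.carrier s × M.Env Γ

/-- The value of a variable. -/
def Structure.Env.lookup {L : Language} {M : Structure L} :
    {Γ : List L.Sorts} → {s : L.Sorts} → M.Env Γ → Var Γ s → M.carrier s
  | _, _, v, .head => v.1
  | _, _, v, .tail x => Structure.Env.lookup v.2 x

/-- Terms. -/
inductive Term (L : Language) (Γ : List L.Sorts) : L.Sorts → Type
  | var {s : L.Sorts} (x : Var Γ s) : Term L Γ s
  | app (f : L.Func) (ts : (i : Fin (L.funArity f)) → Term L Γ (L.funDom f i)) :
      Term L Γ (L.funCod f)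

/-- First-order formulas of continuous logic with free variables in a finite context. Arbitrary
continuous functions `ℝᵏ → ℝ` and `ℝ^ω → ℝ` are allowed as connectives. The quantifiers bind the
last variable of the context. -/
inductive Formula (L : Language) : List L.Sorts → Type
  | dist {Γ : List L.Sorts} {s : L.Sorts} (t u : Term L Γ s) : Formula L Γ
  | rel {Γ : List L.Sorts} (P : L.Rel)
      (ts : (i : Fin (L.relArity P)) → Term L Γ (L.relDom P i)) : Formula L Γ
  | conn {Γ : List L.Sorts} {k : ℕ} (F : C(Fin k → ℝ, ℝ)) (φ : Fin k → Formula L Γ) : Formula L Γ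
  | connω {Γ : List L.Sorts} (F : C(ℕ → ℝ, ℝ)) (φ : ℕ → Formula L Γ) : Formula L Γ
  | sup {Γ : List L.Sorts} {s : L.Sorts} (φ : Formula L (s :: Γ)) : Formula L Γ
  | inf {Γ : List L.Sorts} {s : L.Sorts} (φ : Formula L (s :: Γ)) : Formula L Γ

/-- Interpretation of terms. -/
def Term.eval {L : Language} (M : Structure L) {Γ : List L.Sorts} (v : M.Env Γ) :
    {s : L.Sorts} → Term L Γ s → M.carrier s
  | _, .var x => v.lookup x
  | _, .app f ts => M.funMap f fun i => (ts i).eval M v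

/-- Interpretation of formulas, `φ.eval M m = φ^M(m)`. -/
noncomputable def Formula.eval {L : Language} (M : Structure L) :
    {Γ : List L.Sorts} → Formula L Γ → M.Env Γ → ℝ
  | _, .dist t u, v => Dist.dist (t.eval M v) (u.eval M v)
  | _, .rel P ts, v => M.relMap P fun i => (ts i).eval M v
  | _, .conn F φ, v => F fun i => (φ i).eval M v
  | _, .connω F φ, v => F fun i => (φ i).eval M v
  | _, .sup (s := s) φ, v => ⨆ a : M.carrier s, φ.eval M (a, v)
  | _, .inf (s := s) φ, v => ⨅ a : M.carrier s, φ.eval M (a, v)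

/-- Renamings of variables: sort-preserving maps, possibly identifying variables or adding dummy
ones. -/
def Renaming {S : Type} (Γ Γ' : List S) : Type := (s : S) → Var Γ s → Var Γ' s

/-- A renaming acting under a quantifier. -/
def Renaming.lift {S : Type} {Γ Γ' : List S} (f : Renaming Γ Γ') (t : S) :
    Renaming (t :: Γ) (t :: Γ')
  | _, .head => .head
  | s, .tail x => .tail (f s x)

def Term.rename {L : Language} {Γ Γ' : List L.Sorts} (f : Renaming Γ Γ') :
    {s : L.Sorts} → Term L Γ s → Term L Γ' s
  | s, .var x => .var (f s x)
  | _, .app g ts => .app g fun i => (ts i).rename f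

def Formula.rename {L : Language} :
    {Γ : List L.Sorts} → Formula L Γ → {Γ' : List L.Sorts} → Renaming Γ Γ' → Formula L Γ'
  | _, .dist t u, _, f => .dist (t.rename f) (u.rename f)
  | _, .rel P ts, _, f => .rel P fun i => (ts i).rename f
  | _, .conn F φ, _, f => .conn F fun i => (φ i).rename f
  | _, .connω F φ, _, f => .connω F fun i => (φ i).rename f
  | _, .sup (s := s) φ, _, f => .sup (φ.rename (f.lift s))
  | _, .inf (s := s) φ, _, f => .inf (φ.rename (f.lift s))

/-- A theory is a set of sentences `σ`, read as the conditions `σ ≤ 0`. -/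
abbrev Theory (L : Language) := Set (Formula L [])

def Structure.Models {L : Language} (M : Structure L) (T : Theory L) : Prop :=
  ∀ σ ∈ T, σ.eval M () ≤ 0

def Structure.Separable {L : Language} (M : Structure L) : Prop :=
  ∀ s, TopologicalSpace.SeparableSpace (M.carrier s)

/-! ## Correlations, distortion -/

/-- Collections of formulas, sorted by their contexts. -/
abbrev FormulaSet (L : Language) := (Γ : List L.Sorts) → Set (Formula L Γ)

/-- Relations between `M` and `N`: subsets of the sort-by-sort product. -/
abbrev Relation {L : Language} (M N : Structure L) :=
  (s : L.Sorts) → Set (M.carrier s × N.carrier s)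

/-- `(m, n) ∈ R` for tuples `m` and `n` of the same sorts. -/
def Relation.Holds {L : Language} {M N : Structure L} (R : Relation M N) :
    {Γ : List L.Sorts} → M.Env Γ → N.Env Γ → Prop
  | [], _, _ => True
  | s :: _, m, n => (m.1, n.1) ∈ R s ∧ R.Holds m.2 n.2

/-- The domain and the range of a relation, sort by sort. -/
def Relation.dom {L : Language} {M N : Structure L} (R : Relation M N) (s : L.Sorts) :
    Set (M.carrier s) := {a | ∃ b, (a, b) ∈ R s}

def Relation.ran {L : Language} {M N : Structure L} (R : Relation M N) (s : L.Sorts) :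
    Set (N.carrier s) := {b | ∃ a, (a, b) ∈ R s}

/-- A correlation is a relation that is total and surjective in every sort. -/
def Relation.IsCor {L : Language} {M N : Structure L} (R : Relation M N) : Prop :=
  ∀ s, R.dom s = Set.univ ∧ R.ran s = Set.univ

/-- `A` is (the universe of) a dense sub-pre-structure of `M`. -/
def Structure.IsDenseSub {L : Language} (M : Structure L)
    (A : (s : L.Sorts) → Set (M.carrier s)) : Prop :=
  (∀ s, Dense (A s)) ∧ ∀ f x, (∀ i, x i ∈ A (L.funDom f i)) → M.funMap f x ∈ A (L.funCod f)

/-- An almost correlation is a correlation between dense sub-pre-structures. -/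
def Relation.IsAlmostCor {L : Language} {M N : Structure L} (R : Relation M N) : Prop :=
  M.IsDenseSub R.dom ∧ N.IsDenseSub R.ran

/-- The distortion of `R` with respect to `Δ`, in `[0, ∞]`. -/
noncomputable def distortion {L : Language} (Δ : FormulaSet L) {M N : Structure L}
    (R : Relation M N) : ℝ≥0∞ :=
  ⨆ (Γ : List L.Sorts) (φ ∈ Δ Γ) (m : M.Env Γ) (n : N.Env Γ) (_ : R.Holds m n),
    edist (φ.eval M m) (φ.eval N n)

/-- The `Δ`-distance between `M` and `N`, in `[0, ∞]`. -/
noncomputable def rho {L : Language} (Δ : FormulaSet L) (M N : Structure L) : ℝ≥0∞ :=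
  ⨅ (R : Relation M N) (_ : R.IsCor), distortion Δ R

/-- `φ` and `ψ` differ by at most `ε` in every model of `T`. -/
def CloseMod {L : Language} (T : Theory L) (ε : ℝ) {Γ : List L.Sorts} (φ ψ : Formula L Γ) : Prop :=
  ∀ M : Structure L, M.Models T → ∀ m : M.Env Γ, |φ.eval M m - ψ.eval M m| ≤ ε

/-- The values of formulas of `Δ` determine the types of finite tuples in models of `T`. -/
def LogicallyComplete {L : Language} (T : Theory L) (Δ : FormulaSet L) : Prop :=
  ∀ M N : Structure L, M.Models T → N.Models T → ∀ Γ (m : M.Env Γ) (n : N.Env Γ),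
    (∀ φ ∈ Δ Γ, φ.eval M m = φ.eval N n) → ∀ φ : Formula L Γ, φ.eval M m = φ.eval N n

/-- Distortion systems for `T`. `Fin k → ℝ` carries the max metric. -/
structure IsDistortionSystem {L : Language} (T : Theory L) (Δ : FormulaSet L) : Prop where
  complete : LogicallyComplete T Δ
  rename : ∀ {Γ Γ'} (f : Renaming Γ Γ'), ∀ φ ∈ Δ Γ, φ.rename f ∈ Δ Γ'
  sup : ∀ {Γ s}, ∀ φ ∈ Δ (s :: Γ), φ.sup ∈ Δ Γ
  inf : ∀ {Γ s}, ∀ φ ∈ Δ (s :: Γ), φ.inf ∈ Δ Γ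
  conn : ∀ {Γ} {k : ℕ} (F : C(Fin k → ℝ, ℝ)), LipschitzWith 1 F →
    ∀ φ : Fin k → Formula L Γ, (∀ i, φ i ∈ Δ Γ) → Formula.conn F φ ∈ Δ Γ
  equiv : ∀ {Γ} (φ ψ : Formula L Γ), φ ∈ Δ Γ → CloseMod T 0 φ ψ → ψ ∈ Δ Γ
  limit : ∀ {Γ} (φ : ℕ → Formula L Γ) (ψ : Formula L Γ), (∀ i, φ i ∈ Δ Γ) →
    (∀ ε > 0, ∃ k, ∀ i ≥ k, CloseMod T ε (φ i) ψ) → ψ ∈ Δ Γ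

/-- The relation `R^{<δ}`. -/
def Relation.thicken {L : Language} {M N : Structure L} (R : Relation M N) (δ : ℝ) :
    Relation M N :=
  fun s => {p | ∃ q ∈ R s, dist p.1 q.1 < δ ∧ dist p.2 q.2 < δ}

/-- Uniformly uniformly continuous. -/
def UUC {L : Language} (T : Theory L) (Δ : FormulaSet L) : Prop :=
  ∀ ε : ℝ≥0, 0 < ε → ∃ δ > 0, ∀ M N : Structure L, M.Models T → N.Models T →
    ∀ R : Relation M N, R.IsAlmostCor → distortion Δ (R.thicken δ) ≤ distortion Δ R + ε

/-- Functional: closed almost correlations of small distortion are graphs of uniformly continuous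
bijections with uniformly continuous inverses. -/
def Functional {L : Language} (T : Theory L) (Δ : FormulaSet L) : Prop :=
  ∃ ε : ℝ≥0, 0 < ε ∧ ∀ M N : Structure L, M.Models T → N.Models T →
    ∀ R : Relation M N, R.IsAlmostCor → (∀ s, IsClosed (R s)) → distortion Δ R < ε →
      ∀ s, ∃ e : M.carrier s ≃ᵤ N.carrier s, ∀ a b, (a, b) ∈ R s ↔ e a = b

/-! ## Weak moduli -/

/-- Weak moduli. -/
structure WeakModulus where
  toFun : (ℕ → ℝ≥0) → ℝ≥0∞
  mono : Monotone toFun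
  subadd : ∀ δ ε, toFun (δ + ε) ≤ toFun δ + toFun ε
  zero : toFun 0 = 0
  lsc : LowerSemicontinuous toFun
  cont : ∀ δ i, Continuous fun t => toFun (Function.update δ i t)

/-- Moving arguments to later positions (and putting `0` elsewhere) does not decrease `Ω`. -/
def WeakModulus.ShiftIncreasing (Ω : WeakModulus) : Prop :=
  ∀ j : ℕ → ℕ, StrictMono j → ∀ δ, Ω.toFun δ ≤ Ω.toFun (Function.extend j δ 0)

/-- The sequence of the distances of the entries of two tuples, continued by `0`; the entry for the
variable `xᵢ` is at position `i`. -/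
noncomputable def Structure.distSeq {L : Language} (M : Structure L) :
    {Γ : List L.Sorts} → M.Env Γ → M.Env Γ → ℕ → ℝ≥0
  | [], _, _ => 0
  | _ :: Γ, m, m' => Function.update (M.distSeq m.2 m'.2) Γ.length (nndist m.1 m'.1)

/-- `φ(xₙ, xₙ₊₁, …)` respects `Ω` in `M`. -/
def Formula.RespectsFrom {L : Language} (Ω : WeakModulus) (n : ℕ) (M : Structure L)
    {Γ : List L.Sorts} (φ : Formula L Γ) : Prop :=
  ∀ m m' : M.Env Γ, edist (φ.eval M m) (φ.eval M m') ≤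
    Ω.toFun (Function.extend (fun i => i + n) (M.distSeq m m') 0)

/-- `φ(x₀, x₁, …)` respects `Ω` in every `L`-structure. -/
def Formula.Respects {L : Language} (Ω : WeakModulus) {Γ : List L.Sorts} (φ : Formula L Γ) : Prop :=
  ∀ (M : Structure L) (m m' : M.Env Γ), edist (φ.eval M m) (φ.eval M m') ≤ Ω.toFun (M.distSeq m m')

/-- Suitable weak moduli for u.u.c. `Δ`: in models of `T`, every formula of `Δ` with values in
`[0, 1]` respects `Ω`. -/
def SuitableUUC {L : Language} (T : Theory L) (Δ : FormulaSet L) (Ω : WeakModulus) : Prop :=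
  ∀ Γ, ∀ φ ∈ Δ Γ,
    (∀ M : Structure L, M.Models T → ∀ m : M.Env Γ, φ.eval M m ∈ Set.Icc (0 : ℝ) 1) →
    ∀ M : Structure L, M.Models T → φ.RespectsFrom Ω 0 M

/-- Suitable weak moduli for functional `Δ`: there is a countable subset of `Δ`, dense in the
uniform norm over models of `T`, such that for each of its members `φ` there is an `n` for which
`φ(xₙ, xₙ₊₁, …)` respects `Ω` in models of `T`. -/
def SuitableFunctional {L : Language} (T : Theory L) (Δ : FormulaSet L) (Ω : WeakModulus) : Prop :=
  ∃ D : FormulaSet L, (∀ Γ, (D Γ).Countable ∧ D Γ ⊆ Δ Γ) ∧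
    (∀ Γ, ∀ φ ∈ Δ Γ, ∀ ε > 0, ∃ ψ ∈ D Γ, CloseMod T ε φ ψ) ∧
    ∀ Γ, ∀ φ ∈ D Γ, ∃ n, ∀ M : Structure L, M.Models T → φ.RespectsFrom Ω n M

/-- `Δ` is u.u.c. or functional, and `Ω` is a shift increasing weak modulus suitable for it. -/
def Suitable {L : Language} (T : Theory L) (Δ : FormulaSet L) (Ω : WeakModulus) : Prop :=
  Ω.ShiftIncreasing ∧
    (UUC T Δ ∧ SuitableUUC T Δ Ω ∨ Functional T Δ ∧ SuitableFunctional T Δ Ω)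

/-! ## Back-and-forth pseudo-metrics and Scott rank -/

/-- The back-and-forth pseudo-metrics `r_α(M, m; N, n)`, in `[0, ∞]`. -/
noncomputable def backForth {L : Language} (Δ : FormulaSet L) (Ω : WeakModulus)
    (M N : Structure L) (α : Ordinal.{0}) : (Γ : List L.Sorts) → M.Env Γ → N.Env Γ → ℝ≥0∞ :=
  Ordinal.limitRecOn (motive := fun _ => (Γ : List L.Sorts) → M.Env Γ → N.Env Γ → ℝ≥0∞) α
    (fun Γ m n => ⨆ (ψ ∈ Δ Γ) (_ : ψ.Respects Ω), edist (ψ.eval M m) (ψ.eval N n))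
    (fun _ r Γ m n =>
      (⨆ (s : L.Sorts) (a : M.carrier s), ⨅ b : N.carrier s, r (s :: Γ) (a, m) (b, n)) ⊔
        ⨆ (s : L.Sorts) (b : N.carrier s), ⨅ a : M.carrier s, r (s :: Γ) (a, m) (b, n))
    (fun l _ r Γ m n => ⨆ (β : Ordinal.{0}) (h : β < l), r β h Γ m n)

/-- The `(Δ, Ω)`-Scott rank of `M`. -/
noncomputable def scottRank {L : Language} (Δ : FormulaSet L) (Ω : WeakModulus)
    (M : Structure L) : Ordinal.{0} :=
  sInf {α | ∀ Γ (m n : M.Env Γ),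
    backForth Δ Ω M M α Γ m n = backForth Δ Ω M M (α + 1) Γ m n}

/-! ## Infinitary formulas -/

/-- Infinitary formulas, before the restrictions that define `𝓛_{ω₁ω}^{Δ,Ω}` are imposed. -/
inductive InfFormula (L : Language) : List L.Sorts → Type 1
  | base {Γ : List L.Sorts} (φ : Formula L Γ) : InfFormula L Γ
  | conn {Γ : List L.Sorts} {k : ℕ} (F : (Fin k → ℝ) → ℝ) (φ : Fin k → InfFormula L Γ) :
      InfFormula L Γ
  | seqSup {Γ : List L.Sorts} {ι : Type} (φ : ι → InfFormula L Γ) : InfFormula L Γ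
  | seqInf {Γ : List L.Sorts} {ι : Type} (φ : ι → InfFormula L Γ) : InfFormula L Γ
  | sup {Γ : List L.Sorts} {s : L.Sorts} (φ : InfFormula L (s :: Γ)) : InfFormula L Γ
  | inf {Γ : List L.Sorts} {s : L.Sorts} (φ : InfFormula L (s :: Γ)) : InfFormula L Γ

/-- Interpretation of infinitary formulas. -/
noncomputable def InfFormula.eval {L : Language} (M : Structure L) :
    {Γ : List L.Sorts} → InfFormula L Γ → M.Env Γ → ℝ
  | _, .base φ, v => φ.eval M v
  | _, .conn F φ, v => F fun i => (φ i).eval M v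
  | _, .seqSup φ, v => ⨆ i, (φ i).eval M v
  | _, .seqInf φ, v => ⨅ i, (φ i).eval M v
  | _, .sup (s := s) φ, v => ⨆ a : M.carrier s, φ.eval M (a, v)
  | _, .inf (s := s) φ, v => ⨅ a : M.carrier s, φ.eval M (a, v)

/-- The syntactic range of a first-order formula: the closed convex hull of its possible values. -/
def Formula.range {L : Language} {Γ : List L.Sorts} (φ : Formula L Γ) : Set ℝ :=
  closure (convexHull ℝ {r | ∃ (M : Structure L) (m : M.Env Γ), φ.eval M m = r})

/-- `IsLωω Δ Ω φ I`: `φ` is an `𝓛_{ω₁ω}^{Δ,Ω}`-formula with syntactic range `I`. -/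
inductive IsLωω {L : Language} (Δ : FormulaSet L) (Ω : WeakModulus) :
    {Γ : List L.Sorts} → InfFormula L Γ → Set ℝ → Prop
  | base {Γ : List L.Sorts} (φ : Formula L Γ) (hφ : φ ∈ Δ Γ) (hΩ : φ.Respects Ω) :
      IsLωω Δ Ω (.base φ) φ.range
  | seqSup {Γ : List L.Sorts} {ι : Type} [Countable ι] (φ : ι → InfFormula L Γ) (I : ι → Set ℝ)
      (hφ : ∀ i, IsLωω Δ Ω (φ i) (I i)) (a b : ℝ) (hab : a ≤ b)
      (hI : Set.Icc a b = closure (⋃ i, I i)) : IsLωω Δ Ω (.seqSup φ) (Set.Icc a b)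
  | seqInf {Γ : List L.Sorts} {ι : Type} [Countable ι] (φ : ι → InfFormula L Γ) (I : ι → Set ℝ)
      (hφ : ∀ i, IsLωω Δ Ω (φ i) (I i)) (a b : ℝ) (hab : a ≤ b)
      (hI : Set.Icc a b = closure (⋃ i, I i)) : IsLωω Δ Ω (.seqInf φ) (Set.Icc a b)
  | sup {Γ : List L.Sorts} {s : L.Sorts} (φ : InfFormula L (s :: Γ)) (I : Set ℝ)
      (hφ : IsLωω Δ Ω φ I) : IsLωω Δ Ω (.sup φ) I
  | inf {Γ : List L.Sorts} {s : L.Sorts} (φ : InfFormula L (s :: Γ)) (I : Set ℝ)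
      (hφ : IsLωω Δ Ω φ I) : IsLωω Δ Ω (.inf φ) I
  | conn {Γ : List L.Sorts} {k : ℕ} (F : (Fin k → ℝ) → ℝ) (hF : LipschitzWith 1 F)
      (φ : Fin k → InfFormula L Γ) (I : Fin k → Set ℝ) (hφ : ∀ i, IsLωω Δ Ω (φ i) (I i)) :
      IsLωω Δ Ω (.conn F φ) (F '' Set.univ.pi I)

/-! ## Scott sentences -/

/-- `ψ Γ 0, ψ Γ 1, …` are formulas of `Δ` in the context `Γ` respecting `Ω`, dense among all of
these in the uniform norm over models of `T`. -/
def IsDenseFamily {L : Language} (T : Theory L) (Δ : FormulaSet L) (Ω : WeakModulus)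
    (ψ : (Γ : List L.Sorts) → ℕ → Formula L Γ) : Prop :=
  ∀ Γ, (∀ i, ψ Γ i ∈ Δ Γ ∧ (ψ Γ i).Respects Ω) ∧
    ∀ φ ∈ Δ Γ, φ.Respects Ω → ∀ ε > 0, ∃ i, CloseMod T ε φ (ψ Γ i)

/-- The maximum of two infinitary formulas. -/
noncomputable def InfFormula.max {L : Language} {Γ : List L.Sorts} (φ χ : InfFormula L Γ) :
    InfFormula L Γ :=
  .conn (fun t : Fin 2 → ℝ => Max.max (t 0) (t 1)) ![φ, χ]

/-- The formulas `φ_{α,M,m}`, built from an enumeration `a` of a dense part of `M` and from the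
formulas `ψ`; they express `min (r_α(M, m; N, n)) 1` in models `N` of `T`. -/
noncomputable def scottFormula {L : Language} (M : Structure L)
    (a : (s : L.Sorts) → ℕ → M.carrier s) (ψ : (Γ : List L.Sorts) → ℕ → Formula L Γ)
    (α : Ordinal.{0}) : (Γ : List L.Sorts) → M.Env Γ → InfFormula L Γ :=
  Ordinal.limitRecOn (motive := fun _ => (Γ : List L.Sorts) → M.Env Γ → InfFormula L Γ) α
    (fun Γ m => .seqSup fun i : ℕ =>
      .conn (fun t : Fin 1 → ℝ => min |(ψ Γ i).eval M m - t 0| 1) ![.base (ψ Γ i)])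
    (fun _ φ Γ m => .max
      (.seqSup fun p : L.Sorts × ℕ => .inf (φ (p.1 :: Γ) (a p.1 p.2, m)))
      (.seqSup fun s : L.Sorts => .sup (.seqInf fun i : ℕ => φ (s :: Γ) (a s i, m))))
    (fun l _ φ Γ m => .seqSup fun i : l.ToType =>
      φ (Ordinal.ToType.mk.symm i).1 (Ordinal.ToType.mk.symm i).2 Γ m)

/-- Universal closure: `sup` over all variables. -/
def InfFormula.supAll {L : Language} : {Γ : List L.Sorts} → InfFormula L Γ → InfFormula L []
  | [], φ => φ
  | _ :: _, φ => InfFormula.supAll φ.sup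

/-- The finite tuples with entries in the enumerated part of `M`. -/
def tupleOf {L : Language} {M : Structure L} (a : (s : L.Sorts) → ℕ → M.carrier s) :
    (l : List (L.Sorts × ℕ)) → M.Env (l.map Prod.fst)
  | [] => ()
  | p :: l => (a p.1 p.2, tupleOf a l)

/-- The `(Δ, Ω)`-Scott sentence `σ_M`, built from `a` and `ψ`. -/
noncomputable def scottSentence {L : Language} (Δ : FormulaSet L) (Ω : WeakModulus)
    (M : Structure L) (a : (s : L.Sorts) → ℕ → M.carrier s)
    (ψ : (Γ : List L.Sorts) → ℕ → Formula L Γ) : InfFormula L [] :=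
  .max (scottFormula M a ψ (scottRank Δ Ω M) [] ())
    (.seqSup fun l : List (L.Sorts × ℕ) => InfFormula.supAll <|
      .conn (fun t : Fin 2 → ℝ => 1 / 2 * |t 0 - t 1|)
        ![scottFormula M a ψ (scottRank Δ Ω M) (l.map Prod.fst) (tupleOf a l),
          scottFormula M a ψ (scottRank Δ Ω M + 1) (l.map Prod.fst) (tupleOf a l)])

end MetricLogic

/-!
Scott analysis for distortion systems in continuous logic.

*Meaning of the Scott sentence.* The back-and-forth pseudo-metrics `r_α` satisfy the triangle
inequality and respect the weak modulus `Ω`, hence are determined by their values on tuples from dense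
sequences. So `φ_{α,M,m}` takes the value `min (r_α(M, m; N, n)) 1` at `n` (`eval_scottFormula`), the
Scott rank `α` of a separable `M` is countable (`exists_scottRank`), and `σ_M ≤ 0` holds in `N` if and
only if `r_α(M; N) = 0` and `min r_α 1 = min r_{α+1} 1` between tuples of `M` from the dense sequences
and tuples of `N` (`eval_scottSentence_nonpos_iff`).

*From distance zero to the Scott sentence.* A correlation answers all moves of the game, so `r_α` is
at most its distortion (`backForth_le_distortion`). If `ρ_Δ(M, N) = 0`, tuples of `N` therefore have
arbitrarily good copies in `M`, and the triangle inequality carries the stability of `r_α` over from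
`M` to the pair `M, N` (`backForth_add_one_le_of_rho`).

*From the Scott sentence to distance zero.* If `r_α(M; N) = 0` and `r_{α+1} ≤ r_α` where `r_α < 1`,
countable dense sub-pre-structures of both models are exhausted by a sequence of pairs all of whose
initial segments have `r_0 < ε` (`exists_backForth_sequence`). Formulas `φ` of `Δ` that respect `Ω` only
in models of `T` are treated by truncating them to `[0, 1]` and passing to
`inf_y (φ(y) + min (Ω(d(x, y))) 1)`, which is equivalent modulo `T` and respects `Ω` everywhere
(`IsDistortionSystem.abs_sub_le`).

If `Δ` is u.u.c., the pairs of the sequence form an almost correlation of distortion at most `ε`, and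
a thickening of it is a correlation (`distortion_seqRelation_le`).

If `Δ` is functional, a formula of the dense set `D` respects `Ω` only after a shift of its variables by
some `n`, so the sequence controls it on tuples of pairs that are listed with increasing indices at
least `n` (`Listed.abs_sub_le`); here shift increasingness is used. In ultrapowers of `M` and `N`
over `ℕ`, consider the ultralimits of subsequences of pairs. Finitely many of these have their indices
ordered by the ultrafilter and tending to infinity, so the resulting relation, and its closure, has
distortion at most `ε` (`distortion_ultraRelation_le`). As `Δ` is functional, the closure is the graph
of a bijection. Hence far parts of the sequence behave like a uniformly continuous bijection with
uniformly continuous inverse (`exists_tail_uniform`), and by completeness of `M` and `N` the pairs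
approximated by arbitrarily late pairs of the sequence form a correlation, again of distortion at
most `ε` (`Functional.rho_le`).

*Existence of weak moduli.* In the u.u.c. case, thickening the identity shows that the `[0, 1]`-valued
formulas of `Δ` have a common modulus of continuity (`UUC.exists_suitable`). In general, formulas are
separable in the uniform norm, and the moduli of countably many formulas can be combined into one weak
modulus if the `n`-th formula may be shifted by `n` (`exists_suitableFunctional`).
-/

namespace MetricLogic

variable {L : Language}

/-! ### Environments, variables and renaming -/

/-- Pulling back an environment along a renaming of variables. -/
def Structure.Env.comap {M : Structure L} {Γ' : List L.Sorts} :
    {Γ : List L.Sorts} → Renaming Γ Γ' → M.Env Γ' → M.Env Γ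
  | [], _, _ => ()
  | s :: _, f, v => (v.lookup (f s .head), Structure.Env.comap (fun t x => f t x.tail) v)

lemma Structure.Env.lookup_comap {M : Structure L} {Γ Γ' : List L.Sorts} (f : Renaming Γ Γ')
    (v : M.Env Γ') {s : L.Sorts} (x : Var Γ s) : (v.comap f).lookup x = v.lookup (f s x) := by
  induction x with
  | head => rfl
  | tail x ih => exact ih (fun t y => f t y.tail)

lemma Structure.Env.ext {M : Structure L} : ∀ {Γ : List L.Sorts} {v w : M.Env Γ},
    (∀ (s : L.Sorts) (x : Var Γ s), v.lookup x = w.lookup x) → v = w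
  | [], _, _, _ => rfl
  | s :: _, _, _, h =>
    Prod.ext (h s .head) (Structure.Env.ext fun t x => h t x.tail)

lemma Structure.Env.comap_lift {M : Structure L} {Γ Γ' : List L.Sorts} (f : Renaming Γ Γ')
    {s : L.Sorts} (a : M.carrier s) (v : M.Env Γ') :
    Structure.Env.comap (M := M) (Γ := s :: Γ) (f.lift s) (a, v) = (a, v.comap f) := by
  refine Structure.Env.ext fun t x => ?_
  refine (Structure.Env.lookup_comap (M := M) (f.lift s) _ x).trans ?_
  cases x with
  | head => rfl
  | tail x => exact (Structure.Env.lookup_comap f v x).symm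

lemma Term.eval_rename (M : Structure L) {Γ Γ' : List L.Sorts} (f : Renaming Γ Γ') (v : M.Env Γ')
    {s : L.Sorts} (t : Term L Γ s) : (t.rename f).eval M v = t.eval M (v.comap f) := by
  induction t with
  | var x => exact (Structure.Env.lookup_comap f v x).symm
  | app g ts ih => simp only [Term.rename, Term.eval, ih]

lemma Formula.eval_rename (M : Structure L) {Γ : List L.Sorts} (φ : Formula L Γ) :
    ∀ {Γ' : List L.Sorts} (f : Renaming Γ Γ') (v : M.Env Γ'),
      (φ.rename f).eval M v = φ.eval M (v.comap f) := by
  induction φ with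
  | dist t u => intro Γ' f v; simp only [Formula.rename, Formula.eval, Term.eval_rename]
  | rel P ts => intro Γ' f v; simp only [Formula.rename, Formula.eval, Term.eval_rename]
  | conn F φ ih => intro Γ' f v; simp only [Formula.rename, Formula.eval, ih]
  | connω F φ ih => intro Γ' f v; simp only [Formula.rename, Formula.eval, ih]
  | sup φ ih =>
    intro Γ' f v
    refine congrArg iSup (funext fun a => (ih (f.lift _) _).trans ?_)
    exact congrArg _ (Structure.Env.comap_lift f a v)
  | inf φ ih =>
    intro Γ' f v
    refine congrArg iInf (funext fun a => (ih (f.lift _) _).trans ?_)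
    exact congrArg _ (Structure.Env.comap_lift f a v)

/-- The index of a variable: the head variable of `s :: Γ` is `xₙ` with `n = Γ.length`. -/
def Var.pos {S : Type} : {Γ : List S} → {s : S} → Var Γ s → ℕ
  | _ :: Γ, _, .head => Γ.length
  | _, _, .tail x => x.pos

lemma Var.pos_lt {S : Type} {Γ : List S} {s : S} (x : Var Γ s) : x.pos < Γ.length := by
  induction x with
  | head => simp [Var.pos]
  | tail x ih => simp only [Var.pos, List.length_cons]; omega

lemma Var.exists_pos {S : Type} : ∀ (Γ : List S) (i : ℕ), i < Γ.length →
    ∃ (s : S) (x : Var Γ s), x.pos = i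
  | s :: Γ, i, h => by
    rcases Nat.lt_succ_iff_lt_or_eq.1 (by simpa using h) with h | rfl
    · obtain ⟨t, x, hx⟩ := Var.exists_pos Γ i h
      exact ⟨t, x.tail, hx⟩
    · exact ⟨s, .head, rfl⟩

lemma Structure.distSeq_pos (M : Structure L) {Γ : List L.Sorts} (m m' : M.Env Γ) {s : L.Sorts}
    (x : Var Γ s) : M.distSeq m m' x.pos = nndist (m.lookup x) (m'.lookup x) := by
  induction x with
  | head => simp [Structure.distSeq, Var.pos, Structure.Env.lookup]
  | tail x ih =>
    simp only [Structure.distSeq, Var.pos, Structure.Env.lookup]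
    rw [Function.update_of_ne x.pos_lt.ne]
    exact ih _ _

lemma Structure.distSeq_of_le (M : Structure L) : ∀ {Γ : List L.Sorts} (m m' : M.Env Γ) (i : ℕ),
    Γ.length ≤ i → M.distSeq m m' i = 0
  | [], _, _, _, _ => rfl
  | _ :: Γ, m, m', i, h => by
    simp only [List.length_cons] at h
    simp only [Structure.distSeq]
    rw [Function.update_of_ne (by omega)]
    exact M.distSeq_of_le _ _ _ (by omega)

lemma Structure.distSeq_le (M : Structure L) {Γ : List L.Sorts} {m m' : M.Env Γ} {δ : ℕ → ℝ≥0}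
    (h : ∀ (s : L.Sorts) (x : Var Γ s), nndist (m.lookup x) (m'.lookup x) ≤ δ x.pos) :
    M.distSeq m m' ≤ δ := by
  intro i
  rcases lt_or_ge i Γ.length with hi | hi
  · obtain ⟨s, x, rfl⟩ := Var.exists_pos Γ i hi
    rw [M.distSeq_pos]; exact h s x
  · rw [M.distSeq_of_le _ _ _ hi]; exact zero_le

lemma Structure.distSeq_self (M : Structure L) {Γ : List L.Sorts} (m : M.Env Γ) :
    M.distSeq m m = 0 :=
  le_antisymm (M.distSeq_le fun s x => by simp) (fun _ => zero_le)

lemma Structure.distSeq_comm (M : Structure L) {Γ : List L.Sorts} (m m' : M.Env Γ) :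
    M.distSeq m m' = M.distSeq m' m :=
  le_antisymm (M.distSeq_le fun s x => by rw [M.distSeq_pos, nndist_comm])
    (M.distSeq_le fun s x => by rw [M.distSeq_pos, nndist_comm])

lemma Structure.distSeq_triangle (M : Structure L) {Γ : List L.Sorts} (m m' m'' : M.Env Γ) :
    M.distSeq m m'' ≤ M.distSeq m m' + M.distSeq m' m'' :=
  M.distSeq_le fun s x => by
    rw [Pi.add_apply, M.distSeq_pos, M.distSeq_pos]; exact nndist_triangle _ _ _

/-- Adding equal last entries to two tuples does not change the sequence of distances. -/
lemma Structure.distSeq_cons_same (M : Structure L) {Γ : List L.Sorts} {s : L.Sorts}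
    (a : M.carrier s) (m m' : M.Env Γ) :
    M.distSeq (Γ := s :: Γ) (a, m) (a, m') = M.distSeq m m' := by
  simp only [Structure.distSeq, nndist_self]
  rw [Function.update_eq_self_iff, M.distSeq_of_le _ _ _ le_rfl]

/-- Corresponding entries of the two tuples are at distance less than `δ`. -/
def Structure.Near (M : Structure L) (δ : ℝ) {Γ : List L.Sorts} (m m' : M.Env Γ) : Prop :=
  ∀ (s : L.Sorts) (x : Var Γ s), dist (m.lookup x) (m'.lookup x) < δ

lemma Structure.Near.mono {M : Structure L} {δ δ' : ℝ} (h : δ ≤ δ') {Γ : List L.Sorts}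
    {m m' : M.Env Γ} (hm : M.Near δ m m') : M.Near δ' m m' :=
  fun s x => (hm s x).trans_le h

lemma Structure.Near.cons {M : Structure L} {δ : ℝ} {Γ : List L.Sorts} {s : L.Sorts}
    {a a' : M.carrier s} {m m' : M.Env Γ} (ha : dist a a' < δ) (hm : M.Near δ m m') :
    M.Near (Γ := s :: Γ) δ (a, m) (a', m') := by
  intro t x
  cases x with
  | head => exact ha
  | tail x => exact hm t x

/-! ### Formulas are bounded and uniformly continuous, uniformly over all structures -/

lemma abs_ciSup_le_of_forall {ι : Type*} [Nonempty ι] {f : ι → ℝ} {C : ℝ} (h : ∀ i, |f i| ≤ C) :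
    |⨆ i, f i| ≤ C := by
  have hb : BddAbove (Set.range f) := ⟨C, by rintro _ ⟨i, rfl⟩; exact (abs_le.1 (h i)).2⟩
  obtain ⟨i⟩ := ‹Nonempty ι›
  have : Nonempty ι := ⟨i⟩
  exact abs_le.2 ⟨(abs_le.1 (h i)).1.trans (le_ciSup hb i), ciSup_le fun j => (abs_le.1 (h j)).2⟩

lemma iInf_eq_neg_iSup_neg {ι : Type*} (f : ι → ℝ) : ⨅ i, f i = -⨆ i, -f i := by
  rw [iInf, Real.sInf_def, iSup]
  congr 2
  ext x
  simp [neg_eq_iff_eq_neg]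

lemma abs_ciInf_le_of_forall {ι : Type*} [Nonempty ι] {f : ι → ℝ} {C : ℝ} (h : ∀ i, |f i| ≤ C) :
    |⨅ i, f i| ≤ C := by
  rw [iInf_eq_neg_iSup_neg, abs_neg]
  exact abs_ciSup_le_of_forall fun i => by simpa using h i

lemma abs_ciSup_sub_ciSup_le {ι : Type*} [Nonempty ι] {f g : ι → ℝ} {C ε : ℝ}
    (hf : ∀ i, |f i| ≤ C) (hg : ∀ i, |g i| ≤ C) (h : ∀ i, |f i - g i| ≤ ε) :
    |(⨆ i, f i) - ⨆ i, g i| ≤ ε := by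
  have hbf : BddAbove (Set.range f) := ⟨C, by rintro _ ⟨i, rfl⟩; exact (abs_le.1 (hf i)).2⟩
  have hbg : BddAbove (Set.range g) := ⟨C, by rintro _ ⟨i, rfl⟩; exact (abs_le.1 (hg i)).2⟩
  rw [abs_sub_le_iff]
  constructor
  · rw [sub_le_iff_le_add]
    refine ciSup_le fun i => ?_
    have := (abs_le.1 (h i)).2
    have := le_ciSup hbg i
    linarith
  · rw [sub_le_iff_le_add]
    refine ciSup_le fun i => ?_
    have := (abs_le.1 (h i)).1
    have := le_ciSup hbf i
    linarith

lemma abs_ciInf_sub_ciInf_le {ι : Type*} [Nonempty ι] {f g : ι → ℝ} {C ε : ℝ}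
    (hf : ∀ i, |f i| ≤ C) (hg : ∀ i, |g i| ≤ C) (h : ∀ i, |f i - g i| ≤ ε) :
    |(⨅ i, f i) - ⨅ i, g i| ≤ ε := by
  rw [iInf_eq_neg_iSup_neg, iInf_eq_neg_iSup_neg, neg_sub_neg, abs_sub_comm]
  refine abs_ciSup_sub_ciSup_le (C := C) (by simpa using hf) (by simpa using hg) fun i => ?_
  rw [neg_sub_neg, abs_sub_comm]; exact h i

/-- The box with half side lengths `C i`. -/
def box {ι : Type*} (C : ι → ℝ) : Set (ι → ℝ) := Set.univ.pi fun i => Set.Icc (-C i) (C i)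

lemma mem_box {ι : Type*} {C x : ι → ℝ} : x ∈ box C ↔ ∀ i, |x i| ≤ C i := by
  simp only [box, Set.mem_univ_pi, Set.mem_Icc, abs_le]

lemma isCompact_box {ι : Type*} (C : ι → ℝ) : IsCompact (box C) :=
  isCompact_univ_pi fun _ => isCompact_Icc

/-- A continuous function on a (possibly infinite-dimensional) box is uniformly continuous, and
only finitely many coordinates matter for a given precision. -/
lemma exists_finset_unif {ι : Type*} (C : ι → ℝ) (F : C(ι → ℝ, ℝ)) {ε : ℝ} (hε : 0 < ε) :
    ∃ I : Finset ι, ∃ δ > 0, ∀ x ∈ box C, ∀ y ∈ box C, (∀ i ∈ I, |x i - y i| < δ) →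
      |F x - F y| ≤ ε := by
  have hu := (isCompact_box C).uniformContinuousOn_of_continuous F.continuous.continuousOn
  have h1 : {p : (ι → ℝ) × (ι → ℝ) | dist (F p.1) (F p.2) < ε} ∈
      uniformity (ι → ℝ) ⊓ Filter.principal (box C ×ˢ box C) :=
    hu (Metric.dist_mem_uniformity hε)
  rw [Filter.mem_inf_principal, Pi.uniformity, Filter.mem_iInf] at h1
  obtain ⟨I, hI, V, hV, hV'⟩ := h1
  choose δ hδ hδV using fun i : I =>
    Metric.mem_uniformity_dist.1 (show {q : ℝ × ℝ | ∀ p : (ι → ℝ) × (ι → ℝ),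
      (p.1 i, p.2 i) = q → p ∈ V i} ∈ uniformity ℝ from by
        obtain ⟨t, ht, htV⟩ := Filter.mem_comap.1 (hV i)
        refine Filter.mem_of_superset ht ?_
        rintro q hq p rfl
        exact htV hq)
  have := hI.fintype
  obtain ⟨d, hd, hdδ⟩ : ∃ d > 0, ∀ i : I, d ≤ δ i := by
    obtain ⟨d, hd⟩ := Finite.exists_min (fun i : Option I => i.elim 1 δ)
    refine ⟨d.elim 1 δ, ?_, fun i => hd (some i)⟩
    cases d with
    | none => exact one_pos
    | some i => exact hδ i
  refine ⟨hI.toFinset, d, hd, fun x hx y hy h => ?_⟩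
  have : (x, y) ∈ {p : (ι → ℝ) × (ι → ℝ) | p ∈ box C ×ˢ box C → dist (F p.1) (F p.2) < ε} := by
    have h2 : (x, y) ∈ ⋂ i : I, V i := by
      refine Set.mem_iInter.2 fun i => ?_
      refine hδV i (a := x i) (b := y i) ?_ (x, y) rfl
      rw [Real.dist_eq]
      exact (h i (by simp)).trans_le (hdδ i)
    rw [← hV'] at h2
    exact h2
  have h3 := this ⟨hx, hy⟩
  rw [Real.dist_eq] at h3
  exact h3.le

lemma exists_bound_box {ι : Type*} (C : ι → ℝ) (F : C(ι → ℝ, ℝ)) :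
    ∃ D : ℝ, ∀ x ∈ box C, |F x| ≤ D :=
  (isCompact_box C).exists_bound_of_continuousOn F.continuous.continuousOn

/-- The bound depends on the formula only, not on the structure: a formula takes its values in a compact
set, by induction, since connectives map compact boxes to compact sets. -/
lemma Formula.exists_bound {Γ : List L.Sorts} (φ : Formula L Γ) :
    ∃ C : ℝ, ∀ (M : Structure L) (m : M.Env Γ), |φ.eval M m| ≤ C := by
  induction φ with
  | @dist Γ s t u =>
    refine ⟨L.diam s, fun M m => ?_⟩
    rw [Formula.eval, abs_of_nonneg dist_nonneg]
    exact M.dist_le _ _ _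
  | rel P ts =>
    exact ⟨max |L.relLo P| |L.relHi P|, fun M m =>
      abs_le_max_abs_abs (M.rel_mem P _).1 (M.rel_mem P _).2⟩
  | conn F φ ih =>
    choose C hC using ih
    obtain ⟨D, hD⟩ := exists_bound_box C F
    exact ⟨D, fun M m => hD _ (mem_box.2 fun i => hC i M m)⟩
  | connω F φ ih =>
    choose C hC using ih
    obtain ⟨D, hD⟩ := exists_bound_box C F
    exact ⟨D, fun M m => hD _ (mem_box.2 fun i => hC i M m)⟩
  | sup φ ih =>
    obtain ⟨C, hC⟩ := ih
    exact ⟨C, fun M m => abs_ciSup_le_of_forall fun a => hC M _⟩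
  | inf φ ih =>
    obtain ⟨C, hC⟩ := ih
    exact ⟨C, fun M m => abs_ciInf_le_of_forall fun a => hC M _⟩

lemma Formula.bddAbove {s : L.Sorts} {Γ : List L.Sorts} (φ : Formula L (s :: Γ)) (M : Structure L)
    (m : M.Env Γ) : BddAbove (Set.range fun a : M.carrier s => φ.eval M (a, m)) := by
  obtain ⟨C, hC⟩ := φ.exists_bound
  exact ⟨C, by rintro _ ⟨a, rfl⟩; exact (abs_le.1 (hC M _)).2⟩

lemma Formula.bddBelow {s : L.Sorts} {Γ : List L.Sorts} (φ : Formula L (s :: Γ)) (M : Structure L)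
    (m : M.Env Γ) : BddBelow (Set.range fun a : M.carrier s => φ.eval M (a, m)) := by
  obtain ⟨C, hC⟩ := φ.exists_bound
  exact ⟨-C, by rintro _ ⟨a, rfl⟩; exact (abs_le.1 (hC M _)).1⟩

lemma exists_pos_forall_le {ι : Type*} (I : Finset ι) (δ : ι → ℝ) (hδ : ∀ i, 0 < δ i) :
    ∃ d > 0, ∀ i ∈ I, d ≤ δ i := by
  classical
  induction I using Finset.induction_on with
  | empty => exact ⟨1, one_pos, by simp⟩
  | insert i I _ ih =>
    obtain ⟨d, hd, h⟩ := ih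
    refine ⟨min d (δ i), lt_min hd (hδ i), fun j hj => ?_⟩
    rcases Finset.mem_insert.1 hj with rfl | hj
    · exact min_le_right _ _
    · exact (min_le_left _ _).trans (h j hj)

lemma Term.unif {Γ : List L.Sorts} {s : L.Sorts} (t : Term L Γ s) :
    ∀ ε > 0, ∃ δ > 0, ∀ (M : Structure L) (m m' : M.Env Γ), M.Near δ m m' →
      dist (t.eval M m) (t.eval M m') ≤ ε := by
  induction t with
  | var x => exact fun ε hε => ⟨ε, hε, fun M m m' h => (h _ x).le⟩
  | app f ts ih =>
    intro ε hε
    choose δ hδ h using fun i => ih i (L.funMod f ε / 2) (half_pos (L.funMod_pos f ε hε))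
    obtain ⟨d, hd, hdδ⟩ := exists_pos_forall_le Finset.univ δ hδ
    refine ⟨d, hd, fun M m m' hm => M.fun_unif f ε hε _ _ fun i => ?_⟩
    have := h i M m m' (hm.mono (hdδ i (Finset.mem_univ i)))
    linarith [L.funMod_pos f ε hε]

/-- Formulas are uniformly continuous, with a modulus that does not depend on the structure. A connective
of infinite arity depends, up to `ε`, on finitely many of its arguments. -/
lemma Formula.unif {Γ : List L.Sorts} (φ : Formula L Γ) :
    ∀ ε > 0, ∃ δ > 0, ∀ (M : Structure L) (m m' : M.Env Γ), M.Near δ m m' →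
      |φ.eval M m - φ.eval M m'| ≤ ε := by
  have hconn : ∀ {ι : Type} {Γ : List L.Sorts} (F : C(ι → ℝ, ℝ)) (φ : ι → Formula L Γ),
      (∀ i, ∀ ε > 0, ∃ δ > 0, ∀ (M : Structure L) (m m' : M.Env Γ), M.Near δ m m' →
        |(φ i).eval M m - (φ i).eval M m'| ≤ ε) →
      ∀ ε > 0, ∃ δ > 0, ∀ (M : Structure L) (m m' : M.Env Γ), M.Near δ m m' →
        |F (fun i => (φ i).eval M m) - F (fun i => (φ i).eval M m')| ≤ ε := by
    intro ι Γ F φ ih ε hε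
    choose C hC using fun i => (φ i).exists_bound
    obtain ⟨I, δ, hδ, h⟩ := exists_finset_unif C F hε
    choose η hη hφ using fun i => ih i (δ / 2) (half_pos hδ)
    obtain ⟨d, hd, hdη⟩ := exists_pos_forall_le I η hη
    refine ⟨d, hd, fun M m m' hm => h _ (mem_box.2 fun i => hC i M m) _
      (mem_box.2 fun i => hC i M m') fun i hi => ?_⟩
    have := hφ i M m m' (hm.mono (hdη i hi))
    linarith
  induction φ with
  | dist t u =>
    intro ε hε
    obtain ⟨δ, hδ, h⟩ := t.unif (ε / 2) (half_pos hε)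
    obtain ⟨δ', hδ', h'⟩ := u.unif (ε / 2) (half_pos hε)
    refine ⟨min δ δ', lt_min hδ hδ', fun M m m' hm => ?_⟩
    have h1 := h M m m' (hm.mono (min_le_left _ _))
    have h2 := h' M m m' (hm.mono (min_le_right _ _))
    have h3 := dist_dist_dist_le (t.eval M m) (u.eval M m) (t.eval M m') (u.eval M m')
    rw [Real.dist_eq] at h3
    simp only [Formula.eval]
    linarith
  | rel P ts =>
    intro ε hε
    choose δ hδ h using fun i => (ts i).unif (L.relMod P ε / 2) (half_pos (L.relMod_pos P ε hε))
    obtain ⟨d, hd, hdδ⟩ := exists_pos_forall_le Finset.univ δ hδ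
    refine ⟨d, hd, fun M m m' hm => M.rel_unif P ε hε _ _ fun i => ?_⟩
    have := h i M m m' (hm.mono (hdδ i (Finset.mem_univ i)))
    linarith [L.relMod_pos P ε hε]
  | conn F φ ih => exact hconn F φ ih
  | connω F φ ih => exact hconn F φ ih
  | sup φ ih =>
    intro ε hε
    obtain ⟨δ, hδ, h⟩ := ih ε hε
    obtain ⟨C, hC⟩ := φ.exists_bound
    exact ⟨δ, hδ, fun M m m' hm => abs_ciSup_sub_ciSup_le (C := C) (fun a => hC M _)
      (fun a => hC M _) fun a => h M _ _ (hm.cons (by simpa using hδ))⟩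
  | inf φ ih =>
    intro ε hε
    obtain ⟨δ, hδ, h⟩ := ih ε hε
    obtain ⟨C, hC⟩ := φ.exists_bound
    exact ⟨δ, hδ, fun M m m' hm => abs_ciInf_sub_ciInf_le (C := C) (fun a => hC M _)
      (fun a => hC M _) fun a => h M _ _ (hm.cons (by simpa using hδ))⟩

/-! ### Weak moduli near zero, and truncation -/

/-- A weak modulus, restricted to the first `n` arguments, is continuous at `0`. -/
lemma WeakModulus.exists_delta (Ω : WeakModulus) (n : ℕ) : ∀ η : ℝ≥0∞, 0 < η → ∃ δ > (0 : ℝ),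
    ∀ d : ℕ → ℝ≥0, (∀ i < n, (d i : ℝ) < δ) → (∀ i ≥ n, d i = 0) → Ω.toFun d < η := by
  induction n with
  | zero =>
    intro η hη
    refine ⟨1, one_pos, fun d _ hd => ?_⟩
    have : d = 0 := funext fun i => hd i (Nat.zero_le i)
    rw [this, Ω.zero]; exact hη
  | succ n ih =>
    intro η hη
    obtain ⟨δ, hδ, h⟩ := ih (η / 2) (ENNReal.half_pos hη.ne')
    have hc := (Ω.cont 0 n).tendsto 0
    rw [show Function.update (0 : ℕ → ℝ≥0) n 0 = 0 from Function.update_eq_self_iff.2 rfl,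
      Ω.zero] at hc
    obtain ⟨δ', hδ', h'⟩ := Metric.eventually_nhds_iff.1
      (hc.eventually (gt_mem_nhds (ENNReal.half_pos hη.ne')))
    refine ⟨min δ δ', lt_min hδ hδ', fun d hd hd0 => ?_⟩
    have hsum : d = Function.update d n 0 + Function.update (0 : ℕ → ℝ≥0) n (d n) := by
      funext i
      by_cases hi : i = n
      · subst hi; simp
      · simp [Function.update_of_ne hi]
    rw [hsum]
    refine (Ω.subadd _ _).trans_lt ?_
    rw [← ENNReal.add_halves η]
    refine ENNReal.add_lt_add (h _ (fun i hi => ?_) fun i hi => ?_) (h' ?_)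
    · rw [Function.update_of_ne hi.ne]
      exact (hd i (by omega)).trans_le (min_le_left _ _)
    · by_cases hin : i = n
      · subst hin; simp
      · rw [Function.update_of_ne hin]; exact hd0 i (by omega)
    · rw [NNReal.dist_eq]
      simpa using (hd n (by omega)).trans_le (min_le_right _ _)

/-- Near tuples have small `Ω`-distance, uniformly over all structures. -/
lemma WeakModulus.exists_near (Ω : WeakModulus) (Γ : List L.Sorts) (η : ℝ≥0∞) (hη : 0 < η) :
    ∃ δ > (0 : ℝ), ∀ (M : Structure L) (m m' : M.Env Γ), M.Near δ m m' →
      Ω.toFun (M.distSeq m m') < η := by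
  obtain ⟨δ, hδ, h⟩ := Ω.exists_delta Γ.length η hη
  refine ⟨δ, hδ, fun M m m' hm => h _ (fun i hi => ?_) fun i hi => M.distSeq_of_le _ _ _ hi⟩
  obtain ⟨s, x, rfl⟩ := Var.exists_pos Γ i hi
  rw [M.distSeq_pos]
  exact hm s x

/-- The real number `min (Ω d) 1`. -/
noncomputable def WeakModulus.trunc (Ω : WeakModulus) (d : ℕ → ℝ≥0) : ℝ :=
  (min (Ω.toFun d) 1).toReal

lemma WeakModulus.ofReal_trunc (Ω : WeakModulus) (d : ℕ → ℝ≥0) :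
    ENNReal.ofReal (Ω.trunc d) = min (Ω.toFun d) 1 :=
  ENNReal.ofReal_toReal (ne_top_of_le_ne_top ENNReal.one_ne_top (min_le_right _ _))

lemma WeakModulus.trunc_nonneg (Ω : WeakModulus) (d : ℕ → ℝ≥0) : 0 ≤ Ω.trunc d :=
  ENNReal.toReal_nonneg

lemma WeakModulus.trunc_zero (Ω : WeakModulus) : Ω.trunc 0 = 0 := by
  simp [WeakModulus.trunc, Ω.zero]

lemma WeakModulus.le_trunc (Ω : WeakModulus) {d : ℕ → ℝ≥0} {r : ℝ} (h : ENNReal.ofReal r ≤ Ω.toFun d)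
    (h1 : r ≤ 1) : r ≤ Ω.trunc d := by
  rw [← ENNReal.ofReal_le_ofReal_iff (Ω.trunc_nonneg d), Ω.ofReal_trunc]
  exact le_min h (ENNReal.ofReal_le_one.2 h1)

lemma WeakModulus.trunc_add (Ω : WeakModulus) {d e f : ℕ → ℝ≥0} (h : d ≤ e + f) :
    Ω.trunc d ≤ Ω.trunc e + Ω.trunc f := by
  rw [← ENNReal.ofReal_le_ofReal_iff (add_nonneg (Ω.trunc_nonneg _) (Ω.trunc_nonneg _)),
    ENNReal.ofReal_add (Ω.trunc_nonneg _) (Ω.trunc_nonneg _)]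
  simp only [Ω.ofReal_trunc]
  have h1 : Ω.toFun d ≤ Ω.toFun e + Ω.toFun f := (Ω.mono h).trans (Ω.subadd e f)
  rcases le_total (Ω.toFun e) 1 with he | he
  · rcases le_total (Ω.toFun f) 1 with hf | hf
    · rw [min_eq_left he, min_eq_left hf]; exact (min_le_left _ _).trans h1
    · rw [min_eq_right hf]; exact (min_le_right _ _).trans le_add_self
  · rw [min_eq_right he]; exact (min_le_right _ _).trans le_self_add

/-- The function `(d₀, …, dₙ₋₁) ↦ min (Ω(d₀, …, dₙ₋₁, 0, …)) 1` as a connective. It does not depend on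
`t 0`, the slot of the formula to which its value is added. -/
lemma WeakModulus.continuous_trunc (Ω : WeakModulus) (n : ℕ) :
    Continuous fun t : Fin (n + 1) → ℝ =>
      Ω.trunc fun i => if h : i < n then (t ⟨i + 1, by omega⟩).toNNReal else 0 := by
  rw [Metric.continuous_iff]
  intro t ε hε
  obtain ⟨δ, hδ, h⟩ := Ω.exists_delta n (ENNReal.ofReal ε) (ENNReal.ofReal_pos.2 hε)
  refine ⟨δ, hδ, fun t' ht' => ?_⟩
  set d : (Fin (n + 1) → ℝ) → ℕ → ℝ≥0 :=
    fun t i => if h : i < n then (t ⟨i + 1, by omega⟩).toNNReal else 0 with hd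
  set e : ℕ → ℝ≥0 := fun i => nndist (d t' i) (d t i) with he
  have h1 : Ω.trunc (d t') ≤ Ω.trunc (d t) + Ω.trunc e := by
    refine Ω.trunc_add fun i => ?_
    rw [Pi.add_apply, ← NNReal.coe_le_coe, NNReal.coe_add, he, coe_nndist, NNReal.dist_eq]
    linarith [le_abs_self ((d t' i : ℝ) - d t i)]
  have h2 : Ω.trunc (d t) ≤ Ω.trunc (d t') + Ω.trunc e := by
    refine Ω.trunc_add fun i => ?_
    rw [Pi.add_apply, ← NNReal.coe_le_coe, NNReal.coe_add, he, coe_nndist, NNReal.dist_eq]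
    linarith [neg_abs_le ((d t' i : ℝ) - d t i)]
  have h3 : Ω.trunc e < ε := by
    rw [← ENNReal.ofReal_lt_ofReal_iff hε, Ω.ofReal_trunc]
    refine (min_le_left _ _).trans_lt (h e (fun i hi => ?_) fun i hi => ?_)
    · rw [he, coe_nndist, NNReal.dist_eq]
      simp only [hd, hi, dif_pos, Real.coe_toNNReal']
      refine (abs_max_sub_max_le_abs _ _ _).trans_lt ?_
      rw [← Real.dist_eq]
      exact (dist_le_pi_dist t' t _).trans_lt ht'
    · simp [he, hd, not_lt.2 hi]
  rw [Real.dist_eq, abs_sub_lt_iff]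
  constructor <;> linarith

/-! ### Making formulas of `Δ` respect a weak modulus in all structures -/

/-- The inclusion of the variables of the first part of a concatenated context. -/
def Var.inl {S : Type} {Γ : List S} : {Γ₁ : List S} → {s : S} → Var Γ₁ s → Var (Γ₁ ++ Γ) s
  | _, _, .head => .head
  | _, _, .tail x => .tail x.inl

/-- The inclusion of the variables of the second part of a concatenated context. -/
def Var.inr {S : Type} {Γ : List S} : (Γ₁ : List S) → {s : S} → Var Γ s → Var (Γ₁ ++ Γ) s
  | [], _, x => x
  | _ :: Γ₁, _, x => .tail (Var.inr Γ₁ x)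

/-- The concatenation of two tuples. -/
def Structure.Env.append {M : Structure L} {Γ : List L.Sorts} :
    {Γ₁ : List L.Sorts} → M.Env Γ₁ → M.Env Γ → M.Env (Γ₁ ++ Γ)
  | [], _, v => v
  | _ :: _, w, v => (w.1, Structure.Env.append w.2 v)

lemma Structure.Env.lookup_inl {M : Structure L} {Γ Γ₁ : List L.Sorts} {s : L.Sorts}
    (x : Var Γ₁ s) (w : M.Env Γ₁) (v : M.Env Γ) : (w.append v).lookup x.inl = w.lookup x := by
  induction x with
  | head => rfl
  | tail x ih => exact ih w.2

lemma Structure.Env.lookup_inr {M : Structure L} {Γ : List L.Sorts} {s : L.Sorts}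
    (x : Var Γ s) (v : M.Env Γ) : ∀ {Γ₁ : List L.Sorts} (w : M.Env Γ₁),
    (w.append v).lookup (x.inr Γ₁) = v.lookup x
  | [], _ => rfl
  | _ :: _, w => Structure.Env.lookup_inr x v w.2

/-- Infimum over all variables of the first part of a context. -/
def Formula.infPrefix {Γ : List L.Sorts} :
    (Γ₁ : List L.Sorts) → Formula L (Γ₁ ++ Γ) → Formula L Γ
  | [], φ => φ
  | _ :: Γ₁, φ => Formula.infPrefix Γ₁ φ.inf

lemma Formula.eval_infPrefix_le {M : Structure L} {Γ : List L.Sorts} (v : M.Env Γ) :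
    ∀ {Γ₁ : List L.Sorts} (φ : Formula L (Γ₁ ++ Γ)) (w : M.Env Γ₁),
      (φ.infPrefix Γ₁).eval M v ≤ φ.eval M (w.append v)
  | [], _, _ => le_rfl
  | _ :: _, φ, w =>
    (Formula.eval_infPrefix_le v (Formula.inf φ) w.2).trans (ciInf_le (φ.bddBelow M _) w.1)

lemma Formula.le_eval_infPrefix {M : Structure L} {Γ : List L.Sorts} (v : M.Env Γ) {c : ℝ} :
    ∀ {Γ₁ : List L.Sorts} (φ : Formula L (Γ₁ ++ Γ)),
      (∀ w : M.Env Γ₁, c ≤ φ.eval M (w.append v)) → c ≤ (φ.infPrefix Γ₁).eval M v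
  | [], _, h => h ()
  | _ :: _, φ, h =>
    Formula.le_eval_infPrefix v (Formula.inf φ) fun w => le_ciInf fun a => h (a, w)

/-- The formula `φ(y) + min (Ω(d(y, x))) 1`, in a context that lists the variables of `y` and then those
of `x`. -/
lemma Formula.exists_regularization (Ω : WeakModulus) {Γ : List L.Sorts} (φ : Formula L Γ) :
    ∃ χ : Formula L (Γ ++ Γ), ∀ (M : Structure L) (y x : M.Env Γ),
      χ.eval M (y.append x) = φ.eval M y + Ω.trunc (M.distSeq y x) := by
  choose s x hx using fun i : Fin Γ.length => Var.exists_pos Γ i i.2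
  let ren : Renaming Γ (Γ ++ Γ) := fun _ x => x.inl
  refine ⟨.conn ⟨fun t : Fin (Γ.length + 1) → ℝ => t 0 +
      Ω.trunc fun i => if h : i < Γ.length then (t ⟨i + 1, by omega⟩).toNNReal else 0,
      (continuous_apply 0).add (Ω.continuous_trunc Γ.length)⟩
    (Fin.cons (φ.rename (Γ' := Γ ++ Γ) ren)
      fun i => .dist (.var (x i).inl) (.var ((x i).inr Γ))), fun M m m' => ?_⟩
  simp only [Formula.eval, ContinuousMap.coe_mk, Fin.cons_zero]
  congr 1
  · rw [Formula.eval_rename]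
    refine congrArg _ (Structure.Env.ext fun t y => ?_)
    rw [Structure.Env.lookup_comap]
    exact Structure.Env.lookup_inl y m m'
  · congr 1
    funext i
    by_cases hi : i < Γ.length
    · rw [dif_pos hi]
      have h1 : (⟨i + 1, by omega⟩ : Fin (Γ.length + 1)) = Fin.succ ⟨i, hi⟩ := rfl
      rw [h1, Fin.cons_succ]
      simp only [Formula.eval, Term.eval]
      rw [Structure.Env.lookup_inl, Structure.Env.lookup_inr]
      have h2 := M.distSeq_pos m m' (x ⟨i, hi⟩)
      rw [hx] at h2
      simp only at h2
      rw [h2]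
      exact Subtype.ext (by simp [Real.coe_toNNReal _ dist_nonneg])
    · rw [dif_neg hi, M.distSeq_of_le _ _ _ (not_lt.1 hi)]

lemma Formula.respectsFrom_zero_iff {Ω : WeakModulus} {M : Structure L} {Γ : List L.Sorts}
    {φ : Formula L Γ} : φ.RespectsFrom Ω 0 M ↔
      ∀ m m' : M.Env Γ, edist (φ.eval M m) (φ.eval M m') ≤ Ω.toFun (M.distSeq m m') := by
  have : ∀ δ : ℕ → ℝ≥0, Function.extend (fun i => i + 0) δ 0 = δ := fun δ =>
    funext fun i => Function.Injective.extend_apply (f := fun i : ℕ => i + 0)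
      (fun _ _ h => by simpa using h) δ 0 i
  simp only [Formula.RespectsFrom, this]

/-- A `[0, 1]`-valued formula of `Δ` that respects `Ω` in models of `T` is equivalent modulo `T` to
one that respects `Ω` in all structures: `ψ(x) = inf_y (φ(y) + min (Ω(d(x, y))) 1)`. -/
lemma IsDistortionSystem.exists_respects {T : Theory L} {Δ : FormulaSet L}
    (hΔ : IsDistortionSystem T Δ) {Ω : WeakModulus} {Γ : List L.Sorts} {φ : Formula L Γ}
    (hφ : φ ∈ Δ Γ) (h01 : ∀ (M : Structure L) (m : M.Env Γ), φ.eval M m ∈ Set.Icc (0 : ℝ) 1)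
    (hr : ∀ M : Structure L, M.Models T → φ.RespectsFrom Ω 0 M) :
    ∃ ψ ∈ Δ Γ, ψ.Respects Ω ∧
      ∀ M : Structure L, M.Models T → ∀ m : M.Env Γ, ψ.eval M m = φ.eval M m := by
  obtain ⟨χ, hχ⟩ := φ.exists_regularization Ω
  have hup : ∀ (M : Structure L) (m y : M.Env Γ),
      (χ.infPrefix Γ).eval M m ≤ φ.eval M y + Ω.trunc (M.distSeq y m) := fun M m y =>
    (Formula.eval_infPrefix_le m χ y).trans_eq (hχ M y m)
  have heq : ∀ M : Structure L, M.Models T → ∀ m : M.Env Γ,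
      (χ.infPrefix Γ).eval M m = φ.eval M m := by
    intro M hM m
    refine le_antisymm ?_ (Formula.le_eval_infPrefix m χ fun y => ?_)
    · have := hup M m m
      rwa [M.distSeq_self, Ω.trunc_zero, add_zero] at this
    · rw [hχ, ← sub_le_iff_le_add']
      refine Ω.le_trunc ?_ (by linarith [(h01 M m).2, (h01 M y).1])
      refine le_trans ?_ (Formula.respectsFrom_zero_iff.1 (hr M hM) y m)
      rw [edist_dist, dist_comm, Real.dist_eq]
      exact ENNReal.ofReal_le_ofReal (le_abs_self _)
  refine ⟨χ.infPrefix Γ, hΔ.equiv φ _ hφ fun M hM m => by rw [heq M hM m]; simp, ?_, heq⟩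
  have key : ∀ (M : Structure L) (m m' : M.Env Γ), (χ.infPrefix Γ).eval M m ≤
      (χ.infPrefix Γ).eval M m' + Ω.trunc (M.distSeq m m') := by
    intro M m m'
    rw [← sub_le_iff_le_add]
    refine Formula.le_eval_infPrefix m' χ fun y => ?_
    have h1 := hup M m y
    have h2 : Ω.trunc (M.distSeq y m) ≤ Ω.trunc (M.distSeq y m') + Ω.trunc (M.distSeq m m') :=
      Ω.trunc_add (by rw [M.distSeq_comm m m']; exact M.distSeq_triangle y m' m)
    rw [hχ]
    linarith
  intro M m m'
  have h1 := key M m m'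
  have h2 := key M m' m
  rw [M.distSeq_comm m' m] at h2
  rw [edist_dist, Real.dist_eq]
  refine le_trans (ENNReal.ofReal_le_ofReal (abs_sub_le_iff.2 ⟨?_, ?_⟩))
    ((Ω.ofReal_trunc _).le.trans (min_le_left _ _)) <;> linarith

/-- The function `t ↦ t - c + 1/2`, truncated to `[0, 1]`. -/
noncomputable def clampFun (c : ℝ) : C(Fin 1 → ℝ, ℝ) :=
  ⟨fun t => max 0 (min 1 (t 0 - c + 1 / 2)), by fun_prop⟩

lemma clampFun_lipschitz (c : ℝ) : LipschitzWith 1 (clampFun c) := by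
  refine LipschitzWith.of_dist_le_mul fun t u => ?_
  rw [NNReal.coe_one, one_mul, Real.dist_eq]
  have h0 : |t 0 - u 0| ≤ dist t u := by rw [← Real.dist_eq]; exact dist_le_pi_dist t u 0
  refine le_trans ?_ h0
  simp only [clampFun, ContinuousMap.coe_mk]
  rw [max_comm 0, max_comm 0, min_comm 1, min_comm 1]
  refine (abs_max_sub_max_le_abs _ _ _).trans ((abs_min_sub_min_le_max _ _ _ _).trans ?_)
  rw [sub_self, abs_zero]
  refine max_le (le_of_eq ?_) (abs_nonneg _)
  congr 1; ring

/-- The formula `φ - c + 1/2`, truncated to `[0, 1]`. It determines `φ` where `|φ - c| < 1/2`. -/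
noncomputable def Formula.clamp {Γ : List L.Sorts} (φ : Formula L Γ) (c : ℝ) : Formula L Γ :=
  .conn (clampFun c) ![φ]

lemma Formula.eval_clamp {Γ : List L.Sorts} (φ : Formula L Γ) (c : ℝ) (M : Structure L)
    (m : M.Env Γ) : (φ.clamp c).eval M m = max 0 (min 1 (φ.eval M m - c + 1 / 2)) := rfl

lemma Formula.clamp_mem_Icc {Γ : List L.Sorts} (φ : Formula L Γ) (c : ℝ) (M : Structure L)
    (m : M.Env Γ) : (φ.clamp c).eval M m ∈ Set.Icc (0 : ℝ) 1 := by
  rw [Formula.eval_clamp]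
  exact ⟨le_max_left _ _, max_le zero_le_one (min_le_left _ _)⟩

lemma IsDistortionSystem.clamp {T : Theory L} {Δ : FormulaSet L} (hΔ : IsDistortionSystem T Δ)
    {Γ : List L.Sorts} {φ : Formula L Γ} (hφ : φ ∈ Δ Γ) (c : ℝ) : φ.clamp c ∈ Δ Γ :=
  hΔ.conn _ (clampFun_lipschitz c) _ fun i => by
    obtain rfl : i = 0 := Subsingleton.elim _ _
    exact hφ

lemma Formula.RespectsFrom.clamp {Ω : WeakModulus} {n : ℕ} {M : Structure L} {Γ : List L.Sorts}
    {φ : Formula L Γ} (h : φ.RespectsFrom Ω n M) (c : ℝ) : (φ.clamp c).RespectsFrom Ω n M := by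
  intro m m'
  refine le_trans ?_ (h m m')
  refine ((clampFun_lipschitz c).edist_le_mul _ _).trans ?_
  rw [ENNReal.coe_one, one_mul, edist_pi_le_iff]
  intro i
  obtain rfl : i = 0 := Subsingleton.elim _ _
  exact le_rfl

/-- The formulas respecting `Ω` control every formula `φ` whose truncations respect `Ω` in models
of `T`. The truncation is centred at the value of `φ` at `m`, so that it takes the value `1/2` there,
and a difference of `ε < 1/2` is not cut off. -/
lemma IsDistortionSystem.abs_sub_le {T : Theory L} {Δ : FormulaSet L}
    (hΔ : IsDistortionSystem T Δ) {Ω : WeakModulus} {Γ : List L.Sorts} {φ : Formula L Γ}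
    (hφ : φ ∈ Δ Γ) (hr : ∀ c, ∀ M : Structure L, M.Models T → (φ.clamp c).RespectsFrom Ω 0 M)
    {M N : Structure L} (hM : M.Models T) (hN : N.Models T) {m : M.Env Γ} {n : N.Env Γ} {ε : ℝ}
    (hε : ε < 1 / 2) (h : ∀ ψ ∈ Δ Γ, ψ.Respects Ω → |ψ.eval M m - ψ.eval N n| ≤ ε) :
    |φ.eval M m - φ.eval N n| ≤ ε := by
  obtain ⟨ψ, hψ, hψr, hψe⟩ := hΔ.exists_respects (hΔ.clamp hφ (φ.eval M m))
    (φ.clamp_mem_Icc _) (hr _)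
  have h1 := h ψ hψ hψr
  rw [hψe M hM, hψe N hN, Formula.eval_clamp, Formula.eval_clamp, sub_self, abs_le] at h1
  rw [abs_le]
  obtain ⟨h2, h3⟩ := h1
  generalize φ.eval N n = u at *
  generalize φ.eval M m = v at *
  have hc : max (0 : ℝ) (min 1 (0 + 1 / 2)) = 1 / 2 := by norm_num
  rw [hc] at h2 h3
  rcases le_total 1 (u - v + 1 / 2) with h4 | h4
  · rw [min_eq_left h4, max_eq_right zero_le_one] at h2; linarith
  · rw [min_eq_right h4] at h2 h3
    rcases le_total 0 (u - v + 1 / 2) with h5 | h5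
    · rw [max_eq_right h5] at h2 h3
      constructor <;> linarith
    · rw [max_eq_left h5] at h3; linarith

/-! ### Separability of the set of formulas -/

/-- Closing off under an operation with finite arguments and countably many values keeps a set
countable. -/
lemma exists_countable_closed {X : Type*} (op : List X → Set X) (hop : ∀ l, (op l).Countable) :
    ∃ C : Set X, C.Countable ∧ ∀ l : List X, (∀ x ∈ l, x ∈ C) → op l ⊆ C := by
  let S : ℕ → Set X := Nat.rec ∅ fun _ S => S ∪ ⋃ l ∈ {l : List X | ∀ x ∈ l, x ∈ S}, op l
  have hS : ∀ n, S (n + 1) = S n ∪ ⋃ l ∈ {l : List X | ∀ x ∈ l, x ∈ S n}, op l := fun _ => rfl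
  have hmono : Monotone S := monotone_nat_of_le_succ fun n => by rw [hS]; exact Set.subset_union_left
  refine ⟨⋃ n, S n, Set.countable_iUnion fun n => ?_, fun l hl => ?_⟩
  · induction n with
    | zero => exact Set.countable_empty
    | succ n ih =>
      rw [hS]
      exact ih.union (Set.Countable.biUnion (by
        have := ih.to_subtype
        rw [← Set.range_list_map_coe]
        exact Set.countable_range _) fun l _ => hop l)
  · have : ∃ n, ∀ x ∈ l, x ∈ S n := by
      clear hop
      induction l with
      | nil => exact ⟨0, by simp⟩
      | cons a l ih =>
        obtain ⟨n, hn⟩ := ih fun x hx => hl x (List.mem_cons_of_mem _ hx)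
        obtain ⟨k, hk⟩ := Set.mem_iUnion.1 (hl a List.mem_cons_self)
        refine ⟨max n k, fun x hx => ?_⟩
        rcases List.mem_cons.1 hx with rfl | hx
        · exact hmono (le_max_right _ _) hk
        · exact hmono (le_max_left _ _) (hn x hx)
    obtain ⟨n, hn⟩ := this
    refine Set.Subset.trans ?_ (Set.subset_iUnion S (n + 1))
    rw [hS]
    exact fun x hx => Or.inr (Set.mem_biUnion (x := l) hn hx)

instance countable_var {S : Type} : ∀ Γ : List S, Countable (Σ s, Var Γ s)
  | [] => ⟨fun _ => 0, fun x => nomatch x.2⟩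
  | s :: Γ => by
    have := countable_var Γ
    refine Function.Surjective.countable
      (f := fun o : Option (Σ s, Var Γ s) =>
        (o.elim ⟨s, .head⟩ fun x => ⟨x.1, x.2.tail⟩ : Σ t, Var (s :: Γ) t)) ?_
    rintro ⟨t, x⟩
    cases x with
    | head => exact ⟨none, rfl⟩
    | tail x => exact ⟨some ⟨t, x⟩, rfl⟩

instance countable_sigma_term [Countable L.Func] (Γ : List L.Sorts) :
    Countable (Σ s, Term L Γ s) := by
  obtain ⟨C, hC, h⟩ := exists_countable_closed (X := Σ s, Term L Γ s)
    (fun l => (Set.range fun x : Σ s, Var Γ s => ⟨x.1, .var x.2⟩) ∪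
      ⋃ f : L.Func, {t | ∃ ts, l = List.ofFn (fun i => ⟨L.funDom f i, ts i⟩) ∧
        t = ⟨L.funCod f, .app f ts⟩})
    (fun l => by
      refine (Set.countable_range _).union (Set.countable_iUnion fun f => ?_)
      refine Set.Subsingleton.countable ?_
      rintro _ ⟨ts, hts, rfl⟩ _ ⟨ts', hts', rfl⟩
      have h1 := List.ofFn_injective (hts.symm.trans hts')
      have : ts = ts' := funext fun i => eq_of_heq (Sigma.mk.inj (congrFun h1 i)).2
      rw [this])
  have hmem : ∀ {s : L.Sorts} (t : Term L Γ s), (⟨s, t⟩ : Σ s, Term L Γ s) ∈ C := by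
    intro s t
    induction t with
    | @var s x => exact h [] (by simp) (Or.inl ⟨⟨s, x⟩, rfl⟩)
    | app f ts ih =>
      refine h (List.ofFn fun i => ⟨L.funDom f i, ts i⟩) (fun x hx => ?_)
        (Or.inr (Set.mem_iUnion.2 ⟨f, ts, rfl, rfl⟩))
      obtain ⟨i, rfl⟩ := (List.mem_ofFn' _ _).1 hx
      exact ih i
  have := hC.to_subtype
  exact Function.Injective.countable
    (f := fun x : Σ s, Term L Γ s => (⟨x, hmem x.2⟩ : C)) fun x y hxy => by simpa using hxy

instance countable_term [Countable L.Func] (Γ : List L.Sorts) (s : L.Sorts) :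
    Countable (Term L Γ s) :=
  Function.Injective.countable (f := fun t : Term L Γ s => (⟨s, t⟩ : Σ s, Term L Γ s))
    sigma_mk_injective

/-- The formulas `φ` and `ψ` differ by at most `ε` in all structures. -/
def Formula.Close (ε : ℝ) {Γ : List L.Sorts} (φ ψ : Formula L Γ) : Prop :=
  ∀ (M : Structure L) (m : M.Env Γ), |φ.eval M m - ψ.eval M m| ≤ ε

lemma exists_dense_seq_close {k : ℕ} (C : Fin k → ℝ) (F : C(Fin k → ℝ, ℝ)) {ε : ℝ} (hε : 0 < ε) :
    ∃ j, ∀ x ∈ box C, |F x - TopologicalSpace.denseSeq C(Fin k → ℝ, ℝ) j x| < ε := by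
  have h1 : F ∈ closure (Set.range (TopologicalSpace.denseSeq C(Fin k → ℝ, ℝ))) :=
    TopologicalSpace.denseRange_denseSeq _ F
  have h2 := mem_closure_iff_nhdsWithin_neBot.1 h1
  have h3 := ContinuousMap.tendsto_iff_forall_isCompact_tendstoUniformlyOn.1
    ((Filter.tendsto_id (x := nhds F)).mono_left nhdsWithin_le_nhds :
      Filter.Tendsto id (nhdsWithin F (Set.range (TopologicalSpace.denseSeq _))) (nhds F))
    (box C) (isCompact_box C)
  have h4 := (Metric.tendstoUniformlyOn_iff.1 h3 ε hε).and self_mem_nhdsWithin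
  obtain ⟨G, hG, j, rfl⟩ := h4.exists
  exact ⟨j, fun x hx => by rw [← Real.dist_eq]; exact hG x hx⟩

/-- The set of formulas is separable in the uniform norm over all structures. The countable set is
generated by the atomic formulas, the quantifiers and, for every `k`, a dense sequence of connectives
`ℝᵏ → ℝ`; connectives of infinite arity are approximated by finitary ones. -/
lemma exists_countable_dense [Countable L.Sorts] [Countable L.Func] [Countable L.Rel] :
    ∃ C : Set (Σ Γ, Formula L Γ), C.Countable ∧ ∀ {Γ} (φ : Formula L Γ), ∀ ε > 0,
      ∃ χ : Formula L Γ, ⟨Γ, χ⟩ ∈ C ∧ φ.Close ε χ := by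
  obtain ⟨C, hC, h⟩ := exists_countable_closed (X := Σ Γ, Formula L Γ)
    (fun l =>
      (Set.range fun x : Σ Γ, Σ s, Term L Γ s × Term L Γ s => ⟨x.1, .dist x.2.2.1 x.2.2.2⟩) ∪
      ((Set.range fun x : Σ Γ, Σ P, (i : Fin (L.relArity P)) → Term L Γ (L.relDom P i) =>
        ⟨x.1, .rel x.2.1 x.2.2⟩) ∪
      ((⋃ x : List L.Sorts × ℕ × ℕ, {χ | ∃ φ : Fin x.2.1 → Formula L x.1,
        l = List.ofFn (fun i => ⟨x.1, φ i⟩) ∧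
          χ = ⟨x.1, .conn (TopologicalSpace.denseSeq C(Fin x.2.1 → ℝ, ℝ) x.2.2) φ⟩}) ∪
      ((⋃ x : List L.Sorts × L.Sorts, {χ | ∃ φ : Formula L (x.2 :: x.1),
        l = [⟨x.2 :: x.1, φ⟩] ∧ χ = ⟨x.1, .sup φ⟩}) ∪
      (⋃ x : List L.Sorts × L.Sorts, {χ | ∃ φ : Formula L (x.2 :: x.1),
        l = [⟨x.2 :: x.1, φ⟩] ∧ χ = ⟨x.1, .inf φ⟩})))))
    (fun l => by
      refine (Set.countable_range _).union ((Set.countable_range _).union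
        ((Set.countable_iUnion fun x => ?_).union ((Set.countable_iUnion fun x => ?_).union
          (Set.countable_iUnion fun x => ?_))))
      · refine Set.Subsingleton.countable ?_
        rintro _ ⟨ts, hts, rfl⟩ _ ⟨ts', hts', rfl⟩
        have h1 := List.ofFn_injective (hts.symm.trans hts')
        have : ts = ts' := funext fun i => eq_of_heq (Sigma.mk.inj (congrFun h1 i)).2
        rw [this]
      · refine Set.Subsingleton.countable ?_
        rintro _ ⟨φ, hφ, rfl⟩ _ ⟨φ', hφ', rfl⟩
        have h1 := hφ.symm.trans hφ'
        simp only [List.cons.injEq, Sigma.mk.injEq, heq_eq_eq, true_and, and_true] at h1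
        rw [h1]
      · refine Set.Subsingleton.countable ?_
        rintro _ ⟨φ, hφ, rfl⟩ _ ⟨φ', hφ', rfl⟩
        have h1 := hφ.symm.trans hφ'
        simp only [List.cons.injEq, Sigma.mk.injEq, heq_eq_eq, true_and, and_true] at h1
        rw [h1])
  refine ⟨C, hC, ?_⟩
  have hconn : ∀ {Γ : List L.Sorts} {k : ℕ} (F : C(Fin k → ℝ, ℝ)) (φ : Fin k → Formula L Γ),
      (∀ i, ∀ ε > 0, ∃ χ : Formula L Γ, ⟨Γ, χ⟩ ∈ C ∧ (φ i).Close ε χ) →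
      ∀ ε > 0, ∃ χ : Formula L Γ, ⟨Γ, χ⟩ ∈ C ∧ (Formula.conn F φ).Close ε χ := by
    intro Γ k F φ ih ε hε
    choose B hB using fun i => (φ i).exists_bound
    obtain ⟨I, δ, hδ, hF⟩ := exists_finset_unif (fun i => B i + 1) F (half_pos hε)
    choose χ hχ hχφ using fun i => ih i (min 1 (δ / 2)) (lt_min one_pos (half_pos hδ))
    obtain ⟨j, hj⟩ := exists_dense_seq_close (fun i => B i + 1) F (half_pos hε)
    refine ⟨.conn (TopologicalSpace.denseSeq _ j) χ, ?_, fun M m => ?_⟩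
    · refine h (List.ofFn fun i => ⟨Γ, χ i⟩) (fun x hx => ?_) (Or.inr (Or.inr (Or.inl
        (Set.mem_iUnion.2 ⟨⟨Γ, k, j⟩, χ, rfl, rfl⟩))))
      obtain ⟨i, rfl⟩ := (List.mem_ofFn' _ _).1 hx
      exact hχ i
    · simp only [Formula.eval]
      have hx1 : (fun i => (φ i).eval M m) ∈ box fun i => B i + 1 :=
        mem_box.2 fun i => (hB i M m).trans (by linarith)
      have hx2 : (fun i => (χ i).eval M m) ∈ box fun i => B i + 1 := mem_box.2 fun i => by
        have h1 := (hχφ i M m).trans (min_le_left _ _)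
        have h2 := hB i M m
        rw [abs_le] at h1 h2 ⊢
        constructor <;> linarith
      have h1 := hF _ hx1 _ hx2 fun i _ => by
        have := (hχφ i M m).trans (min_le_right _ _)
        linarith
      have h2 := hj _ hx2
      refine (abs_sub_le _ (F fun i => (χ i).eval M m) _).trans ?_
      linarith
  intro Γ φ
  induction φ with
  | @dist Γ s t u =>
    exact fun ε hε => ⟨.dist t u, h [] (by simp) (Or.inl ⟨⟨Γ, s, t, u⟩, rfl⟩),
      fun M m => by simpa using hε.le⟩
  | @rel Γ P ts =>
    exact fun ε hε => ⟨.rel P ts, h [] (by simp) (Or.inr (Or.inl ⟨⟨Γ, P, ts⟩, rfl⟩)),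
      fun M m => by simpa using hε.le⟩
  | conn F φ ih => exact hconn F φ ih
  | @connω Γ F φ ih =>
    intro ε hε
    choose B hB using fun i => (φ i).exists_bound
    obtain ⟨I, δ, hδ, hF⟩ := exists_finset_unif B F (half_pos hε)
    -- Coordinates outside `I` may be replaced by `0`.
    obtain ⟨n, hn⟩ : ∃ n, ∀ i ∈ I, i < n := ⟨I.sup id + 1, fun i hi =>
      Nat.lt_succ_of_le (Finset.le_sup (f := id) hi)⟩
    let G : C(Fin n → ℝ, ℝ) := ⟨fun t => F fun i => if hi : i < n then t ⟨i, hi⟩ else 0, by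
      refine F.continuous.comp (continuous_pi fun i => ?_)
      by_cases hi : i < n
      · simp only [hi, dif_pos]; exact continuous_apply _
      · simp only [hi, dif_neg, not_false_iff]; exact continuous_const⟩
    obtain ⟨χ, hχ, hχc⟩ := hconn G (fun i => φ i) (fun i => ih i) (ε / 2) (half_pos hε)
    refine ⟨χ, hχ, fun M m => ?_⟩
    have h1 := hχc M m
    have h2 : |F (fun i => (φ i).eval M m) - G fun i => (φ i).eval M m| ≤ ε / 2 := by
      refine hF _ (mem_box.2 fun i => hB i M m) _ (mem_box.2 fun i => ?_) fun i hi => ?_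
      · by_cases hi : i < n
        · simp only [hi, dif_pos]; exact hB i M m
        · simp only [hi, dif_neg, not_false_iff, abs_zero]
          exact (abs_nonneg _).trans (hB i M m)
      · simp only [hn i hi, dif_pos, sub_self, abs_zero]; exact hδ
    refine (abs_sub_le _ (G fun i => (φ i).eval M m) _).trans ?_
    simp only [Formula.eval] at h1 ⊢
    linarith
  | @sup Γ s φ ih =>
    intro ε hε
    obtain ⟨χ, hχ, hφχ⟩ := ih ε hε
    obtain ⟨B, hB⟩ := φ.exists_bound
    obtain ⟨B', hB'⟩ := χ.exists_bound
    exact ⟨.sup χ, h [⟨_, χ⟩] (by simpa using hχ) (Or.inr (Or.inr (Or.inr (Or.inl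
      (Set.mem_iUnion.2 ⟨⟨Γ, s⟩, χ, rfl, rfl⟩))))), fun M m =>
      abs_ciSup_sub_ciSup_le (C := max B B') (fun a => (hB M _).trans (le_max_left _ _))
        (fun a => (hB' M _).trans (le_max_right _ _)) fun a => hφχ M _⟩
  | @inf Γ s φ ih =>
    intro ε hε
    obtain ⟨χ, hχ, hφχ⟩ := ih ε hε
    obtain ⟨B, hB⟩ := φ.exists_bound
    obtain ⟨B', hB'⟩ := χ.exists_bound
    exact ⟨.inf χ, h [⟨_, χ⟩] (by simpa using hχ) (Or.inr (Or.inr (Or.inr (Or.inr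
      (Set.mem_iUnion.2 ⟨⟨Γ, s⟩, χ, rfl, rfl⟩))))), fun M m =>
      abs_ciInf_sub_ciInf_le (C := max B B') (fun a => (hB M _).trans (le_max_left _ _))
        (fun a => (hB' M _).trans (le_max_right _ _)) fun a => hφχ M _⟩

/-- Every set of formulas has a countable dense subset. -/
lemma exists_countable_dense_subset [Countable L.Sorts] [Countable L.Func] [Countable L.Rel]
    {Γ : List L.Sorts} (S : Set (Formula L Γ)) :
    ∃ D ⊆ S, D.Countable ∧ ∀ φ ∈ S, ∀ ε > 0, ∃ ψ ∈ D, φ.Close ε ψ := by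
  obtain ⟨C, hC, h⟩ := exists_countable_dense (L := L)
  have := hC.to_subtype
  let P : Set (C × ℕ) := {x | ∃ φ ∈ S, ∃ χ : Formula L Γ, ⟨Γ, χ⟩ = x.1.1 ∧
    φ.Close (1 / ((x.2 : ℝ) + 1)) χ}
  choose f hfS χ hχ hf using fun x : P => x.2
  refine ⟨Set.range f, by rintro _ ⟨x, rfl⟩; exact hfS x, Set.countable_range f,
    fun φ hφ ε hε => ?_⟩
  obtain ⟨n, hn⟩ := exists_nat_one_div_lt (half_pos hε)
  obtain ⟨χ', hχ', hφχ⟩ := h φ (1 / ((n : ℝ) + 1)) Nat.one_div_pos_of_nat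
  let x : P := ⟨⟨⟨_, hχ'⟩, n⟩, φ, hφ, χ', rfl, hφχ⟩
  refine ⟨f x, ⟨x, rfl⟩, fun M m => ?_⟩
  have h1 : χ x = χ' := by simpa [x] using hχ x
  have h2 := hf x M m
  rw [h1] at h2
  have h3 := hφχ M m
  have h4 : 1 / (((x.1.2 : ℕ) : ℝ) + 1) < ε / 2 := hn
  rw [abs_sub_comm] at h2
  refine (abs_sub_le _ (χ'.eval M m) _).trans ?_
  linarith

lemma IsDistortionSystem.exists_isDenseFamily [Countable L.Sorts] [Countable L.Func]
    [Countable L.Rel] {T : Theory L} {Δ : FormulaSet L} (hΔ : IsDistortionSystem T Δ)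
    (Ω : WeakModulus) : ∃ ψ, IsDenseFamily T Δ Ω ψ := by
  have : ∀ Γ, ∃ ψ : ℕ → Formula L Γ, (∀ i, ψ i ∈ Δ Γ ∧ (ψ i).Respects Ω) ∧
      ∀ φ ∈ Δ Γ, φ.Respects Ω → ∀ ε > 0, ∃ i, CloseMod T ε φ (ψ i) := by
    intro Γ
    obtain ⟨D, hDS, hD, h⟩ := exists_countable_dense_subset {φ | φ ∈ Δ Γ ∧ φ.Respects Ω}
    -- A constant formula, which makes the set to be enumerated nonempty.
    let c : Formula L Γ := .conn (ContinuousMap.const (Fin 0 → ℝ) 0) Fin.elim0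
    have hc : c ∈ {φ | φ ∈ Δ Γ ∧ φ.Respects Ω} :=
      ⟨hΔ.conn _ (LipschitzWith.const' 0) _ fun i => i.elim0, fun M m m' => by
        simp [c, Formula.eval]⟩
    obtain ⟨d, hd, -⟩ := h c hc 1 one_pos
    obtain ⟨ψ, rfl⟩ := hD.exists_eq_range ⟨d, hd⟩
    refine ⟨ψ, fun i => hDS ⟨i, rfl⟩, fun φ hφ hr ε hε => ?_⟩
    obtain ⟨_, ⟨i, rfl⟩, hi⟩ := h φ ⟨hφ, hr⟩ ε hε
    exact ⟨i, fun M _ m => hi M m⟩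
  choose ψ hψ using this
  exact ⟨ψ, hψ⟩

/-! ### Existence of suitable weak moduli -/

/-- A bounded "modulus of continuity", given as a set of pairs `(t, r)`, is dominated by a
continuous subadditive one: `V t = inf_ε (ε + (D / δ(ε)) t)` with `D = max C 1`. -/
lemma exists_modulus (Q : ℝ≥0 → ℝ → Prop) {C : ℝ} (hC : ∀ t r, Q t r → r ≤ C)
    (hQ : ∀ ε > 0, ∃ δ > (0 : ℝ), ∀ (t : ℝ≥0) (r : ℝ), (t : ℝ) < δ → Q t r → r ≤ ε) :
    ∃ V : ℝ≥0 → ℝ≥0∞, Monotone V ∧ (∀ s t, V (s + t) ≤ V s + V t) ∧ V 0 = 0 ∧ Continuous V ∧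
      ∀ t r, Q t r → ENNReal.ofReal r ≤ V t := by
  choose δ hδ h using fun ε : {ε : ℝ // 0 < ε} => hQ ε ε.2
  obtain ⟨D, hD, hCD⟩ : ∃ D : ℝ, 0 < D ∧ C ≤ D := ⟨max C 1, by positivity, le_max_left _ _⟩
  set A : {ε : ℝ // 0 < ε} → ℝ≥0 → ℝ := fun ε t => ε + D / δ ε * t with hA
  have hA0 : ∀ ε t, 0 ≤ A ε t := fun ε t =>
    add_nonneg ε.2.le (mul_nonneg (div_nonneg hD.le (hδ ε).le) t.2)
  set V : ℝ≥0 → ℝ≥0∞ := fun t => ⨅ ε, ENNReal.ofReal (A ε t) with hV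
  have hle : ∀ ε t, V t ≤ ENNReal.ofReal (A ε t) := fun ε t => iInf_le _ ε
  have hmono : Monotone V := fun s t hst => iInf_mono fun ε => ENNReal.ofReal_le_ofReal
    (add_le_add_right (mul_le_mul_of_nonneg_left (by exact_mod_cast hst)
      (div_nonneg hD.le (hδ ε).le)) _)
  have hsub : ∀ s t, V (s + t) ≤ V s + V t := by
    intro s t
    simp only [hV, ENNReal.iInf_add, ENNReal.add_iInf]
    refine le_iInf fun ε => le_iInf fun ε' => ?_
    rw [← ENNReal.ofReal_add (hA0 _ _) (hA0 _ _)]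
    rcases le_total (δ ε) (δ ε') with hle | hle
    · refine (iInf_le _ ε').trans (ENNReal.ofReal_le_ofReal ?_)
      have : D / δ ε' * t ≤ D / δ ε * t := mul_le_mul_of_nonneg_right
        (div_le_div_of_nonneg_left hD.le (hδ ε) hle) t.2
      simp only [hA, NNReal.coe_add]
      have := ε.2
      linarith
    · refine (iInf_le _ ε).trans (ENNReal.ofReal_le_ofReal ?_)
      have : D / δ ε * s ≤ D / δ ε' * s := mul_le_mul_of_nonneg_right
        (div_le_div_of_nonneg_left hD.le (hδ ε') hle) s.2
      simp only [hA, NNReal.coe_add]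
      have := ε'.2
      linarith
  have htop : ∀ t, V t ≠ ⊤ := fun t => ne_top_of_le_ne_top ENNReal.ofReal_ne_top (hle ⟨1, one_pos⟩ t)
  have hreal : ∀ ε t, (V t).toReal ≤ A ε t := fun ε t => ENNReal.toReal_le_of_le_ofReal (hA0 ε t) (hle ε t)
  refine ⟨V, hmono, hsub, ?_, ?_, ?_⟩
  · refine le_antisymm (ENNReal.le_of_forall_pos_le_add fun ε hε _ => ?_) zero_le
    refine (hle ⟨ε, hε⟩ 0).trans ?_
    simp [hA]
  · have hc : Continuous fun t => (V t).toReal := by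
      rw [Metric.continuous_iff]
      intro t ε hε
      let e : {ε : ℝ // 0 < ε} := ⟨ε / 2, half_pos hε⟩
      have hpos : 0 < D / δ e := div_pos hD (hδ e)
      refine ⟨ε / 2 / (D / δ e), div_pos (half_pos hε) hpos, fun s hs => ?_⟩
      have key : ∀ s t : ℝ≥0, (V s).toReal ≤ (V t).toReal + (V (nndist s t)).toReal := by
        intro s t
        rw [← ENNReal.toReal_add (htop _) (htop _)]
        refine ENNReal.toReal_mono (ENNReal.add_ne_top.2 ⟨htop _, htop _⟩)
          ((hmono ?_).trans (hsub _ _))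
        rw [← NNReal.coe_le_coe, NNReal.coe_add, coe_nndist, NNReal.dist_eq]
        linarith [le_abs_self ((s : ℝ) - t)]
      have h1 := key s t
      have h2 := key t s
      rw [nndist_comm t s] at h2
      have h3 : (V (nndist s t)).toReal < ε := by
        refine (hreal e _).trans_lt ?_
        rw [lt_div_iff₀ hpos] at hs
        simp only [hA, coe_nndist]
        have : (e : ℝ) = ε / 2 := rfl
        linarith
      rw [Real.dist_eq, abs_sub_lt_iff]
      constructor <;> linarith
    have : V = fun t => ENNReal.ofReal (V t).toReal :=
      funext fun t => (ENNReal.ofReal_toReal (htop t)).symm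
    rw [this]
    exact ENNReal.continuous_ofReal.comp hc
  · intro t r hr
    refine le_iInf fun ε => ENNReal.ofReal_le_ofReal ?_
    rcases lt_or_ge (t : ℝ) (δ ε) with ht | ht
    · exact (h ε t r ht hr).trans (le_add_of_nonneg_right
        (mul_nonneg (div_nonneg hD.le (hδ ε).le) t.2))
    · refine ((hC t r hr).trans hCD).trans ?_
      have : D ≤ D / δ ε * t := by
        rw [div_mul_eq_mul_div, le_div_iff₀ (hδ ε)]
        exact mul_le_mul_of_nonneg_left ht hD.le
      simp only [hA]
      linarith [ε.2]

/-- The weak modulus `Ω(δ) = sup_i W_i(δ_i)` built from an increasing sequence of one-variable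
moduli. -/
lemma exists_weakModulus (W : ℕ → ℝ≥0 → ℝ≥0∞) (hm : ∀ i, Monotone (W i))
    (hs : ∀ i s t, W i (s + t) ≤ W i s + W i t) (h0 : ∀ i, W i 0 = 0) (hc : ∀ i, Continuous (W i))
    (hi : ∀ t, Monotone fun i => W i t) :
    ∃ Ω : WeakModulus, Ω.ShiftIncreasing ∧ ∀ d, Ω.toFun d = ⨆ i, W i (d i) := by
  refine ⟨{ toFun := fun d => ⨆ i, W i (d i)
            mono := fun d e hde => iSup_mono fun i => hm i (hde i)
            subadd := fun d e => iSup_le fun i => (hs i _ _).trans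
              (add_le_add (le_iSup (fun i => W i (d i)) i) (le_iSup (fun i => W i (e i)) i))
            zero := by simp [h0]
            lsc := lowerSemicontinuous_iSup fun i =>
              ((hc i).comp (continuous_apply i)).lowerSemicontinuous
            cont := fun d i => ?_ }, fun j hj d => ?_, fun d => rfl⟩
  · have : (fun t => ⨆ k, W k (Function.update d i t k)) =
        fun t => W i t ⊔ ⨆ k, W k (Function.update d i 0 k) := by
      funext t
      refine le_antisymm (iSup_le fun k => ?_) (sup_le ?_ (iSup_mono fun k => hm k ?_))
      · by_cases hk : k = i
        · subst hk; simp
        · rw [Function.update_of_ne hk]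
          refine le_sup_of_le_right (le_iSup_of_le k ?_)
          rw [Function.update_of_ne hk]
      · exact le_iSup_of_le i (by simp)
      · by_cases hk : k = i
        · subst hk; simp
        · simp [Function.update_of_ne hk]
    rw [this]
    exact (hc i).sup continuous_const
  · refine iSup_le fun i => le_iSup_of_le (j i) ?_
    rw [hj.injective.extend_apply]
    exact hi _ (hj.le_apply)

lemma le_distortion {Δ : FormulaSet L} {M N : Structure L} (R : Relation M N) {Γ : List L.Sorts}
    {φ : Formula L Γ} (hφ : φ ∈ Δ Γ) {m : M.Env Γ} {n : N.Env Γ} (h : R.Holds m n) :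
    edist (φ.eval M m) (φ.eval N n) ≤ distortion Δ R :=
  le_iSup_of_le Γ (le_iSup₂_of_le φ hφ (le_iSup₂_of_le m n (le_iSup_of_le h le_rfl)))

lemma distortion_le {Δ : FormulaSet L} {M N : Structure L} {R : Relation M N} {c : ℝ≥0∞}
    (h : ∀ Γ, ∀ φ ∈ Δ Γ, ∀ (m : M.Env Γ) (n : N.Env Γ), R.Holds m n →
      edist (φ.eval M m) (φ.eval N n) ≤ c) : distortion Δ R ≤ c :=
  iSup_le fun Γ => iSup₂_le fun φ hφ => iSup₂_le fun m n => iSup_le fun hR => h Γ φ hφ m n hR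

lemma Relation.holds_iff {M N : Structure L} {R : Relation M N} : ∀ {Γ : List L.Sorts}
    {m : M.Env Γ} {n : N.Env Γ}, R.Holds m n ↔
      ∀ (s : L.Sorts) (x : Var Γ s), (m.lookup x, n.lookup x) ∈ R s
  | [], _, _ => ⟨fun _ _ x => (nomatch x), fun _ => trivial⟩
  | s :: Γ, m, n => by
    refine ⟨fun h t x => ?_, fun h => ⟨h s .head, holds_iff.2 fun t x => h t x.tail⟩⟩
    cases x with
    | head => exact h.1
    | tail x => exact holds_iff.1 h.2 t x

/-- Some term of `distSeq` bounds the distances of all corresponding entries. -/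
lemma Structure.exists_max_distSeq (M : Structure L) {Γ : List L.Sorts} (m m' : M.Env Γ) :
    ∃ i, ∀ (s : L.Sorts) (x : Var Γ s),
      dist (m.lookup x) (m'.lookup x) ≤ (M.distSeq m m' i : ℝ) := by
  obtain ⟨i, -, hi⟩ := Finset.exists_max_image (Finset.range (Γ.length + 1)) (M.distSeq m m')
    ⟨0, by simp⟩
  refine ⟨i, fun s x => ?_⟩
  have := hi x.pos (Finset.mem_range.2 (x.pos_lt.trans (Nat.lt_succ_self _)))
  rw [M.distSeq_pos] at this
  exact_mod_cast this

/-- Thickening the identity shows that the formulas of a u.u.c. `Δ` are uniformly equicontinuous. -/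
lemma UUC.unif {T : Theory L} {Δ : FormulaSet L} (h : UUC T Δ) : ∀ ε > 0, ∃ δ > (0 : ℝ),
    ∀ M : Structure L, M.Models T → ∀ Γ, ∀ φ ∈ Δ Γ, ∀ m m' : M.Env Γ, M.Near δ m m' →
      |φ.eval M m - φ.eval M m'| ≤ ε := by
  intro ε hε
  obtain ⟨δ, hδ, h⟩ := h ε.toNNReal (Real.toNNReal_pos.2 hε)
  refine ⟨δ, hδ, fun M hM Γ φ hφ m m' hm => ?_⟩
  -- The relation to be thickened is the identity.
  let R : Relation M M := fun s => {p | p.1 = p.2}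
  have hdom : R.dom = fun s => Set.univ := funext fun s => Set.eq_univ_of_forall fun a => ⟨a, rfl⟩
  have hran : R.ran = fun s => Set.univ := funext fun s => Set.eq_univ_of_forall fun a => ⟨a, rfl⟩
  have hu : M.IsDenseSub fun s => Set.univ := ⟨fun s => dense_univ, fun _ _ _ => trivial⟩
  have h1 := h M M hM hM R ⟨by rw [hdom]; exact hu, by rw [hran]; exact hu⟩
  have h2 : distortion Δ R ≤ 0 := distortion_le fun Γ φ _ m n hmn => by
    have : m = n := Structure.Env.ext (Relation.holds_iff.1 hmn)
    rw [this, edist_self]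
  have h3 : (R.thicken δ).Holds m m' := Relation.holds_iff.2 fun s x =>
    ⟨(m.lookup x, m.lookup x), rfl, by simpa using hδ, by
      have := hm s x
      rwa [dist_comm] at this⟩
  have h4 := ((le_distortion _ hφ h3).trans h1).trans (add_le_add_left h2 _)
  rw [zero_add, edist_dist, Real.dist_eq] at h4
  exact (ENNReal.ofReal_le_ofReal_iff hε.le).1 h4

/-- The `[0, 1]`-valued formulas of `Δ` have a common modulus `V`, and `Ω(δ) = sup_i V(δ_i)` is suitable. -/
lemma UUC.exists_suitable {T : Theory L} {Δ : FormulaSet L} (h : UUC T Δ) :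
    ∃ Ω : WeakModulus, Ω.ShiftIncreasing ∧ SuitableUUC T Δ Ω := by
  obtain ⟨V, hm, hs, h0, hc, hV⟩ := exists_modulus (C := 1)
    (fun t r => ∃ Γ, ∃ φ ∈ Δ Γ,
      (∀ M : Structure L, M.Models T → ∀ m : M.Env Γ, φ.eval M m ∈ Set.Icc (0 : ℝ) 1) ∧
      ∃ M : Structure L, M.Models T ∧ ∃ m m' : M.Env Γ,
        (∀ (s : L.Sorts) (x : Var Γ s), dist (m.lookup x) (m'.lookup x) ≤ (t : ℝ)) ∧
        r = |φ.eval M m - φ.eval M m'|)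
    (by
      rintro t r ⟨Γ, φ, hφ, h01, M, hM, m, m', -, rfl⟩
      have h1 := h01 M hM m
      have h2 := h01 M hM m'
      rw [abs_le]
      constructor <;> linarith [h1.1, h1.2, h2.1, h2.2])
    (by
      intro ε hε
      obtain ⟨δ, hδ, h⟩ := h.unif ε hε
      refine ⟨δ, hδ, ?_⟩
      rintro t r ht ⟨Γ, φ, hφ, -, M, hM, m, m', hmm, rfl⟩
      exact h M hM Γ φ hφ m m' fun s x => (hmm s x).trans_lt ht)
  obtain ⟨Ω, hΩ, hΩV⟩ := exists_weakModulus (fun _ => V) (fun _ => hm) (fun _ => hs) (fun _ => h0)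
    (fun _ => hc) (fun t => monotone_const)
  refine ⟨Ω, hΩ, fun Γ φ hφ h01 M hM => Formula.respectsFrom_zero_iff.2 fun m m' => ?_⟩
  obtain ⟨i, hi⟩ := M.exists_max_distSeq m m'
  rw [hΩV, edist_dist, Real.dist_eq]
  exact (hV _ _ ⟨Γ, φ, hφ, h01, M, hM, m, m', hi, rfl⟩).trans
    (le_iSup (fun i => V (M.distSeq m m' i)) i)

/-- Let `U n` be a modulus of the `n`-th formula of a countable dense subset of `Δ`. Then
`Ω(δ) = sup_i ∑_{n ≤ i} U n (δ_i)` is suitable: the `n`-th formula respects `Ω` once its variables are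
shifted by `n`. -/
lemma exists_suitableFunctional [Countable L.Sorts] [Countable L.Func] [Countable L.Rel]
    (T : Theory L) (Δ : FormulaSet L) :
    ∃ Ω : WeakModulus, Ω.ShiftIncreasing ∧ SuitableFunctional T Δ Ω := by
  choose D hDΔ hDc hD using fun Γ => exists_countable_dense_subset (Δ Γ)
  have := fun Γ => (hDc Γ).to_subtype
  obtain ⟨e, he⟩ := exists_injective_nat (Σ Γ, D Γ)
  have hmod : ∀ x : Σ Γ, D Γ, ∃ V : ℝ≥0 → ℝ≥0∞, Monotone V ∧ (∀ s t, V (s + t) ≤ V s + V t) ∧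
      V 0 = 0 ∧ Continuous V ∧ ∀ (M : Structure L) (m m' : M.Env x.1) (t : ℝ≥0),
        (∀ (s : L.Sorts) (y : Var x.1 s), dist (m.lookup y) (m'.lookup y) ≤ (t : ℝ)) →
        edist (x.2.1.eval M m) (x.2.1.eval M m') ≤ V t := by
    rintro ⟨Γ, φ, hφ⟩
    obtain ⟨C, hC⟩ := φ.exists_bound
    obtain ⟨V, hm, hs, h0, hc, hV⟩ := exists_modulus (C := C + C)
      (fun t r => ∃ (M : Structure L) (m m' : M.Env Γ),
        (∀ (s : L.Sorts) (x : Var Γ s), dist (m.lookup x) (m'.lookup x) ≤ (t : ℝ)) ∧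
        r = |φ.eval M m - φ.eval M m'|)
      (by
        rintro t r ⟨M, m, m', -, rfl⟩
        exact (abs_sub _ _).trans (add_le_add (hC M m) (hC M m')))
      (by
        intro ε hε
        obtain ⟨δ, hδ, h⟩ := φ.unif ε hε
        refine ⟨δ, hδ, ?_⟩
        rintro t r ht ⟨M, m, m', hmm, rfl⟩
        exact h M m m' fun s x => (hmm s x).trans_lt ht)
    refine ⟨V, hm, hs, h0, hc, fun M m m' t ht => ?_⟩
    rw [edist_dist, Real.dist_eq]
    exact hV t _ ⟨M, m, m', ht, rfl⟩
  choose V hm hs h0 hc hV using hmod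
  classical
  -- The modulus of the `n`-th formula, or `0` if there is no such formula.
  let U : ℕ → ℝ≥0 → ℝ≥0∞ := fun n => if h : ∃ x, e x = n then V h.choose else fun _ => 0
  have hU : ∀ n, (∃ x, U n = V x) ∨ U n = fun _ => 0 := by
    intro n
    by_cases h : ∃ x, e x = n
    · exact Or.inl ⟨h.choose, dif_pos h⟩
    · exact Or.inr (dif_neg h)
  have hUe : ∀ x, U (e x) = V x := by
    intro x
    have h : ∃ y, e y = e x := ⟨x, rfl⟩
    have h1 : U (e x) = V h.choose := dif_pos h
    rw [h1, he h.choose_spec]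
  obtain ⟨Ω, hΩ, hΩV⟩ := exists_weakModulus (fun i t => ∑ n ∈ Finset.range (i + 1), U n t)
    (fun i s t hst => Finset.sum_le_sum fun n _ => by
      rcases hU n with ⟨x, hx⟩ | hx <;> rw [hx]
      exact hm x hst)
    (fun i s t => by
      rw [← Finset.sum_add_distrib]
      refine Finset.sum_le_sum fun n _ => ?_
      rcases hU n with ⟨x, hx⟩ | hx <;> rw [hx]
      · exact hs x s t
      · simp)
    (fun i => Finset.sum_eq_zero fun n _ => by
      rcases hU n with ⟨x, hx⟩ | hx <;> rw [hx]
      exact h0 x)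
    (fun i => continuous_finsetSum _ fun n _ => by
      rcases hU n with ⟨x, hx⟩ | hx <;> rw [hx]
      · exact hc x
      · exact continuous_const)
    (fun t i j hij => Finset.sum_le_sum_of_subset (Finset.range_mono (by omega)))
  refine ⟨Ω, hΩ, D, fun Γ => ⟨hDc Γ, hDΔ Γ⟩, fun Γ φ hφ ε hε => ?_, fun Γ φ hφ => ?_⟩
  · obtain ⟨ψ, hψ, h⟩ := hD Γ φ hφ ε hε
    exact ⟨ψ, hψ, fun M _ m => h M m⟩
  · refine ⟨e ⟨Γ, φ, hφ⟩, fun M _ m m' => ?_⟩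
    obtain ⟨i, hi⟩ := M.exists_max_distSeq m m'
    rw [hΩV]
    refine le_iSup_of_le (i + e ⟨Γ, φ, hφ⟩) ?_
    rw [Function.Injective.extend_apply (f := fun i => i + e ⟨Γ, φ, hφ⟩)
      (fun _ _ h => by simpa using h)]
    refine le_trans ?_ (Finset.single_le_sum (f := fun n => U n (M.distSeq m m' i))
      (fun _ _ => zero_le) (Finset.mem_range.2 (by omega : e ⟨Γ, φ, hφ⟩ < _)))
    simp only [hUe]
    exact hV ⟨Γ, φ, hφ⟩ M m m' _ hi

lemma exists_suitable [Countable L.Sorts] [Countable L.Func] [Countable L.Rel]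
    {T : Theory L} {Δ : FormulaSet L} (h : UUC T Δ ∨ Functional T Δ) :
    ∃ Ω : WeakModulus, Suitable T Δ Ω := by
  rcases h with h | h
  · obtain ⟨Ω, h1, h2⟩ := h.exists_suitable
    exact ⟨Ω, h1, Or.inl ⟨h, h2⟩⟩
  · obtain ⟨Ω, h1, h2⟩ := exists_suitableFunctional T Δ
    exact ⟨Ω, h1, Or.inr ⟨h, h2⟩⟩

/-! ### Back-and-forth pseudo-metrics -/

section BackForth

variable {Δ : FormulaSet L} {Ω : WeakModulus} {M N P : Structure L}

lemma backForth_zero (Γ : List L.Sorts) (m : M.Env Γ) (n : N.Env Γ) :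
    backForth Δ Ω M N 0 Γ m n =
      ⨆ (ψ ∈ Δ Γ) (_ : ψ.Respects Ω), edist (ψ.eval M m) (ψ.eval N n) := by
  rw [backForth, Ordinal.limitRecOn_zero]

lemma backForth_add_one (α : Ordinal.{0}) (Γ : List L.Sorts) (m : M.Env Γ) (n : N.Env Γ) :
    backForth Δ Ω M N (α + 1) Γ m n =
      (⨆ (s : L.Sorts) (a : M.carrier s), ⨅ b : N.carrier s,
        backForth Δ Ω M N α (s :: Γ) (a, m) (b, n)) ⊔
      ⨆ (s : L.Sorts) (b : N.carrier s), ⨅ a : M.carrier s,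
        backForth Δ Ω M N α (s :: Γ) (a, m) (b, n) := by
  rw [backForth, Ordinal.limitRecOn_add_one]
  rfl

lemma backForth_limit {l : Ordinal.{0}} (hl : Order.IsSuccLimit l) (Γ : List L.Sorts)
    (m : M.Env Γ) (n : N.Env Γ) :
    backForth Δ Ω M N l Γ m n =
      ⨆ (β : Ordinal.{0}) (_ : β < l), backForth Δ Ω M N β Γ m n := by
  rw [backForth, Ordinal.limitRecOn_limit _ _ _ _ hl]
  rfl

lemma edist_le_backForth_zero {Γ : List L.Sorts} {ψ : Formula L Γ} (hψ : ψ ∈ Δ Γ)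
    (hr : ψ.Respects Ω) (m : M.Env Γ) (n : N.Env Γ) :
    edist (ψ.eval M m) (ψ.eval N n) ≤ backForth Δ Ω M N 0 Γ m n := by
  rw [backForth_zero]
  exact le_iSup₂_of_le ψ hψ (le_iSup_of_le hr le_rfl)

lemma iInf_le_backForth_left (α : Ordinal.{0}) (Γ : List L.Sorts) (m : M.Env Γ) (n : N.Env Γ)
    {s : L.Sorts} (a : M.carrier s) :
    ⨅ b : N.carrier s, backForth Δ Ω M N α (s :: Γ) (a, m) (b, n) ≤
      backForth Δ Ω M N (α + 1) Γ m n := by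
  rw [backForth_add_one]
  exact le_sup_of_le_left (le_iSup₂_of_le s a le_rfl)

lemma iInf_le_backForth_right (α : Ordinal.{0}) (Γ : List L.Sorts) (m : M.Env Γ) (n : N.Env Γ)
    {s : L.Sorts} (b : N.carrier s) :
    ⨅ a : M.carrier s, backForth Δ Ω M N α (s :: Γ) (a, m) (b, n) ≤
      backForth Δ Ω M N (α + 1) Γ m n := by
  rw [backForth_add_one]
  exact le_sup_of_le_right (le_iSup₂_of_le s b le_rfl)

/-- Within one structure, a new element can be answered by itself, which leaves the sequence of distances
unchanged. -/
lemma backForth_self_le (α : Ordinal.{0}) : ∀ (Γ : List L.Sorts) (m m' : M.Env Γ),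
    backForth Δ Ω M M α Γ m m' ≤ Ω.toFun (M.distSeq m m') := by
  induction α using Ordinal.limitRecOn with
  | zero =>
    intro Γ m m'
    rw [backForth_zero]
    exact iSup₂_le fun ψ _ => iSup_le fun hr => hr M m m'
  | add_one α ih =>
    intro Γ m m'
    have h : ∀ (s : L.Sorts) (a : M.carrier s),
        backForth Δ Ω M M α (s :: Γ) (a, m) (a, m') ≤ Ω.toFun (M.distSeq m m') := fun s a => by
      rw [← M.distSeq_cons_same a m m']; exact ih (s :: Γ) (a, m) (a, m')
    rw [backForth_add_one]
    exact sup_le (iSup₂_le fun s a => iInf_le_of_le a (h s a))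
      (iSup₂_le fun s a => iInf_le_of_le a (h s a))
  | limit l hl ih =>
    intro Γ m m'
    rw [backForth_limit hl]
    exact iSup₂_le fun β hβ => ih β hβ Γ m m'

lemma backForth_triangle (α : Ordinal.{0}) : ∀ (Γ : List L.Sorts) (m : M.Env Γ) (n : N.Env Γ)
    (p : P.Env Γ), backForth Δ Ω M P α Γ m p ≤
      backForth Δ Ω M N α Γ m n + backForth Δ Ω N P α Γ n p := by
  induction α using Ordinal.limitRecOn with
  | zero =>
    intro Γ m n p
    rw [backForth_zero]
    exact iSup₂_le fun ψ hψ => iSup_le fun hr => (edist_triangle _ (ψ.eval N n) _).trans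
      (add_le_add (edist_le_backForth_zero hψ hr m n) (edist_le_backForth_zero hψ hr n p))
  | add_one α ih =>
    intro Γ m n p
    rw [backForth_add_one]
    refine sup_le (iSup₂_le fun s a => ?_) (iSup₂_le fun s c => ?_)
    · refine le_trans ?_ (add_le_add_left (iInf_le_backForth_left α Γ m n a) _)
      rw [ENNReal.iInf_add]
      refine le_iInf fun b => ?_
      refine le_trans ?_ (add_le_add_right (iInf_le_backForth_left α Γ n p b) _)
      rw [ENNReal.add_iInf]
      exact iInf_mono fun c => ih (s :: Γ) (a, m) (b, n) (c, p)
    · refine le_trans ?_ (add_le_add_right (iInf_le_backForth_right α Γ n p c) _)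
      rw [ENNReal.add_iInf]
      refine le_iInf fun b => ?_
      refine le_trans ?_ (add_le_add_left (iInf_le_backForth_right α Γ m n b) _)
      rw [ENNReal.iInf_add]
      exact iInf_mono fun a => ih (s :: Γ) (a, m) (b, n) (c, p)
  | limit l hl ih =>
    intro Γ m n p
    simp only [backForth_limit hl]
    exact iSup₂_le fun β hβ => (ih β hβ Γ m n p).trans (add_le_add
      (le_iSup₂ (f := fun β (_ : β < l) => backForth Δ Ω M N β Γ m n) β hβ)
      (le_iSup₂ (f := fun β (_ : β < l) => backForth Δ Ω N P β Γ n p) β hβ))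

/-- The back-and-forth pseudo-metrics respect `Ω`. -/
lemma backForth_le_add (α : Ordinal.{0}) {Γ : List L.Sorts} (m m' : M.Env Γ) (n n' : N.Env Γ) :
    backForth Δ Ω M N α Γ m n ≤ Ω.toFun (M.distSeq m m') + backForth Δ Ω M N α Γ m' n' +
      Ω.toFun (N.distSeq n' n) :=
  (backForth_triangle α Γ m n' n).trans (add_le_add ((backForth_triangle α Γ m m' n').trans
    (add_le_add_left (backForth_self_le α Γ m m') _)) (backForth_self_le α Γ n' n))

lemma distSeq_tail_le {Γ : List L.Sorts} {s : L.Sorts} (v w : M.Env (s :: Γ)) :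
    M.distSeq v.2 w.2 ≤ M.distSeq v w :=
  M.distSeq_le fun _ x => (M.distSeq_pos v w x.tail).ge

lemma backForth_zero_le_cons (hren : ∀ {Γ Γ'} (f : Renaming Γ Γ'), ∀ φ ∈ Δ Γ, φ.rename f ∈ Δ Γ')
    {Γ : List L.Sorts} {s : L.Sorts} (m : M.Env Γ) (n : N.Env Γ) (a : M.carrier s)
    (b : N.carrier s) :
    backForth Δ Ω M N 0 Γ m n ≤ backForth Δ Ω M N 0 (s :: Γ) (a, m) (b, n) := by
  rw [backForth_zero]
  refine iSup₂_le fun ψ hψ => iSup_le fun hr => ?_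
  -- Adding a dummy variable.
  let f : Renaming Γ (s :: Γ) := fun _ x => x.tail
  have hf : ∀ (Q : Structure L) (v : Q.Env (s :: Γ)), (ψ.rename f).eval Q v = ψ.eval Q v.2 := by
    intro Q v
    rw [Formula.eval_rename]
    exact congrArg _ (Structure.Env.ext fun _ x => Structure.Env.lookup_comap f v x)
  have h := edist_le_backForth_zero (M := M) (N := N) (Ω := Ω) (hren f ψ hψ) (fun Q v w => by
    rw [hf, hf]
    exact (hr Q v.2 w.2).trans (Ω.mono (distSeq_tail_le v w)))
    ((a, m) : M.Env (s :: Γ)) ((b, n) : N.Env (s :: Γ))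
  exact (congrArg₂ edist (hf M (a, m)) (hf N (b, n))).ge.trans h

/-- The pseudo-metrics increase with `α`. Both claims are proved by one induction: the step to `α + 1`
is monotone in `r_α`, and `r_0 ≤ r_1` because dummy variables may be added. -/
lemma backForth_le_add_one [Nonempty L.Sorts]
    (hren : ∀ {Γ Γ'} (f : Renaming Γ Γ'), ∀ φ ∈ Δ Γ, φ.rename f ∈ Δ Γ') (α : Ordinal.{0}) :
    (∀ β ≤ α, ∀ (Γ : List L.Sorts) (m : M.Env Γ) (n : N.Env Γ),
      backForth Δ Ω M N β Γ m n ≤ backForth Δ Ω M N α Γ m n) ∧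
    ∀ (Γ : List L.Sorts) (m : M.Env Γ) (n : N.Env Γ),
      backForth Δ Ω M N α Γ m n ≤ backForth Δ Ω M N (α + 1) Γ m n := by
  have hstep : ∀ α β : Ordinal.{0}, (∀ (Γ : List L.Sorts) (m : M.Env Γ) (n : N.Env Γ),
      backForth Δ Ω M N α Γ m n ≤ backForth Δ Ω M N β Γ m n) →
      ∀ (Γ : List L.Sorts) (m : M.Env Γ) (n : N.Env Γ),
      backForth Δ Ω M N (α + 1) Γ m n ≤ backForth Δ Ω M N (β + 1) Γ m n := by
    intro α β h Γ m n
    rw [backForth_add_one, backForth_add_one]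
    exact sup_le_sup
      (iSup₂_mono fun s a => iInf_mono fun b => h (s :: Γ) (a, m) (b, n))
      (iSup₂_mono fun s b => iInf_mono fun a => h (s :: Γ) (a, m) (b, n))
  induction α using Ordinal.limitRecOn with
  | zero =>
    refine ⟨fun β hβ Γ m n => by rw [nonpos_iff_eq_zero.1 hβ], fun Γ m n => ?_⟩
    obtain ⟨s⟩ := ‹Nonempty L.Sorts›
    obtain ⟨a⟩ := M.nonempty s
    exact (le_iInf fun b => backForth_zero_le_cons hren m n a b).trans
      (iInf_le_backForth_left 0 Γ m n a)
  | add_one α ih =>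
    refine ⟨fun β hβ Γ m n => ?_, hstep _ _ ih.2⟩
    rcases hβ.eq_or_lt with rfl | hβ
    · exact le_rfl
    · exact (ih.1 β (Order.lt_add_one_iff.1 hβ) Γ m n).trans (ih.2 Γ m n)
  | limit l hl ih =>
    have h1 : ∀ β ≤ l, ∀ (Γ : List L.Sorts) (m : M.Env Γ) (n : N.Env Γ),
        backForth Δ Ω M N β Γ m n ≤ backForth Δ Ω M N l Γ m n := by
      intro β hβ Γ m n
      rcases hβ.eq_or_lt with rfl | hβ
      · exact le_rfl
      · rw [backForth_limit hl]
        exact le_iSup₂ (f := fun β (_ : β < l) => backForth Δ Ω M N β Γ m n) β hβ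
    refine ⟨h1, fun Γ m n => ?_⟩
    rw [backForth_limit hl]
    exact iSup₂_le fun β hβ => ((ih β hβ).2 Γ m n).trans (hstep β l (h1 β hβ.le) Γ m n)

lemma backForth_mono [Nonempty L.Sorts]
    (hren : ∀ {Γ Γ'} (f : Renaming Γ Γ'), ∀ φ ∈ Δ Γ, φ.rename f ∈ Δ Γ') {α β : Ordinal.{0}}
    (h : α ≤ β) (Γ : List L.Sorts) (m : M.Env Γ) (n : N.Env Γ) :
    backForth Δ Ω M N α Γ m n ≤ backForth Δ Ω M N β Γ m n :=
  (backForth_le_add_one hren β).1 α h Γ m n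

lemma Relation.IsCor.exists_right {R : Relation M N} (hR : R.IsCor) {s : L.Sorts}
    (a : M.carrier s) : ∃ b, (a, b) ∈ R s := by
  have : a ∈ R.dom s := by rw [(hR s).1]; trivial
  exact this

lemma Relation.IsCor.exists_left {R : Relation M N} (hR : R.IsCor) {s : L.Sorts}
    (b : N.carrier s) : ∃ a, (a, b) ∈ R s := by
  have : b ∈ R.ran s := by rw [(hR s).2]; trivial
  exact this

/-- A correlation `R` provides answers in the back-and-forth game. -/
lemma backForth_le_distortion {R : Relation M N} (hR : R.IsCor) (α : Ordinal.{0}) :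
    ∀ (Γ : List L.Sorts) (m : M.Env Γ) (n : N.Env Γ), R.Holds m n →
      backForth Δ Ω M N α Γ m n ≤ distortion Δ R := by
  induction α using Ordinal.limitRecOn with
  | zero =>
    intro Γ m n h
    rw [backForth_zero]
    exact iSup₂_le fun ψ hψ => iSup_le fun _ => le_distortion R hψ h
  | add_one α ih =>
    intro Γ m n h
    rw [backForth_add_one]
    refine sup_le (iSup₂_le fun s a => ?_) (iSup₂_le fun s b => ?_)
    · obtain ⟨b, hb⟩ := hR.exists_right a
      exact iInf_le_of_le b (ih (s :: Γ) (a, m) (b, n) ⟨hb, h⟩)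
    · obtain ⟨a, ha⟩ := hR.exists_left b
      exact iInf_le_of_le a (ih (s :: Γ) (a, m) (b, n) ⟨ha, h⟩)
  | limit l hl ih =>
    intro Γ m n h
    rw [backForth_limit hl]
    exact iSup₂_le fun β hβ => ih β hβ Γ m n h

/-! ### The Scott rank of a separable structure is countable -/

/-- Every tuple is near a tuple with entries in the dense sequences. The equality of contexts is
expressed by equality in a sigma type. -/
lemma exists_tuple_near {a : (s : L.Sorts) → ℕ → M.carrier s} (ha : ∀ s, DenseRange (a s))
    {δ : ℝ} (hδ : 0 < δ) : ∀ (Γ : List L.Sorts) (m : M.Env Γ),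
    ∃ (l : List (L.Sorts × ℕ)) (m' : M.Env Γ),
      (⟨Γ, m'⟩ : Σ Γ, M.Env Γ) = ⟨l.map Prod.fst, tupleOf a l⟩ ∧ M.Near δ m m'
  | [], _ => ⟨[], (), rfl, fun _ x => nomatch x⟩
  | s :: Γ, m => by
    obtain ⟨l, m', h, hm⟩ := exists_tuple_near ha hδ Γ m.2
    obtain ⟨i, hi⟩ := (ha s).exists_dist_lt m.1 hδ
    obtain ⟨rfl, h⟩ := Sigma.mk.inj h
    obtain rfl := eq_of_heq h
    exact ⟨(s, i) :: l, (a s i, tupleOf a l), rfl,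
      Structure.Near.cons (a := m.1) (m := m.2) hi hm⟩

/-- The inequality `r_β ≤ r_α`, where `r_α < c`, passes from a dense set of tuples to all tuples, since
both pseudo-metrics respect `Ω`. -/
lemma backForth_le_of_dense {α β : Ordinal.{0}} {c : ℝ≥0∞} {Γ : List L.Sorts} (m : M.Env Γ)
    (n : N.Env Γ) (h : ∀ δ > 0, ∃ m' n', M.Near δ m m' ∧ N.Near δ n n' ∧
      (backForth Δ Ω M N α Γ m' n' < c →
        backForth Δ Ω M N β Γ m' n' ≤ backForth Δ Ω M N α Γ m' n'))
    (hc : backForth Δ Ω M N α Γ m n < c) :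
    backForth Δ Ω M N β Γ m n ≤ backForth Δ Ω M N α Γ m n := by
  refine ENNReal.le_of_forall_pos_le_add fun ε hε hlt => ?_
  obtain ⟨η, hη, hηε, hηc⟩ : ∃ η : ℝ≥0∞, 0 < η ∧ 4 * η ≤ ε ∧
      backForth Δ Ω M N α Γ m n + 2 * η < c := by
    obtain ⟨r, hr, hrc⟩ := ENNReal.lt_iff_exists_add_pos_lt.1 hc
    refine ⟨min (ε / 4) (r / 2), lt_min (ENNReal.div_pos (by exact_mod_cast hε.ne') (by simp))
      (ENNReal.div_pos (by exact_mod_cast hr.ne') (by simp)), ?_, ?_⟩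
    · refine (mul_le_mul_right (min_le_left _ _) _).trans ?_
      rw [ENNReal.mul_div_cancel (by simp) (by simp)]
    · refine lt_of_le_of_lt (add_le_add_right ((mul_le_mul_right (min_le_right _ _) _).trans ?_) _)
        hrc
      rw [ENNReal.mul_div_cancel (by simp) (by simp)]
  obtain ⟨δ, hδ, h1⟩ := Ω.exists_near Γ η hη
  obtain ⟨m', n', hm, hn, hmn⟩ := h δ hδ
  have hm1 := (h1 M m m' hm).le
  have hn1 := (h1 N n n' hn).le
  have hm2 := hm1
  have hn2 := hn1
  rw [M.distSeq_comm] at hm2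
  rw [N.distSeq_comm] at hn2
  have h2 : backForth Δ Ω M N α Γ m' n' ≤ backForth Δ Ω M N α Γ m n + 2 * η := by
    refine (backForth_le_add α m' m n' n).trans ((add_le_add (add_le_add_left hm2 _) hn1).trans ?_)
    rw [add_comm η, add_assoc, two_mul]
  refine (backForth_le_add β m m' n n').trans ((add_le_add (add_le_add hm1
    ((hmn (h2.trans_lt hηc)).trans h2)) hn2).trans ?_)
  refine le_trans (le_of_eq ?_) (add_le_add_right hηε _)
  ring

open scoped Ordinal in
/-- An increasing `ω₁`-sequence of extended reals is eventually constant. -/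
lemma exists_lt_omega_one_stable {f : Ordinal.{0} → ℝ≥0∞} (hf : Monotone f) :
    ∃ α < ω₁, ∀ β < ω₁, α ≤ β → f β = f α := by
  have hpos : (0 : Ordinal.{0}) < ω₁ := (Cardinal.isSuccLimit_omega 1).bot_lt
  obtain ⟨u, -, hu, hmem⟩ := exists_seq_tendsto_sSup (S := f '' Set.Iio ω₁) ⟨f 0, 0, hpos, rfl⟩
    (OrderTop.bddAbove _)
  choose g hg hgu using hmem
  refine ⟨⨆ n, g n, Ordinal.iSup_lt_omega_one hg, fun β hβ h => le_antisymm ?_ (hf h)⟩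
  refine (le_sSup (Set.mem_image_of_mem f hβ)).trans (le_of_tendsto' hu fun n => ?_)
  rw [← hgu n]
  exact hf (Ordinal.le_iSup g n)

open scoped Ordinal in
/-- The Scott rank of a separable structure is countable, and the pseudo-metrics are stable there: for
each of the countably many pairs of tuples of the dense sequences, `r_α` is constant from some
countable `α` on, and the remaining tuples are approximated by these. -/
lemma exists_scottRank [Nonempty L.Sorts] [Countable L.Sorts]
    (hren : ∀ {Γ Γ'} (f : Renaming Γ Γ'), ∀ φ ∈ Δ Γ, φ.rename f ∈ Δ Γ')
    {a : (s : L.Sorts) → ℕ → M.carrier s} (ha : ∀ s, DenseRange (a s)) :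
    scottRank Δ Ω M < ω₁ ∧ ∀ (Γ : List L.Sorts) (m n : M.Env Γ),
      backForth Δ Ω M M (scottRank Δ Ω M) Γ m n =
        backForth Δ Ω M M (scottRank Δ Ω M + 1) Γ m n := by
  let K : Set (Σ Γ, M.Env Γ) := Set.range fun l => ⟨l.map Prod.fst, tupleOf a l⟩
  have : Countable K := (Set.countable_range _).to_subtype
  -- The pairs of tuples of the same sorts with entries in the dense sequences.
  let E := {x : Σ Γ, M.Env Γ × M.Env Γ // (⟨x.1, x.2.1⟩ : Σ Γ, M.Env Γ) ∈ K ∧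
    (⟨x.1, x.2.2⟩ : Σ Γ, M.Env Γ) ∈ K}
  have : Countable E := by
    refine Function.Injective.countable (f := fun x : E =>
      ((⟨(⟨x.1.1, x.1.2.1⟩ : Σ Γ, M.Env Γ), x.2.1⟩ : K),
        (⟨(⟨x.1.1, x.1.2.2⟩ : Σ Γ, M.Env Γ), x.2.2⟩ : K))) ?_
    rintro ⟨⟨Γ, m, n⟩, h⟩ ⟨⟨Γ', m', n'⟩, h'⟩ hxy
    simp only [Prod.mk.injEq, Subtype.mk.injEq] at hxy
    obtain ⟨h1, h2⟩ := hxy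
    obtain ⟨rfl, h1⟩ := Sigma.mk.inj h1
    obtain rfl := eq_of_heq h1
    obtain rfl := eq_of_heq (Sigma.mk.inj h2).2
    rfl
  choose g hg hgs using fun x : E => exists_lt_omega_one_stable
    (f := fun α => backForth Δ Ω M M α x.1.1 x.1.2.1 x.1.2.2)
    (fun α β h => backForth_mono hren h _ _ _)
  have hlt : ⨆ x, g x < ω₁ := Ordinal.iSup_lt_omega_one hg
  have hlt' : (⨆ x, g x) + 1 < ω₁ := (Cardinal.isSuccLimit_omega 1).add_one_lt hlt
  have hmem : (⨆ x, g x) ∈ {α | ∀ Γ (m n : M.Env Γ),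
      backForth Δ Ω M M α Γ m n = backForth Δ Ω M M (α + 1) Γ m n} := by
    intro Γ m n
    refine le_antisymm ((backForth_le_add_one hren _).2 Γ m n) ?_
    by_cases htop : backForth Δ Ω M M (⨆ x, g x) Γ m n = ⊤
    · rw [htop]; exact le_top
    refine backForth_le_of_dense (c := ⊤) m n (fun δ hδ => ?_) (lt_top_iff_ne_top.2 htop)
    obtain ⟨l, m', h1, hm⟩ := exists_tuple_near ha hδ Γ m
    obtain ⟨l', n', h2, hn⟩ := exists_tuple_near ha hδ Γ n
    let x : E := ⟨⟨Γ, m', n'⟩, ⟨l, h1.symm⟩, ⟨l', h2.symm⟩⟩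
    refine ⟨m', n', hm, hn, fun _ => ?_⟩
    have hx : g x ≤ ⨆ x, g x := Ordinal.le_iSup g x
    exact ((hgs x _ hlt' (hx.trans le_self_add)).trans (hgs x _ hlt hx).symm).le
  exact ⟨(csInf_le' hmem).trans_lt hlt, csInf_mem (s := {α | ∀ Γ (m n : M.Env Γ),
      backForth Δ Ω M M α Γ m n = backForth Δ Ω M M (α + 1) Γ m n}) ⟨_, hmem⟩⟩

end BackForth

/-! ### The formulas `φ_{α,M,m}` express `min r_α 1` -/

section Eval

lemma scottFormula_zero (M : Structure L) (a : (s : L.Sorts) → ℕ → M.carrier s)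
    (ψ : (Γ : List L.Sorts) → ℕ → Formula L Γ) (Γ : List L.Sorts) (m : M.Env Γ) :
    scottFormula M a ψ 0 Γ m = .seqSup fun i : ℕ =>
      .conn (fun t : Fin 1 → ℝ => min |(ψ Γ i).eval M m - t 0| 1) ![.base (ψ Γ i)] := by
  rw [scottFormula, Ordinal.limitRecOn_zero]

lemma scottFormula_add_one (M : Structure L) (a : (s : L.Sorts) → ℕ → M.carrier s)
    (ψ : (Γ : List L.Sorts) → ℕ → Formula L Γ) (α : Ordinal.{0}) (Γ : List L.Sorts)
    (m : M.Env Γ) :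
    scottFormula M a ψ (α + 1) Γ m = .max
      (.seqSup fun p : L.Sorts × ℕ => .inf (scottFormula M a ψ α (p.1 :: Γ) (a p.1 p.2, m)))
      (.seqSup fun s : L.Sorts =>
        .sup (.seqInf fun i : ℕ => scottFormula M a ψ α (s :: Γ) (a s i, m))) := by
  rw [scottFormula, Ordinal.limitRecOn_add_one]
  rfl

lemma scottFormula_limit (M : Structure L) (a : (s : L.Sorts) → ℕ → M.carrier s)
    (ψ : (Γ : List L.Sorts) → ℕ → Formula L Γ) {l : Ordinal.{0}} (hl : Order.IsSuccLimit l)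
    (Γ : List L.Sorts) (m : M.Env Γ) :
    scottFormula M a ψ l Γ m = .seqSup fun i : l.ToType =>
      scottFormula M a ψ (Ordinal.ToType.mk.symm i).1 Γ m := by
  rw [scottFormula, Ordinal.limitRecOn_limit _ _ _ _ hl]
  rfl

lemma InfFormula.eval_max {Γ : List L.Sorts} (φ χ : InfFormula L Γ) (M : Structure L)
    (v : M.Env Γ) : (φ.max χ).eval M v = Max.max (φ.eval M v) (χ.eval M v) := rfl

lemma iSup_eq_of_denseRange {X : Type*} [PseudoMetricSpace X] {a : ℕ → X} (ha : DenseRange a)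
    {g : X → ℝ≥0∞} (hg : ∀ η : ℝ≥0∞, 0 < η → ∃ δ > 0, ∀ x y, dist x y < δ → g x ≤ g y + η) :
    ⨆ x, g x = ⨆ i, g (a i) := by
  refine le_antisymm (iSup_le fun x => ?_) (iSup_le fun i => le_iSup g (a i))
  refine ENNReal.le_of_forall_pos_le_add fun ε hε _ => ?_
  obtain ⟨δ, hδ, h⟩ := hg ε (by exact_mod_cast hε)
  obtain ⟨i, hi⟩ := ha.exists_dist_lt x hδ
  exact (h _ _ hi).trans (add_le_add_left (le_iSup (fun i => g (a i)) i) _)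

lemma iInf_eq_of_denseRange {X : Type*} [PseudoMetricSpace X] {a : ℕ → X} (ha : DenseRange a)
    {g : X → ℝ≥0∞} (hg : ∀ η : ℝ≥0∞, 0 < η → ∃ δ > 0, ∀ x y, dist x y < δ → g x ≤ g y + η) :
    ⨅ x, g x = ⨅ i, g (a i) := by
  refine le_antisymm (le_iInf fun i => iInf_le g (a i)) (le_iInf fun x => ?_)
  refine ENNReal.le_of_forall_pos_le_add fun ε hε _ => ?_
  obtain ⟨δ, hδ, h⟩ := hg ε (by exact_mod_cast hε)
  obtain ⟨i, hi⟩ := ha.exists_dist_lt x hδ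
  exact (iInf_le (fun i => g (a i)) i).trans (h _ _ (by rwa [dist_comm]))

variable {Δ : FormulaSet L} {Ω : WeakModulus}

lemma backForth_unif_left (M N : Structure L) (α : Ordinal.{0}) {s : L.Sorts} {Γ : List L.Sorts}
    (m : M.Env Γ) (n : N.Env Γ) (η : ℝ≥0∞) (hη : 0 < η) :
    ∃ δ > 0, ∀ (x y : M.carrier s), dist x y < δ → ∀ b : N.carrier s,
      backForth Δ Ω M N α (s :: Γ) (x, m) (b, n) ≤
        backForth Δ Ω M N α (s :: Γ) (y, m) (b, n) + η := by
  obtain ⟨δ, hδ, h⟩ := Ω.exists_near (s :: Γ) η hη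
  refine ⟨δ, hδ, fun x y hxy b => ?_⟩
  refine (backForth_le_add (Γ := s :: Γ) α (x, m) (y, m) (b, n) (b, n)).trans ?_
  refine (congrArg _ ((congrArg Ω.toFun (N.distSeq_self _)).trans Ω.zero)).le.trans ?_
  rw [add_zero, add_comm]
  exact add_le_add_right (h M _ _ (Structure.Near.cons hxy fun t z => by simpa using hδ)).le _

/-- The truncated pseudo-metric `min r_α 1`. -/
noncomputable def truncBF (Δ : FormulaSet L) (Ω : WeakModulus) (M N : Structure L)
    (α : Ordinal.{0}) (Γ : List L.Sorts) (m : M.Env Γ) (n : N.Env Γ) : ℝ≥0∞ :=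
  min (backForth Δ Ω M N α Γ m n) 1

lemma truncBF_ne_top {M N : Structure L} {α : Ordinal.{0}} {Γ : List L.Sorts} (m : M.Env Γ)
    (n : N.Env Γ) : truncBF Δ Ω M N α Γ m n ≠ ⊤ :=
  ne_top_of_le_ne_top ENNReal.one_ne_top (min_le_right _ _)

lemma truncBF_le_one {M N : Structure L} {α : Ordinal.{0}} {Γ : List L.Sorts} (m : M.Env Γ)
    (n : N.Env Γ) : truncBF Δ Ω M N α Γ m n ≤ 1 := min_le_right _ _

lemma backForth_zero_eq_iSup {T : Theory L} {ψ : (Γ : List L.Sorts) → ℕ → Formula L Γ}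
    (hψ : IsDenseFamily T Δ Ω ψ) {M N : Structure L} (hM : M.Models T) (hN : N.Models T)
    {Γ : List L.Sorts} (m : M.Env Γ) (n : N.Env Γ) :
    backForth Δ Ω M N 0 Γ m n = ⨆ i, edist ((ψ Γ i).eval M m) ((ψ Γ i).eval N n) := by
  refine le_antisymm ?_ (iSup_le fun i =>
    edist_le_backForth_zero ((hψ Γ).1 i).1 ((hψ Γ).1 i).2 m n)
  rw [backForth_zero]
  refine iSup₂_le fun φ hφ => iSup_le fun hr => ENNReal.le_of_forall_pos_le_add fun ε hε _ => ?_
  obtain ⟨i, hi⟩ := (hψ Γ).2 φ hφ hr (ε / 2) (half_pos hε)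
  refine le_trans ?_ (add_le_add_left (le_iSup
    (fun i => edist ((ψ Γ i).eval M m) ((ψ Γ i).eval N n)) i) _)
  rw [edist_dist, edist_dist, Real.dist_eq, Real.dist_eq, ← ENNReal.ofReal_coe_nnreal,
    ← ENNReal.ofReal_add (abs_nonneg _) (NNReal.coe_nonneg _)]
  refine ENNReal.ofReal_le_ofReal ?_
  have h1 := hi M hM m
  have h2 := hi N hN n
  rw [abs_sub_comm] at h2
  have h3 := abs_sub_le (φ.eval M m) ((ψ Γ i).eval M m) (φ.eval N n)
  have h4 := abs_sub_le ((ψ Γ i).eval M m) ((ψ Γ i).eval N n) (φ.eval N n)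
  linarith

/-- In the recursion for `min r_α 1` it suffices to let the element of `M` range over the dense sequences,
as the pseudo-metrics respect `Ω`. -/
lemma truncBF_add_one {M N : Structure L} {a : (s : L.Sorts) → ℕ → M.carrier s}
    (ha : ∀ s, DenseRange (a s)) (α : Ordinal.{0}) (Γ : List L.Sorts) (m : M.Env Γ)
    (n : N.Env Γ) :
    truncBF Δ Ω M N (α + 1) Γ m n =
      (⨆ p : L.Sorts × ℕ, ⨅ b : N.carrier p.1,
        truncBF Δ Ω M N α (p.1 :: Γ) (a p.1 p.2, m) (b, n)) ⊔
      ⨆ s : L.Sorts, ⨆ b : N.carrier s, ⨅ i : ℕ, truncBF Δ Ω M N α (s :: Γ) (a s i, m) (b, n) := by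
  have h1 : ∀ s : L.Sorts, (⨆ x : M.carrier s, ⨅ b : N.carrier s,
      backForth Δ Ω M N α (s :: Γ) (x, m) (b, n)) =
      ⨆ i, ⨅ b : N.carrier s, backForth Δ Ω M N α (s :: Γ) (a s i, m) (b, n) := fun s =>
    iSup_eq_of_denseRange (ha s) fun η hη => by
      obtain ⟨δ, hδ, h⟩ := backForth_unif_left M N α (s := s) m n η hη
      refine ⟨δ, hδ, fun x y hxy => ?_⟩
      rw [ENNReal.iInf_add]
      exact iInf_mono fun b => h x y hxy b
  have h2 : ∀ (s : L.Sorts) (b : N.carrier s), (⨅ x : M.carrier s,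
      backForth Δ Ω M N α (s :: Γ) (x, m) (b, n)) =
      ⨅ i, backForth Δ Ω M N α (s :: Γ) (a s i, m) (b, n) := fun s b =>
    iInf_eq_of_denseRange (ha s) fun η hη => by
      obtain ⟨δ, hδ, h⟩ := backForth_unif_left M N α (s := s) m n η hη
      exact ⟨δ, hδ, fun x y hxy => h x y hxy b⟩
  simp only [truncBF, backForth_add_one, h1, h2, iSup_prod]
  change (_ ⊔ _) ⊓ (1 : ℝ≥0∞) = (⨆ s, ⨆ i, ⨅ b, _ ⊓ _) ⊔ (⨆ s, ⨆ b, ⨅ i, _ ⊓ _)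
  simp only [inf_sup_right, iSup_inf_eq, iInf_inf]

lemma toReal_sup_iSup_iInf {S : Type} {Y : S → Type} [∀ s, Nonempty (Y s)]
    (F : (s : S) → ℕ → Y s → ℝ≥0∞) (hF : ∀ s i b, F s i b ≤ 1) :
    ((⨆ p : S × ℕ, ⨅ b, F p.1 p.2 b) ⊔ ⨆ s, ⨆ b, ⨅ i, F s i b).toReal =
      max (⨆ p : S × ℕ, ⨅ b, (F p.1 p.2 b).toReal) (⨆ s, ⨆ b, ⨅ i, (F s i b).toReal) := by
  have h1t : ∀ {x : ℝ≥0∞}, x ≤ 1 → x ≠ ⊤ := fun h => ne_top_of_le_ne_top ENNReal.one_ne_top h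
  have hA : ∀ p : S × ℕ, ⨅ b, F p.1 p.2 b ≤ 1 := fun p =>
    iInf_le_of_le (Classical.arbitrary _) (hF _ _ _)
  have hB : ∀ s (b : Y s), ⨅ i, F s i b ≤ 1 := fun s b => iInf_le_of_le 0 (hF _ _ _)
  rw [ENNReal.toReal_max (h1t (iSup_le hA)) (h1t (iSup₂_le hB)),
    ENNReal.toReal_iSup fun p => h1t (hA p),
    ENNReal.toReal_iSup fun s => h1t (iSup_le (hB s))]
  congr 1
  · exact congrArg iSup (funext fun p => ENNReal.toReal_iInf fun b => h1t (hF _ _ _))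
  · refine congrArg iSup (funext fun s => ?_)
    rw [ENNReal.toReal_iSup fun b => h1t (hB s b)]
    exact congrArg iSup (funext fun b => ENNReal.toReal_iInf fun i => h1t (hF _ _ _))

/-- `φ_{α,M,m}` takes the value `min (r_α(M, m; N, n)) 1` at `n`. -/
lemma eval_scottFormula [Nonempty L.Sorts] {T : Theory L}
    {ψ : (Γ : List L.Sorts) → ℕ → Formula L Γ} (hψ : IsDenseFamily T Δ Ω ψ) {M N : Structure L}
    (hM : M.Models T) (hN : N.Models T) {a : (s : L.Sorts) → ℕ → M.carrier s}
    (ha : ∀ s, DenseRange (a s)) (α : Ordinal.{0}) : ∀ (Γ : List L.Sorts) (m : M.Env Γ)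
    (n : N.Env Γ),
    (scottFormula M a ψ α Γ m).eval N n = (truncBF Δ Ω M N α Γ m n).toReal := by
  have h1t : ∀ {x : ℝ≥0∞}, x ≤ 1 → x ≠ ⊤ := fun h => ne_top_of_le_ne_top ENNReal.one_ne_top h
  induction α using Ordinal.limitRecOn with
  | zero =>
    intro Γ m n
    rw [scottFormula_zero, truncBF, backForth_zero_eq_iSup hψ hM hN]
    rw [iSup_inf_eq, ENNReal.toReal_iSup fun i => h1t inf_le_right]
    refine congrArg iSup (funext fun i => ?_)
    change min |_ - (ψ Γ i).eval N n| 1 = _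
    rw [edist_dist, Real.dist_eq, ← ENNReal.ofReal_one,
      ← ENNReal.ofReal_min _ _, ENNReal.toReal_ofReal (le_min (abs_nonneg _) zero_le_one)]
  | add_one α ih =>
    intro Γ m n
    have h := toReal_sup_iSup_iInf (Y := N.carrier)
      (fun s i b => truncBF Δ Ω M N α (s :: Γ) (a s i, m) (b, n)) fun s i b => min_le_right _ _
    rw [scottFormula_add_one, InfFormula.eval_max]
    refine Eq.trans ?_ (h.symm.trans (congrArg ENNReal.toReal (truncBF_add_one ha α Γ m n).symm))
    exact congrArg₂ max
      (congrArg iSup (funext fun p => congrArg iInf (funext fun b =>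
        ih (p.1 :: Γ) (a p.1 p.2, m) (b, n))))
      (congrArg iSup (funext fun s => congrArg iSup (funext fun b =>
        congrArg iInf (funext fun i => ih (s :: Γ) (a s i, m) (b, n)))))
  | limit l hl ih =>
    intro Γ m n
    rw [scottFormula_limit _ _ _ hl, truncBF, backForth_limit hl]
    change _ = ((⨆ β, ⨆ _, _) ⊓ (1 : ℝ≥0∞)).toReal
    rw [iSup_subtype' (p := fun β => β < l)
      (f := fun β (_ : β < l) => backForth Δ Ω M N β Γ m n), iSup_inf_eq]
    refine Eq.trans ?_ (congrArg ENNReal.toReal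
      ((Ordinal.ToType.mk (o := l)).symm.toEquiv.iSup_comp
        (g := fun x : Set.Iio l => backForth Δ Ω M N x.1 Γ m n ⊓ 1)))
    rw [ENNReal.toReal_iSup fun i => h1t inf_le_right]
    exact congrArg iSup (funext fun i => ih _ (Ordinal.ToType.mk.symm i).2 Γ m n)

end Eval

/-! ### The Scott sentence is an infinitary formula -/

section Range

variable {Δ : FormulaSet L} {Ω : WeakModulus}

/-- `φ` is an infinitary formula whose syntactic range is of the form `[0, b]` with `b ≤ 1`. -/
def IsLωωUnit (Δ : FormulaSet L) (Ω : WeakModulus) {Γ : List L.Sorts} (φ : InfFormula L Γ) : Prop :=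
  ∃ b : ℝ, 0 ≤ b ∧ b ≤ 1 ∧ IsLωω Δ Ω φ (Set.Icc 0 b)

lemma Icc_eq_closure_iUnion {ι : Type*} [Nonempty ι] {b : ι → ℝ} (h0 : ∀ i, 0 ≤ b i)
    (h1 : ∀ i, b i ≤ 1) : Set.Icc 0 (⨆ i, b i) = closure (⋃ i, Set.Icc 0 (b i)) := by
  have hb : BddAbove (Set.range b) := ⟨1, by rintro _ ⟨i, rfl⟩; exact h1 i⟩
  refine Set.Subset.antisymm ?_ (closure_minimal (Set.iUnion_subset fun i =>
    Set.Icc_subset_Icc_right (le_ciSup hb i)) isClosed_Icc)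
  rcases (Real.iSup_nonneg h0).eq_or_lt with h | h
  · rw [← h, Set.Icc_self]
    rintro _ rfl
    exact subset_closure (Set.mem_iUnion.2 ⟨Classical.arbitrary ι, le_rfl, h0 _⟩)
  · rw [← closure_Ico h.ne]
    refine closure_mono fun x hx => ?_
    obtain ⟨i, hi⟩ := exists_lt_of_lt_ciSup hx.2
    exact Set.mem_iUnion.2 ⟨i, hx.1, hi.le⟩

lemma IsLωωUnit.seqSup {Γ : List L.Sorts} {ι : Type} [Nonempty ι] [Countable ι]
    {φ : ι → InfFormula L Γ} (h : ∀ i, IsLωωUnit Δ Ω (φ i)) : IsLωωUnit Δ Ω (.seqSup φ) := by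
  choose b h0 h1 hb using h
  exact ⟨⨆ i, b i, Real.iSup_nonneg h0, ciSup_le h1,
    .seqSup φ _ hb _ _ (Real.iSup_nonneg h0) (Icc_eq_closure_iUnion h0 h1)⟩

lemma IsLωωUnit.seqInf {Γ : List L.Sorts} {ι : Type} [Nonempty ι] [Countable ι]
    {φ : ι → InfFormula L Γ} (h : ∀ i, IsLωωUnit Δ Ω (φ i)) : IsLωωUnit Δ Ω (.seqInf φ) := by
  choose b h0 h1 hb using h
  exact ⟨⨆ i, b i, Real.iSup_nonneg h0, ciSup_le h1,
    .seqInf φ _ hb _ _ (Real.iSup_nonneg h0) (Icc_eq_closure_iUnion h0 h1)⟩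

lemma IsLωωUnit.sup {Γ : List L.Sorts} {s : L.Sorts} {φ : InfFormula L (s :: Γ)}
    (h : IsLωωUnit Δ Ω φ) : IsLωωUnit Δ Ω φ.sup := by
  obtain ⟨b, h0, h1, hb⟩ := h
  exact ⟨b, h0, h1, .sup φ _ hb⟩

lemma IsLωωUnit.inf {Γ : List L.Sorts} {s : L.Sorts} {φ : InfFormula L (s :: Γ)}
    (h : IsLωωUnit Δ Ω φ) : IsLωωUnit Δ Ω φ.inf := by
  obtain ⟨b, h0, h1, hb⟩ := h
  exact ⟨b, h0, h1, .inf φ _ hb⟩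

lemma IsLωωUnit.supAll : ∀ {Γ : List L.Sorts} {φ : InfFormula L Γ},
    IsLωωUnit Δ Ω φ → IsLωωUnit Δ Ω φ.supAll
  | [], _, h => h
  | _ :: _, φ, h => by
    have h1 := IsLωωUnit.supAll (φ := φ.sup) h.sup
    exact h1

/-- The image of a product of compact connected ranges under a `1`-Lipschitz `F` is a compact interval. -/
lemma isLωωUnit_conn {Γ : List L.Sorts} {k : ℕ} {F : (Fin k → ℝ) → ℝ} (hF : LipschitzWith 1 F)
    {φ : Fin k → InfFormula L Γ} {I : Fin k → Set ℝ} (hφ : ∀ i, IsLωω Δ Ω (φ i) (I i))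
    (hc : ∀ i, IsCompact (I i)) (hI : ∀ i, IsConnected (I i))
    (h01 : ∀ t ∈ Set.univ.pi I, F t ∈ Set.Icc (0 : ℝ) 1) (h0 : ∃ t ∈ Set.univ.pi I, F t = 0) :
    IsLωωUnit Δ Ω (.conn F φ) := by
  have h1 := eq_Icc_of_connected_compact
    ((isConnected_univ_pi.2 hI).image F hF.continuous.continuousOn)
    ((isCompact_univ_pi hc).image hF.continuous)
  have hsub : F '' Set.univ.pi I ⊆ Set.Icc 0 1 := by rintro _ ⟨t, ht, rfl⟩; exact h01 t ht
  obtain ⟨t, ht, hF0⟩ := h0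
  have h2 : sInf (F '' Set.univ.pi I) = 0 := le_antisymm
    ((csInf_le (bddBelow_Icc.mono hsub) ⟨t, ht, rfl⟩).trans hF0.le)
    (le_csInf ⟨_, t, ht, rfl⟩ fun x hx => (hsub hx).1)
  rw [h2] at h1
  refine ⟨_, ?_, ?_, h1 ▸ IsLωω.conn F hF φ I hφ⟩
  · exact hF0.ge.trans (le_csSup (bddAbove_Icc.mono hsub) ⟨t, ht, rfl⟩)
  · exact csSup_le ⟨_, t, ht, rfl⟩ fun x hx => (hsub hx).2

lemma isLωωUnit_conn₂ {Γ : List L.Sorts} {F : (Fin 2 → ℝ) → ℝ} (hF : LipschitzWith 1 F)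
    (hF0 : F 0 = 0) (h01 : ∀ t : Fin 2 → ℝ, (∀ i, t i ∈ Set.Icc (0 : ℝ) 1) →
      F t ∈ Set.Icc (0 : ℝ) 1) {φ χ : InfFormula L Γ} (hφ : IsLωωUnit Δ Ω φ)
    (hχ : IsLωωUnit Δ Ω χ) : IsLωωUnit Δ Ω (.conn F ![φ, χ]) := by
  obtain ⟨b, b0, b1, hb⟩ := hφ
  obtain ⟨c, c0, c1, hc⟩ := hχ
  have hd : ∀ i : Fin 2, 0 ≤ ![b, c] i ∧ ![b, c] i ≤ 1 := by
    intro i; fin_cases i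
    · exact ⟨b0, b1⟩
    · exact ⟨c0, c1⟩
  refine isLωωUnit_conn (I := fun i => Set.Icc 0 (![b, c] i)) hF (fun i => ?_)
    (fun i => isCompact_Icc) (fun i => isConnected_Icc (hd i).1) (fun t ht => h01 t fun i => ?_)
    ⟨0, fun i _ => ⟨le_rfl, (hd i).1⟩, hF0⟩
  · fin_cases i
    · exact hb
    · exact hc
  · have := ht i (Set.mem_univ i)
    exact ⟨this.1, this.2.trans (hd i).2⟩

lemma IsLωωUnit.max {Γ : List L.Sorts} {φ χ : InfFormula L Γ} (hφ : IsLωωUnit Δ Ω φ)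
    (hχ : IsLωωUnit Δ Ω χ) : IsLωωUnit Δ Ω (φ.max χ) := by
  refine isLωωUnit_conn₂ (LipschitzWith.of_dist_le_mul fun t u => ?_) (by simp) (fun t ht =>
    ⟨le_max_of_le_left (ht 0).1, max_le (ht 0).2 (ht 1).2⟩) hφ hχ
  rw [NNReal.coe_one, one_mul, Real.dist_eq]
  refine (abs_max_sub_max_le_max _ _ _ _).trans (max_le ?_ ?_)
  · exact dist_le_pi_dist t u 0
  · exact dist_le_pi_dist t u 1

lemma IsLωωUnit.half_abs_sub {Γ : List L.Sorts} {φ χ : InfFormula L Γ} (hφ : IsLωωUnit Δ Ω φ)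
    (hχ : IsLωωUnit Δ Ω χ) :
    IsLωωUnit Δ Ω (.conn (fun t : Fin 2 → ℝ => 1 / 2 * |t 0 - t 1|) ![φ, χ]) := by
  refine isLωωUnit_conn₂ (LipschitzWith.of_dist_le_mul fun t u => ?_) (by simp) (fun t ht => ?_)
    hφ hχ
  · rw [NNReal.coe_one, one_mul, Real.dist_eq, ← mul_sub, abs_mul, abs_of_nonneg (by norm_num)]
    have h0 : |t 0 - u 0| ≤ dist t u := dist_le_pi_dist t u 0
    have h1 : |t 1 - u 1| ≤ dist t u := dist_le_pi_dist t u 1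
    have h2 := abs_abs_sub_abs_le_abs_sub (t 0 - t 1) (u 0 - u 1)
    have h3 : |t 0 - t 1 - (u 0 - u 1)| ≤ |t 0 - u 0| + |t 1 - u 1| := by
      rw [show t 0 - t 1 - (u 0 - u 1) = (t 0 - u 0) - (t 1 - u 1) by ring]
      exact abs_sub _ _
    linarith
  · have h0 := ht 0
    have h1 := ht 1
    have h2 : |t 0 - t 1| ≤ 1 := abs_le.2 ⟨by linarith [h0.1, h1.2], by linarith [h0.2, h1.1]⟩
    exact ⟨by positivity, by linarith⟩

lemma Formula.isCompact_range {Γ : List L.Sorts} (φ : Formula L Γ) : IsCompact φ.range := by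
  obtain ⟨C, hC⟩ := φ.exists_bound
  refine ((isBounded_convexHull.2 ((Metric.isBounded_Icc (-C) C).subset ?_)).isCompact_closure)
  rintro _ ⟨M, m, rfl⟩
  exact abs_le.1 (hC M m)

lemma Formula.eval_mem_range {Γ : List L.Sorts} (φ : Formula L Γ) (M : Structure L)
    (m : M.Env Γ) : φ.eval M m ∈ φ.range :=
  subset_closure (subset_convexHull ℝ _ ⟨M, m, rfl⟩)

open scoped Ordinal in
lemma countable_toType {α : Ordinal.{0}} (h : α < ω₁) : Countable α.ToType := by
  rw [← Cardinal.ord_aleph, Cardinal.lt_ord] at h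
  rw [← Cardinal.mk_le_aleph0_iff, Cardinal.mk_toType, ← Order.lt_succ_iff, Cardinal.succ_aleph0]
  exact h

open scoped Ordinal in
lemma isLωωUnit_scottFormula [Nonempty L.Sorts] [Countable L.Sorts] {T : Theory L}
    {ψ : (Γ : List L.Sorts) → ℕ → Formula L Γ} (hψ : IsDenseFamily T Δ Ω ψ) (M : Structure L)
    (a : (s : L.Sorts) → ℕ → M.carrier s) (α : Ordinal.{0}) : α < ω₁ →
    ∀ (Γ : List L.Sorts) (m : M.Env Γ), IsLωωUnit Δ Ω (scottFormula M a ψ α Γ m) := by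
  induction α using Ordinal.limitRecOn with
  | zero =>
    intro _ Γ m
    rw [scottFormula_zero]
    refine IsLωωUnit.seqSup fun i => ?_
    refine isLωωUnit_conn (I := fun _ => (ψ Γ i).range)
      (LipschitzWith.of_dist_le_mul fun t u => ?_) (fun j => ?_)
      (fun _ => (ψ Γ i).isCompact_range) (fun _ => ⟨⟨_, (ψ Γ i).eval_mem_range M m⟩,
        (convex_convexHull ℝ _).closure.isPreconnected⟩)
      (fun t _ => ⟨le_min (abs_nonneg _) zero_le_one, min_le_right _ _⟩)
      ⟨fun _ => (ψ Γ i).eval M m, fun _ _ => (ψ Γ i).eval_mem_range M m, by simp⟩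
    · rw [NNReal.coe_one, one_mul, Real.dist_eq]
      refine (abs_min_sub_min_le_max _ _ _ _).trans (max_le ?_ (by simp))
      refine (abs_abs_sub_abs_le_abs_sub _ _).trans ?_
      rw [sub_sub_sub_cancel_left, abs_sub_comm]
      exact dist_le_pi_dist t u 0
    · obtain rfl : j = 0 := Subsingleton.elim _ _
      exact .base _ ((hψ Γ).1 i).1 ((hψ Γ).1 i).2
  | add_one α ih =>
    intro hα Γ m
    have ih := ih ((lt_add_one α).trans hα)
    rw [scottFormula_add_one]
    exact .max (.seqSup fun p => .inf (ih _ _)) (.seqSup fun s => .sup (.seqInf fun i => ih _ _))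
  | limit l hl ih =>
    intro hl' Γ m
    have := countable_toType hl'
    have : Nonempty l.ToType := ⟨Ordinal.ToType.mk ⟨0, hl.bot_lt⟩⟩
    rw [scottFormula_limit _ _ _ hl]
    exact .seqSup fun i => ih _ (Ordinal.ToType.mk.symm i).2
      ((Ordinal.ToType.mk.symm i).2.trans hl') Γ m

open scoped Ordinal in
/-- The index sets in the Scott sentence are countable because the Scott rank is. -/
lemma isLωω_scottSentence [Nonempty L.Sorts] [Countable L.Sorts] {T : Theory L}
    {ψ : (Γ : List L.Sorts) → ℕ → Formula L Γ} (hψ : IsDenseFamily T Δ Ω ψ) (M : Structure L)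
    (a : (s : L.Sorts) → ℕ → M.carrier s) (hα : scottRank Δ Ω M < ω₁) :
    IsLωωUnit Δ Ω (scottSentence Δ Ω M a ψ) :=
  .max (isLωωUnit_scottFormula hψ M a _ hα [] ()) (.seqSup fun _ => .supAll
    (.half_abs_sub (isLωωUnit_scottFormula hψ M a _ hα _ _) (isLωωUnit_scottFormula hψ M a _
      ((Cardinal.isSuccLimit_omega 1).add_one_lt hα) _ _)))

end Range

/-! ### The meaning of the Scott sentence -/

lemma InfFormula.eval_supAll_mem {N : Structure L} {C : ℝ} : ∀ {Γ : List L.Sorts}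
    {φ : InfFormula L Γ}, (∀ v, φ.eval N v ∈ Set.Icc 0 C) → φ.supAll.eval N () ∈ Set.Icc 0 C ∧
      ∀ v, φ.eval N v ≤ φ.supAll.eval N ()
  | [], _, h => ⟨h (), fun _ => le_rfl⟩
  | s :: Γ, φ, h => by
    have hb : ∀ v : N.Env Γ, BddAbove (Set.range fun a : N.carrier s => φ.eval N (a, v)) :=
      fun v => ⟨C, by rintro _ ⟨a, rfl⟩; exact (h _).2⟩
    obtain ⟨h1, h2⟩ := InfFormula.eval_supAll_mem (φ := φ.sup) (C := C) fun v =>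
      ⟨Real.iSup_nonneg fun a => (h _).1, ciSup_le fun a => (h _).2⟩
    exact ⟨h1, fun v => (le_ciSup (hb v.2) v.1).trans (h2 v.2)⟩

/-- The Scott sentence says that `r_α(M; N) = 0` and that `min r_α 1` and `min r_{α+1} 1` agree between
tuples of the dense sequences and tuples of `N`, where `α` is the Scott rank of `M`. -/
lemma eval_scottSentence_nonpos_iff [Nonempty L.Sorts] {T : Theory L} {Δ : FormulaSet L}
    {Ω : WeakModulus} {ψ : (Γ : List L.Sorts) → ℕ → Formula L Γ} (hψ : IsDenseFamily T Δ Ω ψ)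
    {M N : Structure L} (hM : M.Models T) (hN : N.Models T)
    {a : (s : L.Sorts) → ℕ → M.carrier s} (ha : ∀ s, DenseRange (a s)) :
    (scottSentence Δ Ω M a ψ).eval N () ≤ 0 ↔
      backForth Δ Ω M N (scottRank Δ Ω M) [] () () = 0 ∧
      ∀ (l : List (L.Sorts × ℕ)) (n : N.Env (l.map Prod.fst)),
        truncBF Δ Ω M N (scottRank Δ Ω M) _ (tupleOf a l) n =
          truncBF Δ Ω M N (scottRank Δ Ω M + 1) _ (tupleOf a l) n := by
  have h01 : ∀ (α : Ordinal.{0}) (Γ : List L.Sorts) (m : M.Env Γ) (n : N.Env Γ),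
      (truncBF Δ Ω M N α Γ m n).toReal ∈ Set.Icc (0 : ℝ) 1 := fun α Γ m n =>
    ⟨ENNReal.toReal_nonneg, ENNReal.toReal_le_of_le_ofReal zero_le_one
      (by rw [ENNReal.ofReal_one]; exact truncBF_le_one m n)⟩
  have hfirst : (scottFormula M a ψ (scottRank Δ Ω M) [] ()).eval N () ≤ 0 ↔
      backForth Δ Ω M N (scottRank Δ Ω M) [] () () = 0 := by
    have he := eval_scottFormula hψ hM hN ha (scottRank Δ Ω M) [] () ()
    have h0 : ∀ x : ℝ≥0∞, (min x 1).toReal ≤ 0 ↔ x = 0 := fun x => by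
      rw [ENNReal.toReal_nonneg.ge_iff_eq', ENNReal.toReal_eq_zero_iff, or_iff_left
        (ne_top_of_le_ne_top ENNReal.one_ne_top (min_le_right _ _)), min_eq_iff]
      simp +contextual
    exact (iff_of_eq (congrArg (· ≤ (0 : ℝ)) he)).trans (h0 _)
  set χ : (l : List (L.Sorts × ℕ)) → InfFormula L (l.map Prod.fst) := fun l =>
    .conn (fun t : Fin 2 → ℝ => 1 / 2 * |t 0 - t 1|)
        ![scottFormula M a ψ (scottRank Δ Ω M) (l.map Prod.fst) (tupleOf a l),
          scottFormula M a ψ (scottRank Δ Ω M + 1) (l.map Prod.fst) (tupleOf a l)] with hχ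
  have hχe : ∀ l (n : N.Env (l.map Prod.fst)), (χ l).eval N n =
      1 / 2 * |(truncBF Δ Ω M N (scottRank Δ Ω M) _ (tupleOf a l) n).toReal -
        (truncBF Δ Ω M N (scottRank Δ Ω M + 1) _ (tupleOf a l) n).toReal| := by
    intro l n
    rw [← eval_scottFormula hψ hM hN ha, ← eval_scottFormula hψ hM hN ha]
    rfl
  have hχ01 : ∀ l (n : N.Env (l.map Prod.fst)), (χ l).eval N n ∈ Set.Icc (0 : ℝ) 1 := by
    intro l n
    rw [hχe]
    have h0 := h01 (scottRank Δ Ω M) _ (tupleOf a l) n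
    have h1 := h01 (scottRank Δ Ω M + 1) _ (tupleOf a l) n
    have h2 : |(truncBF Δ Ω M N (scottRank Δ Ω M) _ (tupleOf a l) n).toReal -
        (truncBF Δ Ω M N (scottRank Δ Ω M + 1) _ (tupleOf a l) n).toReal| ≤ 1 :=
      abs_le.2 ⟨by linarith [h0.1, h1.2], by linarith [h0.2, h1.1]⟩
    exact ⟨by positivity, by linarith⟩
  have hev : (scottSentence Δ Ω M a ψ).eval N () =
      max ((scottFormula M a ψ (scottRank Δ Ω M) [] ()).eval N ())
        (⨆ l, (χ l).supAll.eval N ()) := rfl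
  rw [hev, max_le_iff, hfirst]
  refine and_congr_right fun _ => ⟨fun h l n => ?_, fun h => ?_⟩
  · have h1 := InfFormula.eval_supAll_mem (hχ01 l)
    have h2 : (χ l).supAll.eval N () ≤ ⨆ l, (χ l).supAll.eval N () :=
      le_ciSup (f := fun l => (χ l).supAll.eval N ()) ⟨1, by
        rintro _ ⟨l, rfl⟩; exact (InfFormula.eval_supAll_mem (hχ01 l)).1.2⟩ l
    have h3 := (h1.2 n).trans (h2.trans h)
    rw [hχe] at h3
    have h4 : |(truncBF Δ Ω M N (scottRank Δ Ω M) _ (tupleOf a l) n).toReal -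
        (truncBF Δ Ω M N (scottRank Δ Ω M + 1) _ (tupleOf a l) n).toReal| ≤ 0 := by linarith
    exact (ENNReal.toReal_eq_toReal_iff' (truncBF_ne_top _ _) (truncBF_ne_top _ _)).1
      (sub_eq_zero.1 (abs_nonpos_iff.1 h4))
  · refine ciSup_le fun l => (InfFormula.eval_supAll_mem (C := 0) fun n => ?_).1.2
    rw [hχe, h l n]
    simp

/-! ### Models at distance zero satisfy the Scott sentence -/

section Easy

variable {Δ : FormulaSet L} {Ω : WeakModulus} {M N : Structure L}

lemma backForth_comm (α : Ordinal.{0}) : ∀ (Γ : List L.Sorts) (m : M.Env Γ) (n : N.Env Γ),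
    backForth Δ Ω M N α Γ m n = backForth Δ Ω N M α Γ n m := by
  induction α using Ordinal.limitRecOn with
  | zero => intro Γ m n; simp only [backForth_zero, edist_comm]
  | add_one α ih =>
    intro Γ m n
    rw [backForth_add_one, backForth_add_one, sup_comm]
    exact congrArg₂ _
      (congrArg iSup (funext fun s => congrArg iSup (funext fun b =>
        congrArg iInf (funext fun a => ih (s :: Γ) (a, m) (b, n)))))
      (congrArg iSup (funext fun s => congrArg iSup (funext fun a =>
        congrArg iInf (funext fun b => ih (s :: Γ) (a, m) (b, n)))))
  | limit l hl ih =>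
    intro Γ m n
    rw [backForth_limit hl, backForth_limit hl]
    exact iSup_congr fun β => iSup_congr fun hβ => ih β hβ Γ m n

lemma Relation.IsCor.exists_holds_left {R : Relation M N} (hR : R.IsCor) :
    ∀ {Γ : List L.Sorts} (n : N.Env Γ), ∃ m : M.Env Γ, R.Holds m n
  | [], _ => ⟨(), trivial⟩
  | s :: Γ, n => by
    obtain ⟨m, hm⟩ := hR.exists_holds_left (Γ := Γ) n.2
    obtain ⟨a, ha⟩ := hR.exists_left (s := s) n.1
    exact ⟨(a, m), ha, hm⟩

lemma exists_isCor_of_rho_eq_zero (h : rho Δ M N = 0) {ε : ℝ≥0∞} (hε : 0 < ε) :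
    ∃ R : Relation M N, R.IsCor ∧ distortion Δ R < ε := by
  rw [← h] at hε
  obtain ⟨R, hR⟩ := iInf_lt_iff.1 hε
  obtain ⟨hR, h⟩ := iInf_lt_iff.1 hR
  exact ⟨R, hR, h⟩

lemma backForth_eq_zero_of_rho (h : rho Δ M N = 0) (α : Ordinal.{0}) :
    backForth Δ Ω M N α [] () () = 0 := by
  refine le_antisymm (le_of_forall_gt fun ε hε => ?_) zero_le
  obtain ⟨R, hR, hd⟩ := exists_isCor_of_rho_eq_zero h hε
  exact (backForth_le_distortion hR α [] () () trivial).trans_lt hd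

/-- If `M` and `N` have distance zero, then the stabilization of the pseudo-metrics on `M` implies
their stabilization between `M` and `N`. -/
lemma backForth_add_one_le_of_rho (h : rho Δ M N = 0) {α : Ordinal.{0}}
    (hα : ∀ (Γ : List L.Sorts) (m n : M.Env Γ),
      backForth Δ Ω M M α Γ m n = backForth Δ Ω M M (α + 1) Γ m n) {Γ : List L.Sorts}
    (m : M.Env Γ) (n : N.Env Γ) :
    backForth Δ Ω M N (α + 1) Γ m n ≤ backForth Δ Ω M N α Γ m n := by
  refine ENNReal.le_of_forall_pos_le_add fun ε hε _ => ?_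
  obtain ⟨R, hR, hd⟩ := exists_isCor_of_rho_eq_zero h
    (ENNReal.half_pos (a := ε) (by exact_mod_cast hε.ne'))
  obtain ⟨m', hm'⟩ := hR.exists_holds_left n
  have h1 := (backForth_le_distortion (Δ := Δ) (Ω := Ω) hR α Γ m' n hm').trans hd.le
  have h2 := (backForth_le_distortion (Δ := Δ) (Ω := Ω) hR (α + 1) Γ m' n hm').trans hd.le
  rw [backForth_comm] at h1
  refine (backForth_triangle (α + 1) Γ m m' n).trans ?_
  rw [← hα]
  refine (add_le_add (backForth_triangle α Γ m n m') h2).trans ?_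
  rw [add_assoc]
  refine add_le_add_right ?_ _
  exact (add_le_add_left h1 _).trans (ENNReal.add_halves _).le

end Easy

/-! ### Tuples given by lists of labels -/

section Labels

variable {Lab : Type*} {sort : Lab → L.Sorts}

/-- The tuple of the values of a list of labels. -/
def envOf {M : Structure L} (val : (x : Lab) → M.carrier (sort x)) :
    (l : List Lab) → M.Env (l.map sort)
  | [] => ()
  | x :: l => (val x, envOf val l)

/-- Extending a renaming by one variable. -/
def Renaming.cons {S : Type} {Γ Γ' : List S} {s : S} (x : Var Γ' s) (f : Renaming Γ Γ') :
    Renaming (s :: Γ) Γ'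
  | _, .head => x
  | t, .tail y => f t y

lemma exists_var_of_mem {J : List Lab} {y : Lab} (hy : y ∈ J) :
    ∃ v : Var (J.map sort) (sort y), ∀ (M : Structure L) (val : (x : Lab) → M.carrier (sort x)),
      (envOf val J).lookup v = val y := by
  induction J with
  | nil => simp at hy
  | cons z J ih =>
    rcases List.mem_cons.1 hy with rfl | hy
    · exact ⟨.head, fun M val => rfl⟩
    · obtain ⟨v, hv⟩ := ih hy
      exact ⟨v.tail, fun M val => hv M val⟩

/-- If every label of `I` is identified with a label of `J`, then the tuple of `I` arises from the
tuple of `J` by a renaming of variables. -/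
lemma exists_renaming (E : Lab → Lab → Prop) (hE : ∀ x y, E x y → sort x = sort y) (J : List Lab) :
    ∀ I : List Lab, (∀ x ∈ I, ∃ y ∈ J, E x y) →
      ∃ f : Renaming (I.map sort) (J.map sort),
        ∀ (M : Structure L) (val : (x : Lab) → M.carrier (sort x)),
          (∀ x ∈ I, ∀ y ∈ J, E x y →
            (⟨sort x, val x⟩ : Σ s, M.carrier s) = ⟨sort y, val y⟩) →
          (envOf val J).comap f = envOf val I
  | [], _ => ⟨fun _ x => (nomatch x), fun _ _ _ => rfl⟩
  | x :: I, h => by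
    obtain ⟨f, hf⟩ := exists_renaming E hE J I fun z hz => h z (List.mem_cons_of_mem _ hz)
    obtain ⟨y, hy, hxy⟩ := h x List.mem_cons_self
    obtain ⟨v, hv⟩ := exists_var_of_mem (L := L) (sort := sort) hy
    have hs := hE x y hxy
    refine ⟨Renaming.cons (hs ▸ v) f, fun M val hval => ?_⟩
    have h1 := hf M val fun z hz => hval z (List.mem_cons_of_mem _ hz)
    have h2 := hval x List.mem_cons_self y hy hxy
    refine Prod.ext ?_ h1
    change (envOf val J).lookup (hs ▸ v : Var (J.map sort) (sort x)) = val x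
    have h3 := hv M val
    clear hv hval h1 hf
    generalize hu : val x = u at *
    generalize hw : val y = w at *
    clear hu hw
    generalize sort x = s at *
    generalize sort y = t at *
    subst hs
    obtain rfl := eq_of_heq (Sigma.mk.inj h2).2
    exact h3

/-- A pair of related tuples is given by a list of labels, if every related pair of elements is
given by a label. -/
lemma Relation.Holds.exists_list {M N : Structure L} {R : Relation M N}
    (valM : (x : Lab) → M.carrier (sort x)) (valN : (x : Lab) → N.carrier (sort x))
    {P : Lab → Prop} (hR : ∀ s a b, (a, b) ∈ R s → ∃ x, P x ∧
      (⟨s, a, b⟩ : Σ s, M.carrier s × N.carrier s) = ⟨sort x, valM x, valN x⟩) :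
    ∀ {Γ : List L.Sorts} {m : M.Env Γ} {n : N.Env Γ}, R.Holds m n → ∃ I : List Lab, (∀ x ∈ I, P x) ∧
      (⟨Γ, m, n⟩ : Σ Γ, M.Env Γ × N.Env Γ) = ⟨I.map sort, envOf valM I, envOf valN I⟩
  | [], _, _, _ => ⟨[], by simp, rfl⟩
  | s :: Γ, (a, m), (b, n), h => by
    obtain ⟨I, hI, h1⟩ := Relation.Holds.exists_list valM valN hR h.2
    obtain ⟨x, hx, h2⟩ := hR s a b h.1
    refine ⟨x :: I, by simpa using ⟨hx, hI⟩, ?_⟩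
    change _ = (⟨sort x :: I.map sort, (valM x, envOf valM I), (valN x, envOf valN I)⟩ :
      Σ Γ, M.Env Γ × N.Env Γ)
    generalize envOf valM I = m' at *
    generalize envOf valN I = n' at *
    generalize valM x = a' at *
    generalize valN x = b' at *
    generalize I.map sort = Γ' at *
    generalize sort x = s' at *
    obtain ⟨rfl, h1⟩ := Sigma.mk.inj h1
    obtain ⟨rfl, h2⟩ := Sigma.mk.inj h2
    obtain ⟨rfl, rfl⟩ := Prod.mk.inj (eq_of_heq h1)
    obtain ⟨rfl, rfl⟩ := Prod.mk.inj (eq_of_heq h2)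
    rfl

end Labels

/-! ### The back-and-forth construction -/

section Construction

variable {M N : Structure L}

/-- A pair of elements of `M` and `N` of the same sort. -/
abbrev Pair (M N : Structure L) := Σ s, M.carrier s × N.carrier s

/-- The tuple of the first entries of a list of pairs. -/
def leftEnv (l : List (Pair M N)) : M.Env (l.map Sigma.fst) :=
  envOf (sort := Sigma.fst) (fun x : Pair M N => x.2.1) l

/-- The tuple of the second entries of a list of pairs. -/
def rightEnv (l : List (Pair M N)) : N.Env (l.map Sigma.fst) :=
  envOf (sort := Sigma.fst) (fun x : Pair M N => x.2.2) l

/-- The list `[p (k - 1), …, p 0]`. -/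
def initialList {X : Type*} (p : ℕ → X) : ℕ → List X
  | 0 => []
  | k + 1 => p k :: initialList p k

lemma mem_initialList {X : Type*} (p : ℕ → X) {i k : ℕ} (h : i < k) : p i ∈ initialList p k := by
  induction k with
  | zero => omega
  | succ k ih =>
    rcases Nat.lt_succ_iff_lt_or_eq.1 h with h | rfl
    · exact List.mem_cons_of_mem _ (ih h)
    · exact List.mem_cons_self

/-- A separable structure has a countable dense sub-pre-structure. -/
lemma Structure.Separable.exists_countable_denseSub [Countable L.Sorts] [Countable L.Func]
    (h : M.Separable) : ∃ A : (s : L.Sorts) → Set (M.carrier s), (∀ s, (A s).Countable) ∧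
      M.IsDenseSub A := by
  have : ∀ s, TopologicalSpace.SeparableSpace (M.carrier s) := h
  choose D hDc hDd using fun s => TopologicalSpace.exists_countable_dense (M.carrier s)
  obtain ⟨C, hC, hop⟩ := exists_countable_closed (X := Σ s, M.carrier s)
    (fun l => (⋃ s, Sigma.mk s '' D s) ∪
      ⋃ f : L.Func, {x | ∃ t, l = List.ofFn (fun i => ⟨L.funDom f i, t i⟩) ∧
        x = ⟨L.funCod f, M.funMap f t⟩})
    (fun l => by
      refine (Set.countable_iUnion fun s => (hDc s).image _).union
        (Set.countable_iUnion fun f => Set.Subsingleton.countable ?_)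
      rintro _ ⟨ts, hts, rfl⟩ _ ⟨ts', hts', rfl⟩
      have h1 := List.ofFn_injective (hts.symm.trans hts')
      have : ts = ts' := funext fun i => eq_of_heq (Sigma.mk.inj (congrFun h1 i)).2
      rw [this])
  refine ⟨fun s => Sigma.mk s ⁻¹' C, fun s => hC.preimage sigma_mk_injective, fun s => ?_,
    fun f x hx => ?_⟩
  · exact (hDd s).mono fun x hx => hop [] (by simp) (Or.inl (Set.mem_iUnion.2 ⟨s, x, hx, rfl⟩))
  · refine hop (List.ofFn fun i => ⟨L.funDom f i, x i⟩) (fun y hy => ?_)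
      (Or.inr (Set.mem_iUnion.2 ⟨f, x, rfl, rfl⟩))
    obtain ⟨i, rfl⟩ := (List.mem_ofFn' _ _).1 hy
    exact hx i

variable {Δ : FormulaSet L} {Ω : WeakModulus}

/-- One step of the back-and-forth construction, answering an element of `M`. -/
lemma exists_right_lt {α : Ordinal.{0}} {ε : ℝ≥0∞}
    (hα : ∀ (Γ : List L.Sorts) (m : M.Env Γ) (n : N.Env Γ), backForth Δ Ω M N α Γ m n < ε →
      backForth Δ Ω M N (α + 1) Γ m n ≤ backForth Δ Ω M N α Γ m n)
    {B : (s : L.Sorts) → Set (N.carrier s)} (hB : ∀ s, Dense (B s)) {Γ : List L.Sorts}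
    (m : M.Env Γ) (n : N.Env Γ) (h : backForth Δ Ω M N α Γ m n < ε) {s : L.Sorts}
    (a : M.carrier s) : ∃ b ∈ B s, backForth Δ Ω M N α (s :: Γ) (a, m) (b, n) < ε := by
  obtain ⟨b, hb⟩ := iInf_lt_iff.1
    (((iInf_le_backForth_left α Γ m n a).trans (hα Γ m n h)).trans_lt h)
  obtain ⟨r, hr, hrε⟩ := ENNReal.lt_iff_exists_add_pos_lt.1 hb
  obtain ⟨δ, hδ, hcont⟩ := Ω.exists_near (s :: Γ) r (by exact_mod_cast hr)
  obtain ⟨b', hb', hbb'⟩ := (hB s).exists_dist_lt b hδ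
  refine ⟨b', hb', lt_of_le_of_lt ?_ hrε⟩
  refine (backForth_triangle (N := N) (P := N) α (s :: Γ) (a, m) (b, n) (b', n)).trans ?_
  refine add_le_add_right ((backForth_self_le α (s :: Γ) (b, n) (b', n)).trans
    (hcont N _ _ (Structure.Near.cons hbb' fun t x => by simpa using hδ)).le) _

/-- Two countable dense sets are exhausted by a sequence of pairs (each element appearing
infinitely often) all of whose initial segments have back-and-forth distance less than `ε`. -/
lemma exists_backForth_sequence [Nonempty L.Sorts] [Countable L.Sorts] {α : Ordinal.{0}}
    {ε : ℝ≥0∞}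
    (hα : ∀ (Γ : List L.Sorts) (m : M.Env Γ) (n : N.Env Γ), backForth Δ Ω M N α Γ m n < ε →
      backForth Δ Ω M N (α + 1) Γ m n ≤ backForth Δ Ω M N α Γ m n)
    (h0 : backForth Δ Ω M N α [] () () < ε)
    {A : (s : L.Sorts) → Set (M.carrier s)} (hAc : ∀ s, (A s).Countable) (hA : ∀ s, Dense (A s))
    {B : (s : L.Sorts) → Set (N.carrier s)} (hBc : ∀ s, (B s).Countable) (hB : ∀ s, Dense (B s)) :
    ∃ p : ℕ → Pair M N,
      (∀ k, backForth Δ Ω M N α _ (leftEnv (initialList p k)) (rightEnv (initialList p k)) < ε) ∧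
      (∀ k, (p k).2.1 ∈ A (p k).1 ∧ (p k).2.2 ∈ B (p k).1) ∧
      (∀ s, ∀ a ∈ A s, ∀ k, ∃ i ≥ k, ∃ b, p i = ⟨s, a, b⟩) ∧
      (∀ s, ∀ b ∈ B s, ∀ k, ∃ i ≥ k, ∃ a, p i = ⟨s, a, b⟩) := by
  have := fun s => (hAc s).to_subtype
  have := fun s => (hBc s).to_subtype
  have hα' : ∀ (Γ : List L.Sorts) (n : N.Env Γ) (m : M.Env Γ), backForth Δ Ω N M α Γ n m < ε →
      backForth Δ Ω N M (α + 1) Γ n m ≤ backForth Δ Ω N M α Γ n m := fun Γ n m h => by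
    rw [backForth_comm] at h
    rw [backForth_comm, backForth_comm (M := N)]
    exact hα Γ m n h
  -- A task is an element of `A` or of `B` that has to be added to the sequence.
  let Task := (Σ s, A s) ⊕ (Σ s, B s)
  let Done : Task → Pair M N → Prop := fun t q =>
    Sum.elim (fun x => ∃ b, q = ⟨x.1, x.2, b⟩) (fun y => ∃ a, q = ⟨y.1, a, y.2⟩) t
  obtain ⟨s₀⟩ := ‹Nonempty L.Sorts›
  have hne : Nonempty Task := ⟨Sum.inl ⟨s₀, ⟨_, (hA s₀).nonempty.some_mem⟩⟩⟩
  obtain ⟨e, he⟩ := exists_surjective_nat Task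
  let St := {l : List (Pair M N) // backForth Δ Ω M N α _ (leftEnv l) (rightEnv l) < ε}
  have hstep : ∀ (l : St) (t : Task), ∃ q : Pair M N, (q.2.1 ∈ A q.1 ∧ q.2.2 ∈ B q.1) ∧ Done t q ∧
      backForth Δ Ω M N α _ (leftEnv (q :: l.1)) (rightEnv (q :: l.1)) < ε := by
    rintro ⟨l, hl⟩ (⟨s, a, ha⟩ | ⟨s, b, hb⟩)
    · obtain ⟨b, hb, h⟩ := exists_right_lt hα hB _ _ hl a
      exact ⟨⟨s, a, b⟩, ⟨ha, hb⟩, ⟨b, rfl⟩, h⟩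
    · obtain ⟨a, ha, h⟩ := exists_right_lt hα' hA _ _ ((backForth_comm α _ _ _).trans_lt hl) b
      refine ⟨⟨s, a, b⟩, ⟨ha, hb⟩, ⟨a, rfl⟩, lt_of_eq_of_lt ?_ h⟩
      exact backForth_comm α _ _ _
  choose q hq hqd hqε using hstep
  let st : ℕ → St := Nat.rec ⟨[], h0⟩ fun k l =>
    ⟨q l (e k.unpair.1) :: l.1, hqε l (e k.unpair.1)⟩
  let p : ℕ → Pair M N := fun k => q (st k) (e k.unpair.1)
  have hst : ∀ k, (st k).1 = initialList p k := by
    intro k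
    induction k with
    | zero => rfl
    | succ k ih => exact congrArg (p k :: ·) ih
  have hinf : ∀ t k, ∃ i ≥ k, Done t (p i) := by
    intro t k
    obtain ⟨j, rfl⟩ := he t
    refine ⟨Nat.pair j k, Nat.right_le_pair j k, ?_⟩
    have := hqd (st (Nat.pair j k)) (e (Nat.pair j k).unpair.1)
    rw [Nat.unpair_pair] at this
    simpa only [p, Nat.unpair_pair] using this
  refine ⟨p, fun k => ?_, fun k => hq _ _, fun s a ha k => ?_, fun s b hb k => ?_⟩
  · rw [← hst]; exact (st k).2
  · exact hinf (Sum.inl ⟨s, a, ha⟩) k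
  · exact hinf (Sum.inr ⟨s, b, hb⟩) k

end Construction

/-! ### The u.u.c. case -/

section UUC

variable {T : Theory L} {Δ : FormulaSet L} {Ω : WeakModulus} {M N : Structure L}

lemma abs_sub_le_of_backForth_zero {Γ : List L.Sorts} {m : M.Env Γ} {n : N.Env Γ} {ε : ℝ}
    (hε : 0 ≤ ε) (h : backForth Δ Ω M N 0 Γ m n ≤ ENNReal.ofReal ε) {ψ : Formula L Γ}
    (hψ : ψ ∈ Δ Γ) (hr : ψ.Respects Ω) : |ψ.eval M m - ψ.eval N n| ≤ ε := by
  have h1 := (edist_le_backForth_zero hψ hr m n).trans h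
  rwa [edist_dist, Real.dist_eq, ENNReal.ofReal_le_ofReal_iff hε] at h1

lemma Relation.IsAlmostCor.isCor_thicken {R : Relation M N} (hR : R.IsAlmostCor) {δ : ℝ}
    (hδ : 0 < δ) : (R.thicken δ).IsCor := by
  refine fun s => ⟨Set.eq_univ_of_forall fun a => ?_, Set.eq_univ_of_forall fun b => ?_⟩
  · obtain ⟨c, ⟨e, hce⟩, hac⟩ := (hR.1.1 s).exists_dist_lt a hδ
    exact ⟨e, (c, e), hce, hac, by simpa using hδ⟩
  · obtain ⟨e, ⟨c, hce⟩, hbe⟩ := (hR.2.1 s).exists_dist_lt b hδ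
    exact ⟨c, (c, e), hce, by simpa using hδ, hbe⟩

lemma exists_initialList_subset {X : Type*} (p : ℕ → X) (I : List X)
    (hI : ∀ x ∈ I, x ∈ Set.range p) : ∃ k, ∀ x ∈ I, ∃ i < k, p i = x := by
  induction I with
  | nil => exact ⟨0, by simp⟩
  | cons x I ih =>
    obtain ⟨k, hk⟩ := ih fun y hy => hI y (List.mem_cons_of_mem _ hy)
    obtain ⟨i, hi⟩ := hI x List.mem_cons_self
    refine ⟨max k (i + 1), fun y hy => ?_⟩
    rcases List.mem_cons.1 hy with rfl | hy
    · exact ⟨i, by omega, hi⟩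
    · obtain ⟨j, hj, hjy⟩ := hk y hy
      exact ⟨j, by omega, hjy⟩

/-- The relation enumerated by a sequence of pairs. -/
def seqRelation (p : ℕ → Pair M N) : Relation M N := fun s => {x | ∃ k, p k = ⟨s, x⟩}

/-- A tuple of pairs of the sequence arises from an initial segment by a renaming of variables, and, in
the u.u.c. case, renaming does not destroy that the truncations respect `Ω`. -/
lemma distortion_seqRelation_le (hΔ : IsDistortionSystem T Δ) (hΩ : SuitableUUC T Δ Ω)
    (hM : M.Models T) (hN : N.Models T) {p : ℕ → Pair M N} {ε : ℝ} (hε0 : 0 ≤ ε) (hε : ε < 1 / 2)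
    (hp : ∀ k, backForth Δ Ω M N 0 _ (leftEnv (initialList p k)) (rightEnv (initialList p k)) ≤
      ENNReal.ofReal ε) : distortion Δ (seqRelation p) ≤ ENNReal.ofReal ε := by
  refine distortion_le fun Γ φ hφ m n hmn => ?_
  obtain ⟨I, hI, h⟩ := hmn.exists_list (sort := Sigma.fst) (P := fun x => x ∈ Set.range p)
    (fun x : Pair M N => x.2.1) (fun x : Pair M N => x.2.2)
    (fun s a b hab => ⟨⟨s, a, b⟩, hab, rfl⟩)
  obtain ⟨rfl, h⟩ := Sigma.mk.inj h
  obtain ⟨rfl, rfl⟩ := Prod.mk.inj (eq_of_heq h)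
  obtain ⟨k, hk⟩ := exists_initialList_subset p I hI
  obtain ⟨f, hf⟩ := exists_renaming (L := L) (sort := Sigma.fst) (fun x y : Pair M N => x = y)
    (fun x y h => by rw [h]) (initialList p k) I
    fun x hx => ⟨x, by obtain ⟨i, hi, rfl⟩ := hk x hx; exact mem_initialList p hi, rfl⟩
  have h1 := hΔ.abs_sub_le (hΔ.rename f φ hφ) (fun c => hΩ _ _ (hΔ.clamp (hΔ.rename f φ hφ) c)
    fun M _ m => Formula.clamp_mem_Icc _ _ _ _) hM hN hε
    fun ψ hψ hr => abs_sub_le_of_backForth_zero hε0 (hp k) hψ hr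
  rw [Formula.eval_rename, Formula.eval_rename] at h1
  rw [edist_dist, Real.dist_eq]
  refine ENNReal.ofReal_le_ofReal ?_
  have h2 := hf M (fun x : Pair M N => x.2.1) (by rintro x - y - rfl; rfl)
  have h3 := hf N (fun x : Pair M N => x.2.2) (by rintro x - y - rfl; rfl)
  unfold leftEnv rightEnv at h1
  rwa [h2, h3] at h1

end UUC

/-! ### Ultrapowers -/

section Ultrapower

open Filter Topology

lemma exists_tendsto_ultrafilter (U : Ultrafilter ℕ) {x : ℕ → ℝ} {C : ℝ} (h : ∀ k, |x k| ≤ C) :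
    ∃ l, Tendsto x U (𝓝 l) := by
  obtain ⟨l, -, hl⟩ := (isCompact_Icc (a := -C) (b := C)).ultrafilter_le_nhds (U.map x)
    (le_principal_iff.2 (Filter.mem_map.2 (Eventually.of_forall fun k => abs_le.1 (h k))))
  exact ⟨l, hl⟩

/-- Sequences of elements of sort `s`, with the ultralimit of the distances as pseudo-metric. -/
def USeq (M : Structure L) (_ : Ultrafilter ℕ) (s : L.Sorts) : Type := ℕ → M.carrier s

variable {M : Structure L} {U : Ultrafilter ℕ}

lemma tendsto_limUnder_dist (U : Ultrafilter ℕ) {s : L.Sorts} (x y : ℕ → M.carrier s) :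
    Tendsto (fun k => dist (x k) (y k)) U (𝓝 (limUnder (U : Filter ℕ) fun k => dist (x k) (y k))) :=
  tendsto_nhds_limUnder (exists_tendsto_ultrafilter U fun k => by
    rw [abs_of_nonneg dist_nonneg]; exact M.dist_le s _ _)

noncomputable instance (s : L.Sorts) : PseudoMetricSpace (USeq M U s) where
  dist x y := limUnder (U : Filter ℕ) fun k => dist (x k) (y k)
  dist_self x := tendsto_nhds_unique (tendsto_limUnder_dist U x x) (by simp)
  dist_comm x y := by simp only [dist_comm]
  dist_triangle x y z := le_of_tendsto_of_tendsto' (tendsto_limUnder_dist U x z)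
    ((tendsto_limUnder_dist U x y).add (tendsto_limUnder_dist U y z)) fun k => dist_triangle _ _ _

/-- The element of the ultrapower given by a sequence. -/
noncomputable def umk (U : Ultrafilter ℕ) {s : L.Sorts} (x : ℕ → M.carrier s) :
    SeparationQuotient (USeq M U s) :=
  SeparationQuotient.mk (X := USeq M U s) x

lemma tendsto_dist_umk (U : Ultrafilter ℕ) {s : L.Sorts} (x y : ℕ → M.carrier s) :
    Tendsto (fun k => dist (x k) (y k)) U (𝓝 (dist (umk U x) (umk U y))) :=
  tendsto_limUnder_dist U x y

lemma umk_eq_iff {s : L.Sorts} {x y : ℕ → M.carrier s} :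
    umk U x = umk U y ↔ Tendsto (fun k => dist (x k) (y k)) U (𝓝 0) := by
  refine ⟨fun h => ?_, fun h => ?_⟩
  · have := tendsto_dist_umk U x y
    rwa [h, dist_self] at this
  · exact dist_eq_zero.1 (tendsto_nhds_unique (tendsto_dist_umk U x y) h)

/-- A representing sequence of an element of the ultrapower. -/
noncomputable def urep {s : L.Sorts} (a : SeparationQuotient (USeq M U s)) : ℕ → M.carrier s :=
  (SeparationQuotient.surjective_mk a).choose

lemma umk_urep {s : L.Sorts} (a : SeparationQuotient (USeq M U s)) : umk U (urep a) = a :=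
  (SeparationQuotient.surjective_mk a).choose_spec

/-- A diagonal argument: sequences modulo a nonprincipal ultrafilter on `ℕ` form a complete
space. -/
lemma completeSpace_useq (hU : (U : Filter ℕ) ≤ atTop) (s : L.Sorts) :
    CompleteSpace (USeq M U s) := by
  refine Metric.complete_of_convergent_controlled_sequences (fun n => (1 / 2 : ℝ) ^ n)
    (fun n => by positivity) fun u hu => ?_
  classical
  -- `P n k`: at the coordinate `k`, the first `n` sequences are as close as they should be.
  let P : ℕ → ℕ → Prop := fun n k =>
    ∀ j ≤ n, ∀ i ≤ j, dist (u i k) (u j k) ≤ (1 / 2 : ℝ) ^ i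
  have hP : ∀ n, ∀ᶠ k in (U : Filter ℕ), P n k := by
    intro n
    refine (Filter.eventually_all_finite (Set.finite_Iic n)).2 fun j _ =>
      (Filter.eventually_all_finite (Set.finite_Iic j)).2 fun i hi => ?_
    exact ((tendsto_dist_umk U (u i) (u j)).eventually
      (gt_mem_nhds (hu i i j le_rfl hi))).mono fun k hk => hk.le
  let g : ℕ → ℕ := fun k => Nat.findGreatest (fun n => P n k) k
  let x : USeq M U s := fun k => u (g k) k
  refine ⟨x, ?_⟩
  have hle : ∀ n, dist (u n) x ≤ (1 / 2 : ℝ) ^ n := by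
    intro n
    refine le_of_tendsto (tendsto_dist_umk U (u n) x) ?_
    filter_upwards [hP n, hU (eventually_ge_atTop n)] with k hk hnk
    exact Nat.findGreatest_spec (P := fun n => P n k) hnk hk (g k) le_rfl n
      (Nat.le_findGreatest hnk hk)
  rw [tendsto_iff_dist_tendsto_zero]
  exact squeeze_zero (fun n => dist_nonneg) hle
    (tendsto_pow_atTop_nhds_zero_of_lt_one (by norm_num) (by norm_num))

lemma tendsto_dist_funMap (f : L.Func)
    {x y : (i : Fin (L.funArity f)) → ℕ → M.carrier (L.funDom f i)}
    (h : ∀ i, umk U (x i) = umk U (y i)) :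
    umk U (fun k => M.funMap f fun i => x i k) = umk U (fun k => M.funMap f fun i => y i k) := by
  rw [umk_eq_iff, Metric.tendsto_nhds]
  intro ε hε
  have h1 : ∀ᶠ k in (U : Filter ℕ), ∀ i, dist (x i k) (y i k) < L.funMod f (ε / 2) :=
    eventually_all.2 fun i => (umk_eq_iff.1 (h i)).eventually
      (gt_mem_nhds (L.funMod_pos f _ (half_pos hε)))
  filter_upwards [h1] with _ hk
  rw [Real.dist_eq, sub_zero, abs_of_nonneg dist_nonneg]
  exact (M.fun_unif f _ (half_pos hε) _ _ hk).trans_lt (half_lt_self hε)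

lemma tendsto_relMap (U : Ultrafilter ℕ) (P : L.Rel)
    (x : (i : Fin (L.relArity P)) → ℕ → M.carrier (L.relDom P i)) :
    Tendsto (fun k => M.relMap P fun i => x i k) U
      (𝓝 (limUnder (U : Filter ℕ) fun k => M.relMap P fun i => x i k)) :=
  tendsto_nhds_limUnder (exists_tendsto_ultrafilter U fun _ =>
    abs_le_max_abs_abs (M.rel_mem P _).1 (M.rel_mem P _).2)

lemma limUnder_relMap_congr (P : L.Rel)
    {x y : (i : Fin (L.relArity P)) → ℕ → M.carrier (L.relDom P i)}
    (h : ∀ i, umk U (x i) = umk U (y i)) :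
    (limUnder (U : Filter ℕ) fun k => M.relMap P fun i => x i k) =
      limUnder (U : Filter ℕ) fun k => M.relMap P fun i => y i k := by
  refine eq_of_abs_sub_nonpos (le_of_forall_pos_le_add fun ε hε => ?_)
  rw [zero_add]
  have h1 : ∀ᶠ k in (U : Filter ℕ), ∀ i, dist (x i k) (y i k) < L.relMod P ε :=
    eventually_all.2 fun i => (umk_eq_iff.1 (h i)).eventually
      (gt_mem_nhds (L.relMod_pos P _ hε))
  exact le_of_tendsto ((tendsto_relMap U P x).sub (tendsto_relMap U P y)).abs
    (h1.mono fun k hk => M.rel_unif P _ hε _ _ hk)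

/-- The metric ultrapower of `M` by a nonprincipal ultrafilter on `ℕ`. -/
noncomputable def Structure.ultrapower (M : Structure L) (U : Ultrafilter ℕ)
    (hU : (U : Filter ℕ) ≤ atTop) : Structure L where
  carrier s := SeparationQuotient (USeq M U s)
  complete s := by
    have := completeSpace_useq (M := M) hU s
    infer_instance
  nonempty s := ⟨umk U fun _ => Classical.arbitrary (M.carrier s)⟩
  dist_le s x y := by
    rw [← umk_urep x, ← umk_urep y]
    exact le_of_tendsto' (tendsto_dist_umk U _ _) fun k => M.dist_le s _ _
  funMap f x := umk U fun k => M.funMap f fun i => urep (x i) k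
  fun_unif f ε hε x y h := by
    have h1 : ∀ᶠ k in (U : Filter ℕ), ∀ i, dist (urep (x i) k) (urep (y i) k) < L.funMod f ε := by
      refine eventually_all.2 fun i => (tendsto_dist_umk U _ _).eventually (gt_mem_nhds ?_)
      rw [umk_urep, umk_urep]
      exact h i
    exact le_of_tendsto (tendsto_dist_umk U _ _) (h1.mono fun k hk => M.fun_unif f ε hε _ _ hk)
  relMap P x := limUnder (U : Filter ℕ) fun k => M.relMap P fun i => urep (x i) k
  rel_mem P x := isClosed_Icc.mem_of_tendsto (tendsto_relMap U P _)
    (Eventually.of_forall fun k => M.rel_mem P _)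
  rel_unif P ε hε x y h := by
    have h1 : ∀ᶠ k in (U : Filter ℕ), ∀ i, dist (urep (x i) k) (urep (y i) k) < L.relMod P ε := by
      refine eventually_all.2 fun i => (tendsto_dist_umk U _ _).eventually (gt_mem_nhds ?_)
      rw [umk_urep, umk_urep]
      exact h i
    exact le_of_tendsto ((tendsto_relMap U P _).sub (tendsto_relMap U P _)).abs
      (h1.mono fun k hk => M.rel_unif P ε hε _ _ hk)

variable {hU : (U : Filter ℕ) ≤ atTop}

/-- The tuple of the ultrapower given by a sequence of tuples. -/
noncomputable def uenv (hU : (U : Filter ℕ) ≤ atTop) : {Γ : List L.Sorts} → (ℕ → M.Env Γ) →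
    (M.ultrapower U hU).Env Γ
  | [], _ => ()
  | _ :: _, v => (umk U fun k => (v k).1, uenv hU fun k => (v k).2)

lemma lookup_uenv {Γ : List L.Sorts} (v : ℕ → M.Env Γ) {s : L.Sorts} (x : Var Γ s) :
    (uenv hU v).lookup x = umk U fun k => (v k).lookup x := by
  induction x with
  | head => rfl
  | tail x ih => exact ih fun k => (v k).2

lemma Term.eval_ultrapower {Γ : List L.Sorts} (v : ℕ → M.Env Γ) {s : L.Sorts} (t : Term L Γ s) :
    t.eval (M.ultrapower U hU) (uenv hU v) = umk U fun k => t.eval M (v k) := by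
  induction t with
  | var x => exact lookup_uenv v x
  | app f ts ih => exact tendsto_dist_funMap f fun i => (umk_urep _).trans (ih i)

/-- Łoś's theorem. -/
lemma Formula.tendsto_eval_ultrapower {Γ : List L.Sorts} (φ : Formula L Γ) : ∀ v : ℕ → M.Env Γ,
    Tendsto (fun k => φ.eval M (v k)) U (𝓝 (φ.eval (M.ultrapower U hU) (uenv hU v))) := by
  have h0 : Tendsto (fun k : ℕ => 1 / ((k : ℝ) + 1)) U (𝓝 0) :=
    tendsto_one_div_add_atTop_nhds_zero_nat.mono_left hU
  induction φ with
  | dist t u =>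
    intro v
    have h := tendsto_dist_umk U (fun k => t.eval M (v k)) (fun k => u.eval M (v k))
    rw [← Term.eval_ultrapower (hU := hU), ← Term.eval_ultrapower (hU := hU)] at h
    exact h
  | rel P ts =>
    intro v
    have h := tendsto_relMap U P fun i k => (ts i).eval M (v k)
    rw [limUnder_relMap_congr P
      (y := fun i => urep ((ts i).eval (M.ultrapower U hU) (uenv hU v)))
      fun i => ((Term.eval_ultrapower v (ts i)).symm.trans (umk_urep _).symm)] at h
    exact h
  | conn F φ ih =>
    intro v
    exact (F.continuous.tendsto _).comp (tendsto_pi_nhds.2 fun i => ih i v)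
  | connω F φ ih =>
    intro v
    exact (F.continuous.tendsto _).comp (tendsto_pi_nhds.2 fun i => ih i v)
  | @sup Γ s φ ih =>
    intro v
    obtain ⟨C, hC⟩ := (Formula.sup φ).exists_bound
    obtain ⟨l, hl⟩ := exists_tendsto_ultrafilter U fun k => hC M (v k)
    suffices h : l = (Formula.sup φ).eval (M.ultrapower U hU) (uenv hU v) by rw [← h]; exact hl
    refine le_antisymm ?_ (ciSup_le fun a => ?_)
    · choose a ha using fun k => exists_lt_of_lt_ciSup
        (show (Formula.sup φ).eval M (v k) - 1 / ((k : ℝ) + 1) <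
          ⨆ a : M.carrier s, φ.eval M (a, v k) from sub_lt_self _ Nat.one_div_pos_of_nat)
      have h1 := le_of_tendsto_of_tendsto' (hl.sub h0) (ih fun k => (a k, v k))
        fun k => (ha k).le
      rw [sub_zero] at h1
      exact h1.trans (le_ciSup (φ.bddAbove (M.ultrapower U hU) (uenv hU v)) (umk U a))
    · have h1 := le_of_tendsto_of_tendsto' (ih fun k => (urep a k, v k)) hl
        fun k => le_ciSup (φ.bddAbove M (v k)) (urep a k)
      refine le_of_eq_of_le (congrArg (fun b => φ.eval (M.ultrapower U hU) (b, uenv hU v)) ?_) h1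
      exact (umk_urep a).symm
  | @inf Γ s φ ih =>
    intro v
    obtain ⟨C, hC⟩ := (Formula.inf φ).exists_bound
    obtain ⟨l, hl⟩ := exists_tendsto_ultrafilter U fun k => hC M (v k)
    suffices h : l = (Formula.inf φ).eval (M.ultrapower U hU) (uenv hU v) by rw [← h]; exact hl
    refine le_antisymm (le_ciInf fun a => ?_) ?_
    · have h1 := le_of_tendsto_of_tendsto' hl (ih fun k => (urep a k, v k))
        fun k => ciInf_le (φ.bddBelow M (v k)) (urep a k)
      refine h1.trans_eq (congrArg (fun b => φ.eval (M.ultrapower U hU) (b, uenv hU v)) ?_)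
      exact umk_urep a
    · choose a ha using fun k => exists_lt_of_ciInf_lt
        (show ⨅ a : M.carrier s, φ.eval M (a, v k) <
          (Formula.inf φ).eval M (v k) + 1 / ((k : ℝ) + 1) from
            lt_add_of_pos_right _ Nat.one_div_pos_of_nat)
      have h1 := le_of_tendsto_of_tendsto' (ih fun k => (a k, v k)) (hl.add h0)
        fun k => (ha k).le
      rw [add_zero] at h1
      exact (ciInf_le (φ.bddBelow (M.ultrapower U hU) (uenv hU v)) (umk U a)).trans h1

lemma Structure.Models.ultrapower {T : Theory L} (h : M.Models T) :
    (M.ultrapower U hU).Models T := fun σ hσ =>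
  le_of_tendsto' (σ.tendsto_eval_ultrapower fun _ => ()) fun _ => h σ hσ

end Ultrapower

/-! ### Tuples listed by a sequence of pairs -/

section Listed

variable {M N : Structure L}

/-- `Listed p n k m m'`: the pairs of corresponding entries of `m` and `m'` occur in the sequence
`p` at increasing indices in `[n, k)`, the entry of `x₀` first. -/
inductive Listed (p : ℕ → Pair M N) (n : ℕ) :
    ℕ → {Γ : List L.Sorts} → M.Env Γ → N.Env Γ → Prop
  | nil {k : ℕ} (h : n ≤ k) : Listed p n k (Γ := []) () ()
  | cons {i k : ℕ} {Γ : List L.Sorts} {m : M.Env Γ} {m' : N.Env Γ} {s : L.Sorts}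
      {a : M.carrier s} {b : N.carrier s} (h : Listed p n i m m') (hik : i < k)
      (hi : p i = ⟨s, a, b⟩) : Listed p n k (Γ := s :: Γ) (a, m) (b, m')

lemma Listed.mono {p : ℕ → Pair M N} {n k k' : ℕ} {Γ : List L.Sorts} {m : M.Env Γ} {m' : N.Env Γ}
    (h : Listed p n k m m') (hk : k ≤ k') : Listed p n k' m m' := by
  cases h with
  | nil h => exact .nil (h.trans hk)
  | cons h hik hi => exact .cons h (hik.trans_le hk) hi

/-- The pair `p i` is the entry of the variable `xᵢ` in the tuples of an initial segment. -/
lemma exists_var_initialList (p : ℕ → Pair M N) {i k : ℕ} (h : i < k) {s : L.Sorts}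
    {a : M.carrier s} {b : N.carrier s} (hi : p i = ⟨s, a, b⟩) :
    ∃ v : Var ((initialList p k).map Sigma.fst) s, v.pos = i ∧
      (leftEnv (initialList p k)).lookup v = a ∧ (rightEnv (initialList p k)).lookup v = b := by
  induction k with
  | zero => omega
  | succ k ih =>
    rcases Nat.lt_succ_iff_lt_or_eq.1 h with h | rfl
    · obtain ⟨v, hv, h1, h2⟩ := ih h
      exact ⟨v.tail, hv, h1, h2⟩
    · have hlen : ((initialList p i).map Sigma.fst).length = i := by
        clear ih h hi
        induction i with
        | zero => rfl
        | succ i ih => simpa [initialList] using ih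
      change ∃ v : Var ((p i).1 :: (initialList p i).map Sigma.fst) s, v.pos = i ∧
        Structure.Env.lookup (M := M) (Γ := (p i).1 :: (initialList p i).map Sigma.fst)
          ((p i).2.1, leftEnv (initialList p i)) v = a ∧
        Structure.Env.lookup (M := N) (Γ := (p i).1 :: (initialList p i).map Sigma.fst)
          ((p i).2.2, rightEnv (initialList p i)) v = b
      rw [hi]
      exact ⟨.head, hlen, rfl, rfl⟩

/-- A listed pair of tuples arises from an initial segment of the sequence by a renaming of
variables that, after `x₀, x₁, …` are shifted to `xₙ, xₙ₊₁, …`, is increasing. -/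
lemma Listed.exists_renaming {p : ℕ → Pair M N} {n k : ℕ} {Γ : List L.Sorts} {m : M.Env Γ}
    {m' : N.Env Γ} (h : Listed p n k m m') {K : ℕ} (hK : k ≤ K) :
    ∃ f : Renaming Γ ((initialList p K).map Sigma.fst),
      (leftEnv (initialList p K)).comap f = m ∧ (rightEnv (initialList p K)).comap f = m' ∧
      ∃ j : ℕ → ℕ, StrictMono j ∧ (∀ s (x : Var Γ s), (f s x).pos = j (n + x.pos)) ∧
        ∀ u < n + Γ.length, j u < k := by
  induction h with
  | nil h => exact ⟨fun _ x => (nomatch x), rfl, rfl, id, strictMono_id, fun _ x => (nomatch x),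
      fun u hu => lt_of_lt_of_le hu h⟩
  | @cons i k Γ m m' s a b h hik hi ih =>
    obtain ⟨f, hm, hm', j, hj, hf, hji⟩ := ih (by omega)
    obtain ⟨v, hv, hva, hvb⟩ := exists_var_initialList p (hik.trans_le hK) hi
    refine ⟨Renaming.cons v f, Prod.ext hva hm, Prod.ext hvb hm',
      fun u => if u < n + Γ.length then j u else i + (u - (n + Γ.length)), ?_, ?_, ?_⟩
    · refine strictMono_nat_of_lt_succ fun u => ?_
      have h1 := hj (Nat.lt_succ_self u)
      have h2 := hji u
      split_ifs <;> omega
    · intro t x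
      cases x with
      | head =>
        change v.pos = if n + Γ.length < n + Γ.length then _ else i + (n + Γ.length - (n + Γ.length))
        rw [if_neg (lt_irrefl _), hv, Nat.sub_self, add_zero]
      | tail x =>
        have h1 := x.pos_lt
        change (f t x).pos = if n + x.pos < n + Γ.length then _ else _
        rw [if_pos (by omega)]
        exact hf t x
    · intro u hu
      have h2 := hji u
      simp only [List.length_cons] at hu
      dsimp only
      split_ifs <;> omega

/-- Renaming the variables of a formula increasingly makes the arguments of a shift increasing weak
modulus move to later positions only. -/
lemma Formula.RespectsFrom.rename {Ω : WeakModulus} (hΩ : Ω.ShiftIncreasing) {n : ℕ}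
    {Γ Γ' : List L.Sorts} {φ : Formula L Γ} (h : φ.RespectsFrom Ω n M) {f : Renaming Γ Γ'}
    {j : ℕ → ℕ} (hj : StrictMono j) (hf : ∀ s (x : Var Γ s), (f s x).pos = j (n + x.pos)) :
    (φ.rename f).RespectsFrom Ω 0 M := by
  rw [Formula.respectsFrom_zero_iff]
  intro m m'
  rw [Formula.eval_rename, Formula.eval_rename]
  refine (h _ _).trans ((hΩ j hj _).trans (Ω.mono fun t => ?_))
  by_cases ht : ∃ u, j u = t
  · obtain ⟨u, rfl⟩ := ht
    rw [hj.injective.extend_apply]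
    by_cases hu : ∃ i, i + n = u
    · obtain ⟨i, rfl⟩ := hu
      rw [(add_left_injective n).extend_apply]
      rcases lt_or_ge i Γ.length with hi | hi
      · obtain ⟨s, x, rfl⟩ := Var.exists_pos Γ i hi
        rw [M.distSeq_pos, add_comm, ← hf, M.distSeq_pos, Structure.Env.lookup_comap,
          Structure.Env.lookup_comap]
      · rw [M.distSeq_of_le _ _ _ hi]; exact zero_le
    · rw [Function.extend_apply' _ _ _ hu]; exact zero_le
  · rw [Function.extend_apply' _ _ _ ht]; exact zero_le

variable {T : Theory L} {Δ : FormulaSet L} {Ω : WeakModulus}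

/-- In the functional case, a formula need not respect `Ω` after a renaming of variables; it does if the
renaming is the shift by `n` followed by an increasing map. -/
lemma Listed.abs_sub_le (hΔ : IsDistortionSystem T Δ) (hΩ : Ω.ShiftIncreasing)
    (hM : M.Models T) (hN : N.Models T) {p : ℕ → Pair M N} {ε : ℝ} (hε0 : 0 ≤ ε) (hε : ε < 1 / 2)
    (hp : ∀ k, backForth Δ Ω M N 0 _ (leftEnv (initialList p k)) (rightEnv (initialList p k)) ≤
      ENNReal.ofReal ε) {Γ : List L.Sorts} {φ : Formula L Γ} (hφ : φ ∈ Δ Γ) {n : ℕ}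
    (hn : ∀ M : Structure L, M.Models T → φ.RespectsFrom Ω n M) {k : ℕ} {m : M.Env Γ}
    {m' : N.Env Γ} (h : Listed p n k m m') : |φ.eval M m - φ.eval N m'| ≤ ε := by
  obtain ⟨f, rfl, rfl, j, hj, hf, -⟩ := h.exists_renaming le_rfl
  rw [← Formula.eval_rename, ← Formula.eval_rename]
  exact hΔ.abs_sub_le (hΔ.rename f φ hφ) (fun c Q hQ => ((hn Q hQ).rename hΩ hj hf).clamp c) hM hN
    hε fun ψ hψ hr => abs_sub_le_of_backForth_zero hε0 (hp k) hψ hr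

end Listed

/-! ### Functional distortion systems: the limit relation on ultrapowers -/

section Ultra

open Filter Topology

variable {M N : Structure L} {U : Ultrafilter ℕ} {hU : (U : Filter ℕ) ≤ atTop}

/-- The sequence of the pairs with exchanged entries. -/
def swapSeq (p : ℕ → Pair M N) : ℕ → Pair N M := fun i => ⟨(p i).1, (p i).2.swap⟩

lemma swapSeq_eq_iff {p : ℕ → Pair M N} {i : ℕ} {s : L.Sorts} {a : M.carrier s}
    {b : N.carrier s} : swapSeq p i = ⟨s, b, a⟩ ↔ p i = ⟨s, a, b⟩ := by
  unfold swapSeq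
  constructor <;> intro h
  · generalize p i = q at *
    obtain ⟨t, c, d⟩ := q
    obtain ⟨rfl, h⟩ := Sigma.mk.inj h
    obtain ⟨rfl, rfl⟩ := Prod.mk.inj (eq_of_heq h)
    rfl
  · rw [h]; rfl

/-- The relation between ultrapowers whose pairs are the ultralimits of pairs of the sequence `p`
with indices tending to infinity. -/
def ultraRelation (hU : (U : Filter ℕ) ≤ atTop) (p : ℕ → Pair M N) :
    Relation (M.ultrapower U hU) (N.ultrapower U hU) := fun s =>
  {x | ∃ (i : ℕ → ℕ) (a : ℕ → M.carrier s) (b : ℕ → N.carrier s), (∀ k, k ≤ i k) ∧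
    (∀ k, p (i k) = ⟨s, a k, b k⟩) ∧ umk U a = x.1 ∧ umk U b = x.2}

lemma mem_ultraRelation_swapSeq {p : ℕ → Pair M N} {s : L.Sorts}
    {x : (M.ultrapower U hU).carrier s} {y : (N.ultrapower U hU).carrier s} :
    (y, x) ∈ ultraRelation hU (swapSeq p) s ↔ (x, y) ∈ ultraRelation hU p s := by
  constructor
  · rintro ⟨i, b, a, hi, hp, hb, ha⟩
    exact ⟨i, a, b, hi, fun k => swapSeq_eq_iff.1 (hp k), ha, hb⟩
  · rintro ⟨i, a, b, hi, hp, ha, hb⟩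
    exact ⟨i, b, a, hi, fun k => swapSeq_eq_iff.2 (hp k), hb, ha⟩

/-- The pairs of `p` of large index approximate every element of `M`. -/
def LeftDense (p : ℕ → Pair M N) : Prop :=
  ∀ (s : L.Sorts) (a : M.carrier s), ∀ δ > 0, ∀ n, ∃ i ≥ n, ∃ (a' : M.carrier s) (b : N.carrier s),
    p i = ⟨s, a', b⟩ ∧ dist a a' < δ

lemma LeftDense.exists_mem_ultraRelation {p : ℕ → Pair M N} (hp : LeftDense p) (s : L.Sorts)
    (x : (M.ultrapower U hU).carrier s) : ∃ y, (x, y) ∈ ultraRelation hU p s := by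
  choose i hi a b hpi hd using fun k => hp s (urep x k) (1 / ((k : ℝ) + 1)) Nat.one_div_pos_of_nat k
  refine ⟨umk U b, i, a, b, hi, hpi, ?_, rfl⟩
  refine Eq.trans ?_ (umk_urep x)
  refine (umk_eq_iff.2 ?_).symm
  exact squeeze_zero (fun k => dist_nonneg) (fun k => (hd k).le)
    (tendsto_one_div_add_atTop_nhds_zero_nat.mono_left hU)

/-- A list can be thinned out and sorted decreasingly with respect to a function `g`. -/
lemma exists_decreasing_list {X β : Type*} [LinearOrder β] (g : X → β) (I : List X) :
    ∃ J : List X, J.Pairwise (fun x y => g y < g x) ∧ ∀ x ∈ I, ∃ y ∈ J, g x = g y := by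
  induction I with
  | nil => exact ⟨[], List.Pairwise.nil, by simp⟩
  | cons x I ih =>
    obtain ⟨J, hJ, hIJ⟩ := ih
    refine ⟨J.filter (fun y => g x < g y) ++ x :: J.filter (fun y => g y < g x), ?_, ?_⟩
    · refine List.pairwise_append.2 ⟨hJ.filter _, List.pairwise_cons.2 ⟨?_, hJ.filter _⟩, ?_⟩
      · intro y hy
        simpa using (List.mem_filter.1 hy).2
      · intro y hy z hz
        have hy : g x < g y := by simpa using (List.mem_filter.1 hy).2
        rcases List.mem_cons.1 hz with rfl | hz
        · exact hy
        · exact (show g z < g x by simpa using (List.mem_filter.1 hz).2).trans hy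
    · intro y hy
      by_cases hxy : g y = g x
      · exact ⟨x, by simp, hxy⟩
      · rcases List.mem_cons.1 hy with rfl | hy
        · exact absurd rfl hxy
        · obtain ⟨z, hz, h⟩ := hIJ y hy
          refine ⟨z, ?_, h⟩
          rcases lt_or_gt_of_ne hxy with h' | h' <;> rw [h] at h' <;> simp [hz, h']

/-- A sequence of pairs of the sequence `p` of constant sort with indices tending to infinity. -/
structure Subseq (p : ℕ → Pair M N) where
  idx : ℕ → ℕ
  le_idx : ∀ k, k ≤ idx k
  sort : L.Sorts
  left : ℕ → M.carrier sort
  right : ℕ → N.carrier sort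
  eq : ∀ k, p (idx k) = ⟨sort, left k, right k⟩

/-- If the indices of several subsequences are ordered along `U`, then along `U` the tuples of the `k`-th
terms are listed by the sequence. -/
lemma Subseq.eventually_listed (hU : (U : Filter ℕ) ≤ atTop) {p : ℕ → Pair M N} (n : ℕ)
    {J : List (Subseq p)}
    (hJ : J.Pairwise fun x y => ∀ᶠ k in (U : Filter ℕ), y.idx k < x.idx k) :
    ∀ᶠ k in (U : Filter ℕ), ∀ b, n ≤ b → (∀ y ∈ J, y.idx k < b) →
      Listed p n b (envOf (fun x : Subseq p => x.left k) J)
        (envOf (fun x : Subseq p => x.right k) J) := by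
  induction J with
  | nil => exact Eventually.of_forall fun k b hb _ => .nil hb
  | cons x J ih =>
    obtain ⟨h1, h2⟩ := List.pairwise_cons.1 hJ
    have h3 : ∀ᶠ k in (U : Filter ℕ), ∀ y ∈ J, y.idx k < x.idx k :=
      (Filter.eventually_all_finite J.finite_toSet).2 h1
    filter_upwards [ih h2, h3, hU (eventually_ge_atTop n)] with k h4 h5 h6 b _ hb
    exact .cons (h4 (x.idx k) (h6.trans (x.le_idx k)) h5) (hb x List.mem_cons_self) (x.eq k)

lemma uenv_envOf {Lab : Type*} {sort : Lab → L.Sorts} (val : (x : Lab) → ℕ → M.carrier (sort x)) :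
    ∀ J : List Lab, uenv hU (fun k => envOf (fun x => val x k) J) =
      envOf (M := M.ultrapower U hU) (fun x => umk U (val x)) J
  | [] => rfl
  | _ :: J => Prod.ext rfl (uenv_envOf val J)

/-- If the formulas of `Δ` almost differ by at most `ε` on all tuples listed by far parts of the
sequence, then the limit relation has distortion at most `ε`. Tuples of the limit relation come from
several subsequences, which the ultrafilter puts in a definite order. -/
lemma distortion_ultraRelation_le {T : Theory L} {Δ : FormulaSet L} (hΔ : IsDistortionSystem T Δ)
    {p : ℕ → Pair M N} {ε : ℝ}
    (hp : ∀ Γ, ∀ φ ∈ Δ Γ, ∀ η > 0, ∃ n, ∀ k (m : M.Env Γ) (m' : N.Env Γ), Listed p n k m m' →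
      |φ.eval M m - φ.eval N m'| ≤ ε + η) :
    distortion Δ (ultraRelation hU p) ≤ ENNReal.ofReal ε := by
  refine distortion_le fun Γ φ hφ m m' hmm => ?_
  obtain ⟨I, -, h⟩ := hmm.exists_list (sort := Subseq.sort (p := p)) (P := fun _ => True)
    (fun x => umk U x.left) (fun x => umk U x.right) (by
      rintro s _ _ ⟨i, a, b, hi, hpi, rfl, rfl⟩
      exact ⟨⟨i, hi, s, a, b, hpi⟩, trivial, rfl⟩)
  obtain ⟨rfl, h⟩ := Sigma.mk.inj h
  obtain ⟨rfl, rfl⟩ := Prod.mk.inj (eq_of_heq h)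
  obtain ⟨J, hJ, hIJ⟩ := exists_decreasing_list
    (fun x : Subseq p => ((x.idx : ℕ → ℕ) : Germ (U : Filter ℕ) ℕ)) I
  simp only [Germ.coe_lt, Germ.coe_eq] at hJ hIJ
  have hE : ∀ x y : Subseq p, x.idx =ᶠ[(U : Filter ℕ)] y.idx →
      (⟨x.sort, umk U x.left, umk U x.right⟩ : Pair (M.ultrapower U hU) (N.ultrapower U hU)) =
        ⟨y.sort, umk U y.left, umk U y.right⟩ := by
    rintro ⟨i, hi, s, a, b, hab⟩ ⟨j, hj, t, c, d, hcd⟩ (h : ∀ᶠ k in (U : Filter ℕ), i k = j k)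
    have h1 : ∀ᶠ k in (U : Filter ℕ), (⟨s, a k, b k⟩ : Pair M N) = ⟨t, c k, d k⟩ :=
      h.mono fun k hk => by rw [← hab, ← hcd, hk]
    obtain ⟨k, hk⟩ := h1.exists
    obtain ⟨rfl, -⟩ := Sigma.mk.inj hk
    have h2 : ∀ᶠ k in (U : Filter ℕ), a k = c k ∧ b k = d k := h1.mono fun k hk =>
      Prod.mk.inj (eq_of_heq (Sigma.mk.inj hk).2)
    have h3 : umk U a = umk U c := umk_eq_iff.2 (tendsto_const_nhds.congr'
      (h2.mono fun k hk => show 0 = dist (a k) (c k) by rw [hk.1, dist_self]))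
    have h4 : umk U b = umk U d := umk_eq_iff.2 (tendsto_const_nhds.congr'
      (h2.mono fun k hk => show 0 = dist (b k) (d k) by rw [hk.2, dist_self]))
    dsimp only
    rw [h3, h4]
  obtain ⟨f, hf⟩ := exists_renaming (L := L) (sort := Subseq.sort (p := p))
    (fun x y => x.idx =ᶠ[(U : Filter ℕ)] y.idx) (fun x y h => (Sigma.mk.inj (hE x y h)).1) J I hIJ
  have hM := hf (M.ultrapower U hU) (fun x => umk U x.left) fun x _ y _ h =>
    congrArg (fun q : Pair (M.ultrapower U hU) (N.ultrapower U hU) =>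
      (⟨q.1, q.2.1⟩ : Σ s, (M.ultrapower U hU).carrier s)) (hE x y h)
  have hN := hf (N.ultrapower U hU) (fun x => umk U x.right) fun x _ y _ h =>
    congrArg (fun q : Pair (M.ultrapower U hU) (N.ultrapower U hU) =>
      (⟨q.1, q.2.2⟩ : Σ s, (N.ultrapower U hU).carrier s)) (hE x y h)
  rw [← hM, ← hN, ← Formula.eval_rename, ← Formula.eval_rename, edist_dist, Real.dist_eq]
  refine ENNReal.ofReal_le_ofReal (le_of_forall_pos_le_add fun η hη => ?_)
  obtain ⟨n, hn⟩ := hp _ _ (hΔ.rename f φ hφ) η hη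
  rw [← uenv_envOf, ← uenv_envOf]
  refine le_of_tendsto (((φ.rename f).tendsto_eval_ultrapower _).sub
    ((φ.rename f).tendsto_eval_ultrapower _)).abs ?_
  filter_upwards [Subseq.eventually_listed hU n hJ] with k hk
  have hb : ∀ J : List (Subseq p), ∃ b, n ≤ b ∧ ∀ y ∈ J, y.idx k < b := by
    intro J
    induction J with
    | nil => exact ⟨n, le_rfl, by simp⟩
    | cons x J ih =>
      obtain ⟨b, hb, h⟩ := ih
      refine ⟨max b (x.idx k + 1), by omega, fun y hy => ?_⟩
      rcases List.mem_cons.1 hy with rfl | hy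
      · omega
      · have := h y hy; omega
  obtain ⟨b, hnb, hb⟩ := hb J
  exact hn b _ _ (hk b hnb hb)

end Ultra

/-! ### Functional distortion systems: convergence of the back-and-forth sequence -/

section Tail

open Filter Topology

variable {M N : Structure L}

/-- The closure of a relation, sort by sort. -/
def Relation.closure (R : Relation M N) : Relation M N := fun s => _root_.closure (R s)

lemma Relation.Holds.exists_near {R : Relation M N} {δ : ℝ} (hδ : 0 < δ) :
    ∀ {Γ : List L.Sorts} {m : M.Env Γ} {n : N.Env Γ}, R.closure.Holds m n →
      ∃ m' n', R.Holds m' n' ∧ M.Near δ m m' ∧ N.Near δ n n'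
  | [], _, _, _ => ⟨(), (), trivial, fun _ x => (nomatch x), fun _ x => (nomatch x)⟩
  | _ :: _, m, n, h => by
    obtain ⟨m', n', h1, h2, h3⟩ := Relation.Holds.exists_near hδ h.2
    obtain ⟨q, hq, hd⟩ := Metric.mem_closure_iff.1 h.1 δ hδ
    rw [Prod.dist_eq, max_lt_iff] at hd
    exact ⟨(q.1, m'), (q.2, n'), ⟨hq, h1⟩, Structure.Near.cons hd.1 h2,
      Structure.Near.cons hd.2 h3⟩

/-- Passing to the closure does not increase the distortion, as formulas are continuous. -/
lemma distortion_closure_le {Δ : FormulaSet L} {R : Relation M N} {ε : ℝ} (hε : 0 ≤ ε)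
    (h : distortion Δ R ≤ ENNReal.ofReal ε) : distortion Δ R.closure ≤ ENNReal.ofReal ε := by
  refine distortion_le fun Γ φ hφ m n hmn => ?_
  rw [edist_dist, Real.dist_eq]
  refine ENNReal.ofReal_le_ofReal (le_of_forall_pos_le_add fun η hη => ?_)
  obtain ⟨δ, hδ, hu⟩ := φ.unif (η / 2) (half_pos hη)
  obtain ⟨m', n', h1, h2, h3⟩ := Relation.Holds.exists_near hδ hmn
  have h4 := (le_distortion R hφ h1).trans h
  rw [edist_dist, Real.dist_eq, ENNReal.ofReal_le_ofReal_iff hε] at h4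
  have h5 := hu M m m' h2
  have h6 := hu N n n' h3
  rw [abs_le] at *
  constructor <;> linarith

/-- If the limit relation on ultrapowers is single-valued, then far parts of the sequence behave
like a uniformly continuous function. -/
lemma exists_tail_uniform {U : Ultrafilter ℕ} (hU : (U : Filter ℕ) ≤ atTop) {p : ℕ → Pair M N}
    {s : L.Sorts} (h : ∀ x y y', (x, y) ∈ ultraRelation hU p s → (x, y') ∈ ultraRelation hU p s →
      y = y') {η : ℝ} (hη : 0 < η) :
    ∃ n, ∃ δ > 0, ∀ i ≥ n, ∀ j ≥ n, ∀ a b a' b', p i = ⟨s, a, b⟩ → p j = ⟨s, a', b'⟩ →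
      dist a a' < δ → dist b b' < η := by
  by_contra! H
  choose i hi j hj a b a' b' hp hp' hd hη' using
    fun k : ℕ => H k (1 / ((k : ℝ) + 1)) Nat.one_div_pos_of_nat
  have h1 : umk U a = umk U a' := umk_eq_iff.2 (squeeze_zero (fun k => dist_nonneg)
    (fun k => (hd k).le) (tendsto_one_div_add_atTop_nhds_zero_nat.mono_left hU))
  have h2 := h (umk U a) (umk U b) (umk U b') ⟨i, a, b, hi, hp, rfl, rfl⟩
    ⟨j, a', b', hj, hp', h1.symm, rfl⟩
  obtain ⟨k, hk⟩ := ((umk_eq_iff.1 h2).eventually (gt_mem_nhds hη)).exists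
  exact (hη' k).not_gt hk

/-- The pairs approximated by pairs of `p` of arbitrarily large index. -/
def tailRelation (p : ℕ → Pair M N) : Relation M N := fun s =>
  {x | ∀ δ > 0, ∀ n, ∃ i ≥ n, ∃ (a : M.carrier s) (b : N.carrier s), p i = ⟨s, a, b⟩ ∧
    dist x.1 a < δ ∧ dist x.2 b < δ}

lemma mem_tailRelation_swapSeq {p : ℕ → Pair M N} {s : L.Sorts} {x : M.carrier s}
    {y : N.carrier s} (h : (y, x) ∈ tailRelation (swapSeq p) s) : (x, y) ∈ tailRelation p s := by
  intro δ hδ n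
  obtain ⟨i, hi, b, a, hp, hb, ha⟩ := h δ hδ n
  exact ⟨i, hi, a, b, swapSeq_eq_iff.1 hp, ha, hb⟩

/-- Pairs of `p` whose first entries converge to `x` have second entries that form a Cauchy sequence, by
the uniformity of far parts of the sequence. -/
lemma LeftDense.exists_mem_tailRelation {p : ℕ → Pair M N} (hp : LeftDense p) {s : L.Sorts}
    (h : ∀ η > 0, ∃ n, ∃ δ > 0, ∀ i ≥ n, ∀ j ≥ n, ∀ a b a' b', p i = ⟨s, a, b⟩ →
      p j = ⟨s, a', b'⟩ → dist a a' < δ → dist b b' < η) (x : M.carrier s) :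
    ∃ y, (x, y) ∈ tailRelation p s := by
  choose i hi a b hpi hd using fun k : ℕ => hp s x (1 / ((k : ℝ) + 1)) Nat.one_div_pos_of_nat k
  have h0 : Tendsto (fun k => dist x (a k)) atTop (𝓝 0) :=
    squeeze_zero (fun k => dist_nonneg) (fun k => (hd k).le)
      tendsto_one_div_add_atTop_nhds_zero_nat
  have hb : CauchySeq b := by
    refine Metric.cauchySeq_iff.2 fun η hη => ?_
    obtain ⟨n, δ, hδ, hn⟩ := h η hη
    obtain ⟨K, hK⟩ := eventually_atTop.1 (h0.eventually (gt_mem_nhds (half_pos hδ)))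
    refine ⟨max K n, fun k hk l hl => hn (i k) ((le_of_max_le_right hk).trans (hi k)) (i l)
      ((le_of_max_le_right hl).trans (hi l)) _ _ _ _ (hpi k) (hpi l) ?_⟩
    have h1 := hK k (le_of_max_le_left hk)
    have h2 := hK l (le_of_max_le_left hl)
    have h3 := dist_triangle_left (a k) (a l) x
    linarith
  obtain ⟨y, hy⟩ := cauchySeq_tendsto_of_complete hb
  refine ⟨y, fun δ hδ n => ?_⟩
  obtain ⟨k, h1, h2, h3⟩ := ((h0.eventually (gt_mem_nhds hδ)).and
    ((hy.eventually (Metric.ball_mem_nhds y hδ)).and (eventually_ge_atTop n))).exists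
  exact ⟨i k, h3.trans (hi k), a k, b k, hpi k, h1, by rw [dist_comm]; exact h2⟩

lemma Relation.Holds.exists_listed {p : ℕ → Pair M N} {δ : ℝ} (hδ : 0 < δ) (n : ℕ) :
    ∀ {Γ : List L.Sorts} {m : M.Env Γ} {m' : N.Env Γ}, (tailRelation p).Holds m m' →
      ∃ k l l', Listed p n k l l' ∧ M.Near δ m l ∧ N.Near δ m' l'
  | [], _, _, _ => ⟨n, (), (), .nil le_rfl, fun _ x => (nomatch x), fun _ x => (nomatch x)⟩
  | _ :: _, m, m', h => by
    obtain ⟨k, l, l', h1, h2, h3⟩ := Relation.Holds.exists_listed hδ n h.2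
    obtain ⟨i, hi, a, b, hp, ha, hb⟩ := h.1 δ hδ k
    exact ⟨i + 1, (a, l), (b, l'), .cons (h1.mono hi) i.lt_succ_self hp, Structure.Near.cons ha h2,
      Structure.Near.cons hb h3⟩

variable {Δ : FormulaSet L}

/-- A tuple of the tail relation is approximated by listed tuples, whose indices are chosen one after the
other. -/
lemma distortion_tailRelation_le {p : ℕ → Pair M N} {ε : ℝ}
    (hp : ∀ Γ, ∀ φ ∈ Δ Γ, ∀ η > 0, ∃ n, ∀ k (m : M.Env Γ) (m' : N.Env Γ), Listed p n k m m' →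
      |φ.eval M m - φ.eval N m'| ≤ ε + η) :
    distortion Δ (tailRelation p) ≤ ENNReal.ofReal ε := by
  refine distortion_le fun Γ φ hφ m n hmn => ?_
  rw [edist_dist, Real.dist_eq]
  refine ENNReal.ofReal_le_ofReal (le_of_forall_pos_le_add fun η hη => ?_)
  obtain ⟨δ, hδ, hu⟩ := φ.unif (η / 3) (by positivity)
  obtain ⟨K, hK⟩ := hp Γ φ hφ (η / 3) (by positivity)
  obtain ⟨k, m', n', h1, h2, h3⟩ := Relation.Holds.exists_listed hδ K hmn
  have h4 := hK k m' n' h1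
  have h5 := hu M m m' h2
  have h6 := hu N n n' h3
  rw [abs_le] at *
  constructor <;> linarith

/-- For functional `Δ`, a sequence of pairs that exhausts both structures and has small distortion
in the limit converges to a correlation of small distortion. -/
lemma Functional.rho_le {T : Theory L} (hΔ : IsDistortionSystem T Δ) {εF : ℝ≥0}
    (hF : ∀ M N : Structure L, M.Models T → N.Models T →
      ∀ R : Relation M N, R.IsAlmostCor → (∀ s, IsClosed (R s)) → distortion Δ R < εF →
        ∀ s, ∃ e : M.carrier s ≃ᵤ N.carrier s, ∀ a b, (a, b) ∈ R s ↔ e a = b)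
    (hM : M.Models T) (hN : N.Models T) {p : ℕ → Pair M N} (hl : LeftDense p)
    (hr : LeftDense (swapSeq p)) {ε : ℝ} (hε0 : 0 ≤ ε) (hε : ENNReal.ofReal ε < εF)
    (hp : ∀ Γ, ∀ φ ∈ Δ Γ, ∀ η > 0, ∃ n, ∀ k (m : M.Env Γ) (m' : N.Env Γ), Listed p n k m m' →
      |φ.eval M m - φ.eval N m'| ≤ ε + η) :
    rho Δ M N ≤ ENNReal.ofReal ε := by
  have hU : (hyperfilter ℕ : Filter ℕ) ≤ atTop := Nat.hyperfilter_le_atTop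
  have hdom : ∀ s, (ultraRelation hU p).closure.dom s = Set.univ := fun s =>
    Set.eq_univ_of_forall fun x => by
      obtain ⟨y, hy⟩ := hl.exists_mem_ultraRelation (hU := hU) s x
      exact ⟨y, subset_closure hy⟩
  have hran : ∀ s, (ultraRelation hU p).closure.ran s = Set.univ := fun s =>
    Set.eq_univ_of_forall fun y => by
      obtain ⟨x, hx⟩ := hr.exists_mem_ultraRelation (hU := hU) s y
      exact ⟨x, subset_closure (mem_ultraRelation_swapSeq.1 hx)⟩
  have hgraph := hF (M.ultrapower _ hU) (N.ultrapower _ hU) hM.ultrapower hN.ultrapower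
    (ultraRelation hU p).closure
    ⟨⟨fun s => by rw [hdom]; exact dense_univ, fun f x _ => by rw [hdom]; trivial⟩,
      ⟨fun s => by rw [hran]; exact dense_univ, fun f x _ => by rw [hran]; trivial⟩⟩
    (fun s => isClosed_closure)
    ((distortion_closure_le hε0 (distortion_ultraRelation_le hΔ hp)).trans_lt hε)
  have hcor : (tailRelation p).IsCor := by
    intro s
    obtain ⟨e, he⟩ := hgraph s
    have he' : ∀ {x y}, (x, y) ∈ ultraRelation hU p s → e x = y := fun h =>
      (he _ _).1 (subset_closure h)
    refine ⟨Set.eq_univ_of_forall fun x => hl.exists_mem_tailRelation (fun η hη =>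
      exists_tail_uniform hU (fun x y y' h h' => (he' h).symm.trans (he' h')) hη) x,
      Set.eq_univ_of_forall fun y => ?_⟩
    obtain ⟨x, hx⟩ := hr.exists_mem_tailRelation (fun η hη => exists_tail_uniform hU
      (fun y x x' h h' => e.injective ((he' (mem_ultraRelation_swapSeq.1 h)).trans
        (he' (mem_ultraRelation_swapSeq.1 h')).symm)) hη) y
    exact ⟨x, mem_tailRelation_swapSeq hx⟩
  exact (iInf₂_le _ hcor).trans (distortion_tailRelation_le hp)

end Tail

/-! ### Models of the Scott sentence are at distance zero -/

section Scott

variable {T : Theory L} {Δ : FormulaSet L} {Ω : WeakModulus} {M N : Structure L}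

lemma leftDense_of_exhausting {p : ℕ → Pair M N} {A : (s : L.Sorts) → Set (M.carrier s)}
    (hA : ∀ s, Dense (A s)) (h : ∀ s, ∀ a ∈ A s, ∀ k, ∃ i ≥ k, ∃ b, p i = ⟨s, a, b⟩) :
    LeftDense p := by
  intro s a δ hδ n
  obtain ⟨a', ha', hd⟩ := (hA s).exists_dist_lt a hδ
  obtain ⟨i, hi, b, hp⟩ := h s a' ha' n
  exact ⟨i, hi, a', b, hp, hd⟩

/-- The formulas of the dense set `D` differ by at most `ε` on listed tuples, and approximate all
formulas of `Δ`. -/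
lemma Listed.exists_abs_sub_le (hΔ : IsDistortionSystem T Δ) (hΩ : Ω.ShiftIncreasing)
    (hΩF : SuitableFunctional T Δ Ω) (hM : M.Models T) (hN : N.Models T) {p : ℕ → Pair M N} {ε : ℝ}
    (hε0 : 0 ≤ ε) (hε : ε < 1 / 2)
    (hp : ∀ k, backForth Δ Ω M N 0 _ (leftEnv (initialList p k)) (rightEnv (initialList p k)) ≤
      ENNReal.ofReal ε) (Γ : List L.Sorts) (φ : Formula L Γ) (hφ : φ ∈ Δ Γ) (η : ℝ) (hη : 0 < η) :
    ∃ n, ∀ k (m : M.Env Γ) (m' : N.Env Γ), Listed p n k m m' →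
      |φ.eval M m - φ.eval N m'| ≤ ε + η := by
  obtain ⟨D, hD, hDd, hDr⟩ := hΩF
  obtain ⟨θ, hθ, hφθ⟩ := hDd Γ φ hφ (η / 2) (half_pos hη)
  obtain ⟨n, hn⟩ := hDr Γ θ hθ
  refine ⟨n, fun k m m' h => ?_⟩
  have h1 := h.abs_sub_le hΔ hΩ hM hN hε0 hε hp ((hD Γ).2 hθ) hn
  have h2 := hφθ M hM m
  have h3 := hφθ N hN m'
  rw [abs_le] at *
  constructor <;> linarith

/-- The back-and-forth construction, in its two versions, turns stabilized pseudo-metrics with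
`r_α(M; N) = 0` into correlations of arbitrarily small distortion. -/
lemma rho_eq_zero_of_backForth [Nonempty L.Sorts] [Countable L.Sorts] [Countable L.Func]
    (hΔ : IsDistortionSystem T Δ) (hΩ : Suitable T Δ Ω) (hM : M.Models T) (hN : N.Models T)
    (hMs : M.Separable) (hNs : N.Separable) {α : Ordinal.{0}}
    (hα : ∀ (Γ : List L.Sorts) (m : M.Env Γ) (n : N.Env Γ), backForth Δ Ω M N α Γ m n < 1 →
      backForth Δ Ω M N (α + 1) Γ m n ≤ backForth Δ Ω M N α Γ m n)
    (h0 : backForth Δ Ω M N α [] () () = 0) : rho Δ M N = 0 := by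
  -- Almost correlations relate dense sub-pre-structures, so these are to be exhausted.
  obtain ⟨A, hAc, hA⟩ := hMs.exists_countable_denseSub
  obtain ⟨B, hBc, hB⟩ := hNs.exists_countable_denseSub
  have hseq : ∀ ε : ℝ, 0 < ε → ε < 1 / 2 → ∃ p : ℕ → Pair M N,
      (∀ k, backForth Δ Ω M N 0 _ (leftEnv (initialList p k)) (rightEnv (initialList p k)) ≤
        ENNReal.ofReal ε) ∧ (∀ k, (p k).2.1 ∈ A (p k).1 ∧ (p k).2.2 ∈ B (p k).1) ∧
      (∀ s, ∀ a ∈ A s, ∀ k, ∃ i ≥ k, ∃ b, p i = ⟨s, a, b⟩) ∧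
      (∀ s, ∀ b ∈ B s, ∀ k, ∃ i ≥ k, ∃ a, p i = ⟨s, a, b⟩) := by
    intro ε hε hε'
    have h1 : ENNReal.ofReal ε < 1 := by
      rw [← ENNReal.ofReal_one, ENNReal.ofReal_lt_ofReal_iff one_pos]
      linarith
    obtain ⟨p, hp, h⟩ := exists_backForth_sequence (ε := ENNReal.ofReal ε)
      (fun Γ m n h => hα Γ m n (h.trans h1)) (by rw [h0]; exact ENNReal.ofReal_pos.2 hε)
      hAc hA.1 hBc hB.1
    exact ⟨p, fun k => (backForth_mono hΔ.rename zero_le _ _ _).trans (hp k).le, h⟩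
  refine nonpos_iff_eq_zero.1 (ENNReal.le_of_forall_pos_le_add fun η hη _ => ?_)
  rw [zero_add]
  have hη' : (0 : ℝ) < η := hη
  rcases hΩ with ⟨hs, ⟨hu, hΩu⟩ | ⟨⟨εF, hεF, hF⟩, hΩF⟩⟩
  -- In the u.u.c. case, the relation enumerated by the sequence is thickened to a correlation.
  · obtain ⟨δ, hδ, h⟩ := hu (η / 2) (by positivity)
    have hε : 0 < min ((η : ℝ) / 2) (1 / 4) := by positivity
    obtain ⟨p, hp, hpm, hpA, hpB⟩ := hseq _ hε (lt_of_le_of_lt (min_le_right _ _) (by norm_num))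
    have hdom : (seqRelation p).dom = A := funext fun s => Set.ext fun a => by
      refine ⟨?_, fun ha => ?_⟩
      · rintro ⟨b, k, hk⟩
        have := (hpm k).1
        rwa [hk] at this
      · obtain ⟨i, -, b, hi⟩ := hpA s a ha 0
        exact ⟨b, i, hi⟩
    have hran : (seqRelation p).ran = B := funext fun s => Set.ext fun b => by
      refine ⟨?_, fun hb => ?_⟩
      · rintro ⟨a, k, hk⟩
        have := (hpm k).2
        rwa [hk] at this
      · obtain ⟨i, -, a, hi⟩ := hpB s b hb 0
        exact ⟨a, i, hi⟩
    have hR : (seqRelation p).IsAlmostCor := ⟨by rwa [hdom], by rwa [hran]⟩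
    have hd := distortion_seqRelation_le hΔ hΩu hM hN hε.le
      (lt_of_le_of_lt (min_le_right _ _) (by norm_num)) hp
    refine (iInf₂_le _ (hR.isCor_thicken hδ)).trans ((h M N hM hN _ hR).trans ?_)
    refine (add_le_add_left (hd.trans (ENNReal.ofReal_le_ofReal (min_le_left _ _))) _).trans
      (le_of_eq ?_)
    rw [show ((η : ℝ) / 2) = ((η / 2 : ℝ≥0) : ℝ) by push_cast; rfl, ENNReal.ofReal_coe_nnreal,
      ← ENNReal.coe_add, add_halves]
  -- In the functional case, the sequence converges to a correlation.
  · have hεF' : (0 : ℝ) < εF := hεF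
    have hε : 0 < min (η : ℝ) (min (εF / 2) (1 / 4)) := by positivity
    have hε2 : min (η : ℝ) (min (εF / 2) (1 / 4)) < 1 / 2 :=
      lt_of_le_of_lt ((min_le_right _ _).trans (min_le_right _ _)) (by norm_num)
    obtain ⟨p, hp, -, hpA, hpB⟩ := hseq _ hε hε2
    have hεF2 : ENNReal.ofReal (min (η : ℝ) (min (εF / 2) (1 / 4))) < εF := by
      rw [← ENNReal.ofReal_coe_nnreal (p := εF), ENNReal.ofReal_lt_ofReal_iff hεF']
      exact lt_of_le_of_lt ((min_le_right _ _).trans (min_le_left _ _)) (half_lt_self hεF')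
    refine (Functional.rho_le hΔ hF hM hN (leftDense_of_exhausting hA.1 hpA)
      (leftDense_of_exhausting hB.1 fun s b hb k => ?_) hε.le hεF2
      (Listed.exists_abs_sub_le hΔ hs hΩF hM hN hε.le hε2 hp)).trans ?_
    · obtain ⟨i, hi, a, h⟩ := hpB s b hb k
      exact ⟨i, hi, a, swapSeq_eq_iff.2 h⟩
    · exact (ENNReal.ofReal_le_ofReal (min_le_left _ _)).trans (ENNReal.ofReal_coe_nnreal).le

/-- If `N` satisfies the Scott sentence, then density extends the stability of the pseudo-metrics below `1`
to all tuples. Conversely, at distance zero both properties expressed by the sentence pass from `M` to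
`N`. -/
lemma eval_scottSentence_nonpos_iff_rho [Nonempty L.Sorts] [Countable L.Sorts] [Countable L.Func]
    (hΔ : IsDistortionSystem T Δ) (hΩ : Suitable T Δ Ω)
    {ψ : (Γ : List L.Sorts) → ℕ → Formula L Γ} (hψ : IsDenseFamily T Δ Ω ψ) (hM : M.Models T)
    (hMs : M.Separable) (hN : N.Models T) (hNs : N.Separable)
    {a : (s : L.Sorts) → ℕ → M.carrier s} (ha : ∀ s, DenseRange (a s)) :
    (scottSentence Δ Ω M a ψ).eval N () ≤ 0 ↔ rho Δ M N = 0 := by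
  rw [eval_scottSentence_nonpos_iff hψ hM hN ha]
  constructor
  · rintro ⟨h0, h⟩
    refine rho_eq_zero_of_backForth hΔ hΩ hM hN hMs hNs (fun Γ m n hlt => ?_) h0
    refine backForth_le_of_dense m n (fun δ hδ => ?_) hlt
    obtain ⟨l, m', hm', hnear⟩ := exists_tuple_near ha hδ Γ m
    obtain ⟨rfl, hm'⟩ := Sigma.mk.inj hm'
    obtain rfl := eq_of_heq hm'
    refine ⟨tupleOf a l, n, hnear, fun s x => by simpa using hδ, fun hlt => ?_⟩
    have h1 := h l n
    unfold truncBF at h1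
    rw [min_eq_left hlt.le] at h1
    rcases min_choice (backForth Δ Ω M N (scottRank Δ Ω M + 1) _ (tupleOf a l) n) 1 with h2 | h2
    · rw [h2] at h1
      exact h1.ge
    · rw [h2] at h1
      exact absurd h1 hlt.ne
  · intro h
    refine ⟨backForth_eq_zero_of_rho h _, fun l n => ?_⟩
    have h1 := backForth_add_one_le_of_rho (Ω := Ω) h (exists_scottRank hΔ.rename ha).2
      (tupleOf a l) n
    unfold truncBF
    rw [le_antisymm h1 ((backForth_le_add_one hΔ.rename _).2 _ _ _)]

end Scott

end MetricLogic

theorem mainTheorem1 (L : MetricLogic.Language) [Nonempty L.Sorts]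
    [Countable L.Sorts] [Countable L.Func] [Countable L.Rel]
    (T : MetricLogic.Theory L) (Δ : MetricLogic.FormulaSet L)
    (hΔ : MetricLogic.IsDistortionSystem T Δ)
    (h : MetricLogic.UUC T Δ ∨ MetricLogic.Functional T Δ) :
    (∃ Ω : MetricLogic.WeakModulus, MetricLogic.Suitable T Δ Ω) ∧
    ∀ Ω : MetricLogic.WeakModulus, MetricLogic.Suitable T Δ Ω →
      (∃ ψ, MetricLogic.IsDenseFamily T Δ Ω ψ) ∧
      ∀ ψ, MetricLogic.IsDenseFamily T Δ Ω ψ →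
      ∀ M : MetricLogic.Structure L, M.Models T → M.Separable →
      ∀ a : (s : L.Sorts) → ℕ → M.carrier s, (∀ s, DenseRange (a s)) →
        (∃ I, MetricLogic.IsLωω Δ Ω (MetricLogic.scottSentence Δ Ω M a ψ) I) ∧
        ∀ N : MetricLogic.Structure L, N.Models T → N.Separable →
          ((MetricLogic.scottSentence Δ Ω M a ψ).eval N () ≤ 0 ↔ MetricLogic.rho Δ M N = 0) := by
  refine ⟨MetricLogic.exists_suitable h, fun Ω hΩ => ⟨hΔ.exists_isDenseFamily Ω,
    fun ψ hψ M hM hMs a ha => ⟨?_, fun N hN hNs =>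
      MetricLogic.eval_scottSentence_nonpos_iff_rho hΔ hΩ hψ hM hMs hN hNs ha⟩⟩⟩
  obtain ⟨b, -, -, hb⟩ := MetricLogic.isLωω_scottSentence hψ M a
    (MetricLogic.exists_scottRank (Ω := Ω) hΔ.rename ha).1
  exact ⟨_, hb⟩
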